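/- Let $(\Omega,\mu)$ be a probability space with an at most countable measurable partition $\{\Omega_j\}$, let $\theta\in(0,1)$, and let $T:\Omega\to\Omega$ be measure preserving and ergodic. For $y,y'\in\Omega$ let $s(y,y')$ be the least $n\ge 0$ such that $T^ny$ and $T^ny'$ lie in distinct partition elements, suppose that $s(y,y')=\infty$ if and only if $y=y'$, and put $d_\theta(y,y')=\theta^{s(y,y')}$. $T$ is a Gibbs–Markov map if each $T(\Omega_j)$ is a union of partition elements and $T|_{\Omega_j}:\Omega_j\to T(\Omega_j)$ is a bijection, measurable together with its inverse; $\inf_j\mu(T(\Omega_j))>0$; and a version $g>0$ of $d\mu/d(\mu\circ T)$ satisfies, for some $C>0$, $|\log g(y)-\log g(y')|\le C d_\theta(y,y')$ for all $j$ and all $y,y'\in\Omega_j$. It is mixing if $\mu(A\cap T^{-n}B)\to\mu(A)\mu(B)$ for all measurable $A,B$. For a real or complex function $f$ on $\Omega$ let $D_jf=\sup_{y\ne y'\in\Omega_j}|f(y)-f(y')|/d_\theta(y,y')$ and $|f|_\theta=\sup_jD_jf$. Let $\mathcal B_\theta$ be the space of bounded measurable $f:\Omega\to\mathbb C$ with $|f|_\theta<\infty$,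 with norm $\|f\|_\theta=|f|_\infty+|f|_\theta$. **Proposition.** Let $T$ be a mixing Gibbs–Markov map and let $v:\Omega\to\mathbb R$ be measurable with $\int v^2\,d\mu=\infty$, $|v|_\theta<\infty$, and, for some $C>0$, $D_jv\le C\inf_{\Omega_j}|v|$ for all $j$. Fix $\alpha\in(0,1)\cup(1,2]$ and assume (H1) $\mu(v>x)=(p+o(1))\,\ell(x)x^{-\alpha}$ and $\mu(v\le -x)=(q+o(1))\,\ell(x)x^{-\alpha}$ as $x\to\infty$, where $\ell$ is (measurable, eventually positive and) slowly varying, $p,q\ge0$ and $p+q=1$. Let $\ell_0=\ell$ if $\alpha\neq2$, and let $\ell_0(x)=\hat\ell(x)=1+\int_1^{1+x}\ell(u)u^{-1}\,du$ if $\alpha=2$, where in the latter case $\ell(u)/u$ is assumed integrable on bounded subintervals of $[1,\infty)$. Let $R$ be the transfer operator on $L^1(\mu;\mathbb C)$, $\int (Rf)\,g\,d\mu=\int f\,(g\circ T)\,d\mu$ for bounded measurable $g$, and $R(t)f=R(e^{itv}f)$ for $t\in\mathbb R$. Then $\mathcal B_\theta$ is a Banach space contained in $L^\infty(\mu)$ (the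 supremum $|f|_\infty$ equals the essential supremum, so $|f|_{L^\infty}\le\|f\|_\theta$) and contains the constants, each $R(t)$, $t\in\mathbb R$, restricts to a bounded operator on $\mathcal B_\theta$, and (H1)–(H3) hold with $\mathcal B=\mathcal B_\theta$. That is, with $\|\cdot\|$ the operator norm on $\mathcal B_\theta$ and $R'$ the derivative of $t\mapsto R(t)$ in this norm: (H2) There are $\varepsilon,C>0$ such that for all $|t|,|h|<\varepsilon$: (i) $\|R(t)\|\le C$; and if $\alpha\in(1,2]$, then $R$ is differentiable on $(-2\varepsilon,2\varepsilon)$ and $\|R'(t)\|\le C$. (ii) If $\alpha\in(0,1)$, then $\|R(t+h)-R(t)\|\le C|h|^\alpha\ell(1/|h|)$. (iii) If $\alpha\in(1,2]$, then for every $\alpha'\in(1,\alpha)$ there is $C'=C'(\alpha')>0$, not depending on $t,h$, with $\|R(t+h)-R(t)-hR'(0)\|\le C'|h|\,(|t|^{\alpha'-1}+|h|^{\alpha'-1})$. (iv) If $\alpha\in(1,2]$, then $\|R'(t+h)-R'(t)\|\le C|h|^{\alpha-1}\ell_0(1/|h|)$. (In (ii) and (iv) the right-hand side is read as $0$ when $h=0$.)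 (H3) $1$ is a simple eigenvalue of $R(0):\mathcal B_\theta\to\mathcal B_\theta$ (one-dimensional eigenspace, algebraic multiplicity one), and the rest of the spectrum of $R(0)$ is contained in a disk about $0$ of radius less than $1$. -/

import Mathlib

open Set Filter Topology MeasureTheory
open scoped ENNReal NNReal

noncomputable section

/-! ### Separation time and locally Lipschitz functions -/

/-- The times `n ≥ 0` at which `T^n y` and `T^n y'` lie in distinct elements of the partition. -/
def sepTimes {Ω ι : Type*} (T : Ω → Ω) (P : ι → Set Ω) (y y' : Ω) : Set ℕ :=
  {n | ¬ ∃ j, T^[n] y ∈ P j ∧ T^[n] y' ∈ P j}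

open Classical in
/-- `d_θ(y, y') = θ ^ s(y, y')`, where `s(y, y')` is the least time in `sepTimes`
(and `d_θ(y, y') = 0` if there is no such time, i.e. `s(y, y') = ∞`). -/
def dTheta {Ω ι : Type*} (T : Ω → Ω) (P : ι → Set Ω) (θ : ℝ) (y y' : Ω) : ℝ :=
  if (sepTimes T P y y').Nonempty then θ ^ sInf (sepTimes T P y y') else 0

/-- `D_j f = sup_{y, y' ∈ Ω_j} |f y - f y'| / d_θ(y, y')`; the pairs with `y = y'`
contribute `0 / 0 = 0` in `[0, ∞]`. -/
def lipOn {Ω ι E : Type*} [NormedAddCommGroup E] (T : Ω → Ω) (P : ι → Set Ω) (θ : ℝ)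
    (f : Ω → E) (j : ι) : ℝ≥0∞ :=
  ⨆ y ∈ P j, ⨆ y' ∈ P j, ‖f y - f y'‖ₑ / ENNReal.ofReal (dTheta T P θ y y')

/-- `|f|_θ = sup_j D_j f`. -/
def lipSemi {Ω ι E : Type*} [NormedAddCommGroup E] (T : Ω → Ω) (P : ι → Set Ω) (θ : ℝ)
    (f : Ω → E) : ℝ≥0∞ :=
  ⨆ j, lipOn T P θ f j

/-- `sup_y |f y|`. -/
def supNormE {Ω E : Type*} [NormedAddCommGroup E] (f : Ω → E) : ℝ≥0∞ := ⨆ y, ‖f y‖ₑ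

theorem lipSemi_zero {Ω ι E : Type*} [NormedAddCommGroup E] (T : Ω → Ω) (P : ι → Set Ω)
    (θ : ℝ) : lipSemi T P θ (0 : Ω → E) = 0 := by
  simp [lipSemi, lipOn]

theorem lipSemi_add_le {Ω ι E : Type*} [NormedAddCommGroup E] (T : Ω → Ω) (P : ι → Set Ω)
    (θ : ℝ) (f g : Ω → E) :
    lipSemi T P θ (f + g) ≤ lipSemi T P θ f + lipSemi T P θ g := by
  refine iSup_le fun j => iSup₂_le fun y hy => iSup₂_le fun y' hy' => ?_
  have h1 : ∀ u : Ω → E, ‖u y - u y'‖ₑ / ENNReal.ofReal (dTheta T P θ y y')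
      ≤ lipSemi T P θ u := fun u =>
    le_trans (le_trans (le_iSup₂ (f := fun y' (_ : y' ∈ P j) =>
        ‖u y - u y'‖ₑ / ENNReal.ofReal (dTheta T P θ y y')) y' hy')
      (le_iSup₂ (f := fun y (_ : y ∈ P j) => ⨆ y' ∈ P j,
        ‖u y - u y'‖ₑ / ENNReal.ofReal (dTheta T P θ y y')) y hy))
      (le_iSup (lipOn T P θ u) j)
  refine le_trans ?_ (add_le_add (h1 f) (h1 g))
  rw [← ENNReal.add_div]
  refine ENNReal.div_le_div_right ?_ _
  have : (f + g) y - (f + g) y' = (f y - f y') + (g y - g y') := by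
    simp only [Pi.add_apply]; abel
  rw [this]
  exact enorm_add_le _ _

theorem lipSemi_smul {Ω ι : Type*} (T : Ω → Ω) (P : ι → Set Ω)
    (θ : ℝ) (c : ℂ) (f : Ω → ℂ) :
    lipSemi T P θ (c • f) = ‖c‖ₑ * lipSemi T P θ f := by
  simp only [lipSemi, lipOn, ENNReal.mul_iSup]
  refine iSup_congr fun j => iSup_congr fun y => iSup_congr fun _ => iSup_congr fun y' =>
    iSup_congr fun _ => ?_
  rw [← mul_div_assoc, ← enorm_mul]
  simp [mul_sub]

theorem supNormE_add_le {Ω E : Type*} [NormedAddCommGroup E] (f g : Ω → E) :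
    supNormE (f + g) ≤ supNormE f + supNormE g :=
  iSup_le fun y => (enorm_add_le _ _).trans
    (add_le_add (le_iSup (fun y => ‖f y‖ₑ) y) (le_iSup (fun y => ‖g y‖ₑ) y))

theorem supNormE_smul {Ω : Type*} (c : ℂ) (f : Ω → ℂ) :
    supNormE (c • f) = ‖c‖ₑ * supNormE f := by
  simp [supNormE, ENNReal.mul_iSup, enorm_mul]

/-! ### The space `𝓑_θ` -/

/-- Bounded measurable functions `f : Ω → ℂ` with `|f|_θ < ∞`, as a space of functions. -/
def lipSubmodule {Ω ι : Type*} [MeasurableSpace Ω] (T : Ω → Ω) (P : ι → Set Ω) (θ : ℝ) :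
    Submodule ℂ (Ω → ℂ) where
  carrier := {f | Measurable f ∧ supNormE f < ⊤ ∧ lipSemi T P θ f < ⊤}
  add_mem' := fun {f g} hf hg => ⟨hf.1.add hg.1,
    (supNormE_add_le f g).trans_lt (ENNReal.add_lt_top.2 ⟨hf.2.1, hg.2.1⟩),
    (lipSemi_add_le T P θ f g).trans_lt (ENNReal.add_lt_top.2 ⟨hf.2.2, hg.2.2⟩)⟩
  zero_mem' := ⟨measurable_const, by simp [supNormE], by simp [lipSemi_zero]⟩
  smul_mem' := fun c f hf => ⟨hf.1.const_smul c,
    by rw [supNormE_smul]; exact ENNReal.mul_lt_top enorm_lt_top hf.2.1,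
    by rw [lipSemi_smul]; exact ENNReal.mul_lt_top enorm_lt_top hf.2.2⟩

/-- The space `𝓑_θ` (complex valued functions, so that the operators `f ↦ R (e^{itv} f)`
can act on it). -/
def BTheta {Ω ι : Type*} [MeasurableSpace Ω] (T : Ω → Ω) (P : ι → Set Ω) (θ : ℝ) : Type _ :=
  lipSubmodule T P θ

namespace BTheta

instance {Ω ι : Type*} [MeasurableSpace Ω] (T : Ω → Ω) (P : ι → Set Ω) (θ : ℝ) :
    AddCommGroup (BTheta T P θ) :=
  inferInstanceAs (AddCommGroup (lipSubmodule T P θ))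

instance {Ω ι : Type*} [MeasurableSpace Ω] (T : Ω → Ω) (P : ι → Set Ω) (θ : ℝ) :
    Module ℂ (BTheta T P θ) :=
  inferInstanceAs (Module ℂ (lipSubmodule T P θ))

/-- The underlying function of an element of `𝓑_θ`. -/
def toFun {Ω ι : Type*} [MeasurableSpace Ω] {T : Ω → Ω} {P : ι → Set Ω} {θ : ℝ}
    (f : BTheta T P θ) : Ω → ℂ := Subtype.val (p := fun f => f ∈ lipSubmodule T P θ) f

instance {Ω ι : Type*} [MeasurableSpace Ω] (T : Ω → Ω) (P : ι → Set Ω) (θ : ℝ) :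
    CoeFun (BTheta T P θ) (fun _ => Ω → ℂ) := ⟨toFun⟩

/-- `‖f‖_θ = |f|_∞ + |f|_θ`. -/
instance {Ω ι : Type*} [MeasurableSpace Ω] (T : Ω → Ω) (P : ι → Set Ω) (θ : ℝ) :
    Norm (BTheta T P θ) :=
  ⟨fun f => (supNormE f.toFun + lipSemi T P θ f.toFun).toReal⟩

theorem mem {Ω ι : Type*} [MeasurableSpace Ω] {T : Ω → Ω} {P : ι → Set Ω} {θ : ℝ}
    (f : BTheta T P θ) :
    Measurable f.toFun ∧ supNormE f.toFun < ⊤ ∧ lipSemi T P θ f.toFun < ⊤ :=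
  Subtype.property (p := fun f => f ∈ lipSubmodule T P θ) f

theorem norm_core {Ω ι : Type*} [MeasurableSpace Ω] (T : Ω → Ω) (P : ι → Set Ω) (θ : ℝ) :
    NormedSpace.Core ℂ (BTheta T P θ) where
  norm_nonneg _ := ENNReal.toReal_nonneg
  norm_smul c f := by
    change (supNormE (c • f.toFun) + lipSemi T P θ (c • f.toFun)).toReal
      = ‖c‖ * (supNormE f.toFun + lipSemi T P θ f.toFun).toReal
    rw [supNormE_smul, lipSemi_smul, ← mul_add, ENNReal.toReal_mul, toReal_enorm]
  norm_triangle f g := by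
    change (supNormE (f.toFun + g.toFun) + lipSemi T P θ (f.toFun + g.toFun)).toReal
      ≤ (supNormE f.toFun + lipSemi T P θ f.toFun).toReal
        + (supNormE g.toFun + lipSemi T P θ g.toFun).toReal
    have hf := (ENNReal.add_lt_top.2 f.mem.2).ne
    have hg := (ENNReal.add_lt_top.2 g.mem.2).ne
    rw [← ENNReal.toReal_add hf hg]
    refine ENNReal.toReal_mono (ENNReal.add_ne_top.2 ⟨hf, hg⟩) ?_
    calc _ ≤ (supNormE f.toFun + supNormE g.toFun)
          + (lipSemi T P θ f.toFun + lipSemi T P θ g.toFun) :=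
          add_le_add (supNormE_add_le _ _) (lipSemi_add_le _ _ _ _ _)
      _ = _ := by abel
  norm_eq_zero_iff f := by
    change (supNormE f.toFun + lipSemi T P θ f.toFun).toReal = 0 ↔ f = 0
    constructor
    · intro h
      rw [ENNReal.toReal_eq_zero_iff] at h
      have h0 : supNormE f.toFun = 0 :=
        (add_eq_zero.1 (h.resolve_right (ENNReal.add_lt_top.2 f.mem.2).ne)).1
      refine Subtype.ext (funext fun y => ?_)
      exact enorm_eq_zero.1 (ENNReal.iSup_eq_zero.1 h0 y)
    · rintro rfl
      have h1 : (0 : BTheta T P θ).toFun = 0 := rfl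
      rw [h1, lipSemi_zero]
      simp [supNormE]

instance {Ω ι : Type*} [MeasurableSpace Ω] (T : Ω → Ω) (P : ι → Set Ω) (θ : ℝ) :
    NormedAddCommGroup (BTheta T P θ) :=
  NormedAddCommGroup.ofCore (norm_core T P θ)

instance {Ω ι : Type*} [MeasurableSpace Ω] (T : Ω → Ω) (P : ι → Set Ω) (θ : ℝ) :
    NormedSpace ℂ (BTheta T P θ) :=
  NormedSpace.ofCore (norm_core T P θ)

end BTheta

/-! ### Gibbs–Markov maps -/

/-- The measure `μ ∘ T`, given by `A ↦ ∑ j, μ (T (A ∩ Ω_j))`. -/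
def compMeasure {Ω ι : Type*} [MeasurableSpace Ω] (μ : Measure Ω) (T : Ω → Ω)
    (P : ι → Set Ω) : Measure Ω :=
  Measure.sum fun j => (μ.comap (fun x : P j => T x)).map Subtype.val

/-- `T` is a Gibbs–Markov map of `(Ω, μ)` with respect to the partition `P = {Ω_j}` and with
distortion controlled by `d_θ`. -/
structure IsGibbsMarkov {Ω ι : Type*} [MeasurableSpace Ω] (μ : Measure Ω) (T : Ω → Ω)
    (P : ι → Set Ω) (θ : ℝ) : Prop where
  ergodic : Ergodic T μ
  measurableSet : ∀ j, MeasurableSet (P j)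
  disjoint : Pairwise (Function.onFun Disjoint P)
  cover : ⋃ j, P j = univ
  theta_pos : 0 < θ
  theta_lt_one : θ < 1
  /-- `s(y, y') = ∞` only if `y = y'` -/
  separating : ∀ y y', sepTimes T P y y' = ∅ → y = y'
  markov : ∀ j, ∃ J : Set ι, T '' P j = ⋃ k ∈ J, P k
  injOn : ∀ j, InjOn T (P j)
  measurable_image : ∀ j, ∀ A ⊆ P j, MeasurableSet A → MeasurableSet (T '' A)
  big_images : ∃ c : ℝ≥0∞, 0 < c ∧ ∀ j, c ≤ μ (T '' P j)
  /-- a version `g` of `dμ / d(μ ∘ T)` is positive with `log g` Lipschitz on each `Ω_j`,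
  uniformly in `j` -/
  distortion : ∃ g : Ω → ℝ, Measurable g ∧ (∀ y, 0 < g y) ∧
    μ = (compMeasure μ T P).withDensity (fun y => ENNReal.ofReal (g y)) ∧
    ∃ C : ℝ, ∀ j, ∀ y ∈ P j, ∀ y' ∈ P j,
      |Real.log (g y) - Real.log (g y')| ≤ C * dTheta T P θ y y'

/-- `μ (A ∩ T⁻ⁿ B) → μ(A) μ(B)` for all measurable `A`, `B`. -/
def IsMixing {Ω : Type*} [MeasurableSpace Ω] (μ : Measure Ω) (T : Ω → Ω) : Prop :=
  ∀ A B : Set Ω, MeasurableSet A → MeasurableSet B →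
    Tendsto (fun n : ℕ => μ (A ∩ T^[n] ⁻¹' B)) atTop (𝓝 (μ A * μ B))

/-! ### Regular variation and hypothesis (H1) -/

/-- `ℓ` is slowly varying at infinity. -/
structure SlowlyVarying (ℓ : ℝ → ℝ) : Prop where
  measurable : Measurable ℓ
  eventually_pos : ∀ᶠ x in atTop, 0 < ℓ x
  tendsto : ∀ c : ℝ, 0 < c → Tendsto (fun x => ℓ (c * x) / ℓ x) atTop (𝓝 1)

/-- `ℓ̂(x) = 1 + ∫_1^{1+x} ℓ(u)/u du`. -/
def ellHat (ℓ : ℝ → ℝ) (x : ℝ) : ℝ := 1 + ∫ u in (1 : ℝ)..(1 + x), ℓ u / u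

open Classical in
/-- `ℓ₀ = ℓ̂` if `α = 2`, and `ℓ₀ = ℓ` otherwise. -/
def ellZero (α : ℝ) (ℓ : ℝ → ℝ) : ℝ → ℝ := if α = 2 then ellHat ℓ else ℓ

/-- (H1): `μ(v > x) = p ℓ(x) x^{-α} (1 + o(1))`, `μ(v ≤ -x) = q ℓ(x) x^{-α} (1 + o(1))`
with `ℓ` slowly varying, `p, q ≥ 0` and `p + q = 1`; when `p = 0` or `q = 0` the respective
tail is `o(ℓ(x) x^{-α})`. -/
structure HypH1 {Ω : Type*} [MeasurableSpace Ω] (μ : Measure Ω) (v : Ω → ℝ)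
    (α p q : ℝ) (ℓ : ℝ → ℝ) : Prop where
  slowlyVarying : SlowlyVarying ℓ
  p_nonneg : 0 ≤ p
  q_nonneg : 0 ≤ q
  add_eq_one : p + q = 1
  right_tail : Tendsto (fun x : ℝ => μ.real {y | x < v y} / (ℓ x * x ^ (-α))) atTop (𝓝 p)
  left_tail : Tendsto (fun x : ℝ => μ.real {y | v y ≤ -x} / (ℓ x * x ^ (-α))) atTop (𝓝 q)

/-! ### The transfer operator -/

/-- `h` is the image of `f` under the transfer operator of `T`:
`∫ h g dμ = ∫ f (g ∘ T) dμ` for all bounded measurable `g`. -/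
def IsTransferImage {Ω : Type*} [MeasurableSpace Ω] (μ : Measure Ω) (T : Ω → Ω)
    (f h : Ω → ℂ) : Prop :=
  Integrable h μ ∧ ∀ g : Ω → ℂ, Measurable g → (∃ M : ℝ, ∀ x, ‖g x‖ ≤ M) →
    ∫ x, h x * g x ∂μ = ∫ x, f x * g (T x) ∂μ

theorem exists_isTransferImage {Ω : Type*} [MeasurableSpace Ω] {μ : Measure Ω}
    [IsProbabilityMeasure μ] {T : Ω → Ω} (hT : MeasurePreserving T μ μ) {f : Ω → ℂ}
    (hf : Integrable f μ) : ∃ h, IsTransferImage μ T f h := by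
  have hm : MeasurableSpace.comap T inferInstance ≤ (inferInstance : MeasurableSpace Ω) :=
    hT.measurable.comap_le
  obtain ⟨h, hh, hcomp⟩ := (stronglyMeasurable_condExp
    (m := MeasurableSpace.comap T inferInstance) (μ := μ) (f := f)).exists_eq_measurable_comp
  have hint : Integrable (h ∘ T) μ := by rw [← hcomp]; exact integrable_condExp
  have hhint : Integrable h μ :=
    (hT.integrable_comp hh.aestronglyMeasurable).1 hint
  refine ⟨h, hhint, fun g hg ⟨M, hM⟩ => ?_⟩
  have hgT : StronglyMeasurable[MeasurableSpace.comap T inferInstance] (fun x => g (T x)) :=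
    (hg.comp (comap_measurable T)).stronglyMeasurable
  have hfg : Integrable (fun x => f x * g (T x)) μ :=
    hf.mul_bdd (c := M) (hgT.mono hm).aestronglyMeasurable (ae_of_all _ fun x => hM (T x))
  have key := condExp_bilin_of_stronglyMeasurable_right (μ := μ)
    (m := MeasurableSpace.comap T inferInstance)
    (ContinuousLinearMap.mul ℝ ℂ) (f := f) (g := fun x => g (T x)) hgT hfg hf
  calc ∫ x, h x * g x ∂μ = ∫ x, h (T x) * g (T x) ∂μ := by
        have hgh : AEStronglyMeasurable (fun x => h x * g x) (μ.map T) :=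
          hh.aestronglyMeasurable.mul hg.aestronglyMeasurable
        have := integral_map hT.measurable.aemeasurable hgh
        rwa [hT.map_eq] at this
    _ = ∫ x, (μ[fun x => f x * g (T x) | MeasurableSpace.comap T inferInstance]) x ∂μ := by
        refine integral_congr_ae ?_
        filter_upwards [key] with x hx
        have hx' := congrFun hcomp x
        simp only [Function.comp_apply] at hx'
        simp only [ContinuousLinearMap.mul_apply'] at hx
        rw [← hx', ← hx]
    _ = ∫ x, f x * g (T x) ∂μ := integral_condExp hm

open Classical in
/-- The transfer operator `R` of `T` on integrable functions (unique up to null sets). -/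
def transferOp {Ω : Type*} [MeasurableSpace Ω] (μ : Measure Ω) (T : Ω → Ω)
    (f : Ω → ℂ) : Ω → ℂ :=
  if h : ∃ h, IsTransferImage μ T f h then h.choose else 0

theorem transferOp_spec {Ω : Type*} [MeasurableSpace Ω] {μ : Measure Ω}
    [IsProbabilityMeasure μ] {T : Ω → Ω} (hT : MeasurePreserving T μ μ) {f : Ω → ℂ}
    (hf : Integrable f μ) : IsTransferImage μ T f (transferOp μ T f) := by
  have h := exists_isTransferImage hT hf
  rw [transferOp, dif_pos h]
  exact h.choose_spec

theorem IsTransferImage.ae_eq {Ω : Type*} [MeasurableSpace Ω] {μ : Measure Ω}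
    {T : Ω → Ω} {f h h' : Ω → ℂ}
    (H : IsTransferImage μ T f h) (H' : IsTransferImage μ T f h') : h =ᵐ[μ] h' := by
  refine Integrable.ae_eq_of_forall_setIntegral_eq h h' H.1 H'.1 fun s hs _ => ?_
  have hb : ∃ M : ℝ, ∀ x, ‖s.indicator (fun _ => (1 : ℂ)) x‖ ≤ M :=
    ⟨1, fun x => by by_cases hx : x ∈ s <;> simp [hx]⟩
  have e := (H.2 _ (measurable_const.indicator hs) hb).trans
    (H'.2 _ (measurable_const.indicator hs) hb).symm
  have e' : ∀ u : Ω → ℂ, ∫ x, u x * s.indicator (fun _ => (1 : ℂ)) x ∂μ = ∫ x in s, u x ∂μ := by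
    intro u
    rw [← integral_indicator hs]
    refine integral_congr_ae (ae_of_all _ fun x => ?_)
    by_cases hx : x ∈ s <;> simp [hx]
  rwa [e', e'] at e

/-- The perturbed operator `R(t) f = R (e^{itv} f)`. -/
def perturbedOp {Ω : Type*} [MeasurableSpace Ω] (μ : Measure Ω) (T : Ω → Ω) (v : Ω → ℝ)
    (t : ℝ) (f : Ω → ℂ) : Ω → ℂ :=
  transferOp μ T fun y => Complex.exp (Complex.I * (t * v y : ℝ)) * f y

/-! ### Hypotheses (H2) and (H3) for a family of operators on a Banach space -/

/-- (H2), where `R'(t)` is the derivative of `t ↦ R(t)` in operator norm. In (iii) the constant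
may depend on `α'`. -/
def HypH2 {B : Type*} [NormedAddCommGroup B] [NormedSpace ℂ B] (R : ℝ → B →L[ℂ] B)
    (α : ℝ) (ℓ : ℝ → ℝ) : Prop :=
  ∃ ε : ℝ, 0 < ε ∧ ∃ C : ℝ, 0 < C ∧
    -- (i)
    (∀ t : ℝ, |t| < ε → ‖R t‖ ≤ C) ∧
    (1 < α → (∀ t : ℝ, |t| < 2 * ε → DifferentiableAt ℝ R t) ∧
      ∀ t : ℝ, |t| < ε → ‖deriv R t‖ ≤ C) ∧
    -- (ii)
    (α < 1 → ∀ t h : ℝ, |t| < ε → |h| < ε →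
      ‖R (t + h) - R t‖ ≤ C * (|h| ^ α * ℓ (1 / |h|))) ∧
    -- (iii)
    (1 < α → ∀ α' : ℝ, 1 < α' → α' < α → ∃ C' : ℝ, 0 < C' ∧
      ∀ t h : ℝ, |t| < ε → |h| < ε →
        ‖R (t + h) - R t - h • deriv R 0‖ ≤ C' * (|h| * (|t| ^ (α' - 1) + |h| ^ (α' - 1)))) ∧
    -- (iv)
    (1 < α → ∀ t h : ℝ, |t| < ε → |h| < ε →
      ‖deriv R (t + h) - deriv R t‖ ≤ C * (|h| ^ (α - 1) * ellZero α ℓ (1 / |h|)))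

/-- (H3): `1` is a simple eigenvalue of `A` (one-dimensional eigenspace, complemented by the
range of `A - 1`, i.e. algebraic multiplicity one), and the rest of the spectrum lies in a disk
of radius less than one. -/
def HypH3 {B : Type*} [NormedAddCommGroup B] [NormedSpace ℂ B] (A : B →L[ℂ] B) : Prop :=
  Module.finrank ℂ (LinearMap.ker (A - 1).toLinearMap) = 1 ∧
  IsCompl (LinearMap.ker (A - 1).toLinearMap) (LinearMap.range (A - 1).toLinearMap) ∧
  ∃ r : ℝ, r < 1 ∧ ∀ z ∈ spectrum ℂ A, z ≠ 1 → ‖z‖ ≤ r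

end

set_option linter.unusedSectionVars false

noncomputable section

/-! ### The separation metric -/

section Separation

variable {Ω ι : Type*} {T : Ω → Ω} {P : ι → Set Ω} {θ : ℝ}

/-! The transfer operator is handled pointwise, as the sum `branchSum` over the inverse branches of
T with weights given by g = dμ/d(μ∘T). Bounded distortion and big images give g ≤ C μ(Ω_j) on Ω_j,
with Lipschitz constant at most C μ(Ω_j) there (`exists_isWeight`). Inverse branches contract d_θ by
θ, and by the Markov property two points of one partition element have the same inverse branches, so
the sums at these points can be compared term by term.

The engine for (H2) is `DominatedBy.norm_op_le`: if a multiplier u is bounded and Lipschitz on each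
Ω_j with constants at most ψ(z) for every z in Ω_j, then f ↦ R(uf) has operator norm at most 3C ∫ψ
on 𝓑_θ. R(t), R'(t), their increments and the Taylor remainder are all of this form. The condition
D_j v ≤ C inf |v| makes |v| comparable to itself on each Ω_j, so ψ can be written in terms of |v|.
What remains are the truncated moments E min(1, |h||v|) for α < 1 and E |v| min(1, |h||v|) for α >
1. They are estimated by doubling: a relation between the moments at x and 2x is iterated, using
only the ratio of the tails at x and 2x. For α = 2 the error made at each doubling is absorbed by
the growth of `ellHat`, and the infinite second moment removes the additive constant. Errors linear
in |h| are harmless because |h| itself is O of the truncated moment, v not being almost everywhere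
zero. Finally (iii) follows from a Hölder bound on R' and the mean value inequality.

For (H3) it is enough that some power R(0)^N is at distance less than 1 from the projection f ↦ ∫f
onto the constants (`hypH3_of_norm_pow_sub_lt_one`). The Lasota–Yorke inequality reduces this to
making the iterates of mean-zero f small in sup norm, uniformly on the unit ball. Up to points that
leave a finite alphabet, f is a combination of finitely many cylinder indicators, so mixing makes
the averages of R^m f over these cylinders uniformly small. Regularity then gives smallness at every
point that stays in the alphabet, and n more iterates average out the points that leave it. A last n
iterates shrink the Lipschitz seminorm. -/

theorem dTheta_nonneg (hθ : 0 ≤ θ) (y y' : Ω) : 0 ≤ dTheta T P θ y y' := by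
  unfold dTheta; split_ifs <;> positivity

theorem dTheta_le_pow (hθ : 0 ≤ θ) (hθ1 : θ ≤ 1) {y y' : Ω} {n : ℕ}
    (h : ∀ k < n, ∃ j, T^[k] y ∈ P j ∧ T^[k] y' ∈ P j) : dTheta T P θ y y' ≤ θ ^ n := by
  unfold dTheta
  split_ifs with hne
  · refine pow_le_pow_of_le_one hθ hθ1 ?_
    by_contra hlt
    exact Nat.sInf_mem hne (h _ (not_le.1 hlt))
  · positivity

theorem dTheta_le_one (hθ : 0 ≤ θ) (hθ1 : θ ≤ 1) (y y' : Ω) : dTheta T P θ y y' ≤ 1 := by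
  simpa using dTheta_le_pow (T := T) (P := P) (y := y) (y' := y') (n := 0) hθ hθ1 (by simp)

theorem dTheta_pos (hθ : 0 < θ) {y y' : Ω} (h : (sepTimes T P y y').Nonempty) :
    0 < dTheta T P θ y y' := by
  unfold dTheta; rw [if_pos h]; positivity

/-- Time 0 does not separate y and y', so their separation time is one more than that of their
images. Read backwards, inverse branches contract by θ. -/
theorem dTheta_le_mul_dTheta_apply (hθ : 0 ≤ θ) {y y' : Ω}
    (h : ∃ j, y ∈ P j ∧ y' ∈ P j) :
    dTheta T P θ y y' ≤ θ * dTheta T P θ (T y) (T y') := by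
  have key : ∀ n, n + 1 ∈ sepTimes T P y y' ↔ n ∈ sepTimes T P (T y) (T y') := fun n => Iff.rfl
  by_cases hne : (sepTimes T P y y').Nonempty
  · have h0 : sInf (sepTimes T P y y') ≠ 0 := by
      intro h0
      have := Nat.sInf_mem hne
      rw [h0] at this
      exact this h
    obtain ⟨m, hm⟩ := Nat.exists_eq_succ_of_ne_zero h0
    have hmem : m ∈ sepTimes T P (T y) (T y') := by
      rw [← key, ← Nat.succ_eq_add_one, ← hm]; exact Nat.sInf_mem hne
    have hmin : sInf (sepTimes T P (T y) (T y')) = m := by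
      refine le_antisymm (Nat.sInf_le hmem) ?_
      have := Nat.sInf_le ((key _).2 (Nat.sInf_mem ⟨m, hmem⟩))
      omega
    unfold dTheta
    rw [if_pos hne, if_pos ⟨m, hmem⟩, hmin, hm, pow_succ, mul_comm]
  · have : dTheta T P θ y y' = 0 := by unfold dTheta; rw [if_neg hne]
    rw [this]
    exact mul_nonneg hθ (dTheta_nonneg hθ _ _)

end Separation

/-! ### Lipschitz seminorms in terms of pointwise bounds -/

section Lip

variable {Ω ι E : Type*} [NormedAddCommGroup E] {T : Ω → Ω} {P : ι → Set Ω} {θ : ℝ}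

/-- A vanishing distance would make the quotient uninformative; but it only occurs when the points
are never separated, hence equal. -/
theorem enorm_sub_le_of_lipOn_le (hθ : 0 < θ)
    (hsep : ∀ y y', sepTimes T P y y' = ∅ → y = y')
    {f : Ω → E} {D : ℝ} (hD : 0 ≤ D) {j : ι} (h : lipOn T P θ f j ≤ ENNReal.ofReal D)
    {y y' : Ω} (hy : y ∈ P j) (hy' : y' ∈ P j) :
    ‖f y - f y'‖ ≤ D * dTheta T P θ y y' := by
  rcases (sepTimes T P y y').eq_empty_or_nonempty with he | hne
  · rw [hsep _ _ he]
    simpa using mul_nonneg hD (dTheta_nonneg hθ.le _ _)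
  have hd := dTheta_pos (T := T) (P := P) hθ hne
  have h1 : ‖f y - f y'‖ₑ / ENNReal.ofReal (dTheta T P θ y y') ≤ ENNReal.ofReal D :=
    le_trans (le_trans (le_iSup₂ (f := fun y' (_ : y' ∈ P j) =>
        ‖f y - f y'‖ₑ / ENNReal.ofReal (dTheta T P θ y y')) y' hy')
      (le_iSup₂ (f := fun y (_ : y ∈ P j) => ⨆ y' ∈ P j,
        ‖f y - f y'‖ₑ / ENNReal.ofReal (dTheta T P θ y y')) y hy)) h
  rw [ENNReal.div_le_iff (by simpa using hd) ENNReal.ofReal_ne_top,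
    ← ENNReal.ofReal_mul hD, ← ofReal_norm] at h1
  exact (ENNReal.ofReal_le_ofReal_iff (by positivity)).1 h1

theorem lipSemi_le_ofReal {f : Ω → E} {D : ℝ} (hθ : 0 ≤ θ)
    (h : ∀ j, ∀ y ∈ P j, ∀ y' ∈ P j, ‖f y - f y'‖ ≤ D * dTheta T P θ y y') :
    lipSemi T P θ f ≤ ENNReal.ofReal D := by
  refine iSup_le fun j => iSup₂_le fun y hy => iSup₂_le fun y' hy' => ?_
  refine ENNReal.div_le_of_le_mul ?_
  rw [← ENNReal.ofReal_mul' (dTheta_nonneg hθ _ _), ← ofReal_norm]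
  exact ENNReal.ofReal_le_ofReal (h j y hy y' hy')

theorem norm_sub_le_of_lipSemi_lt_top (hθ : 0 < θ)
    (hsep : ∀ y y', sepTimes T P y y' = ∅ → y = y')
    {f : Ω → E} (h : lipSemi T P θ f < ⊤) {j : ι}
    {y y' : Ω} (hy : y ∈ P j) (hy' : y' ∈ P j) :
    ‖f y - f y'‖ ≤ (lipSemi T P θ f).toReal * dTheta T P θ y y' := by
  refine enorm_sub_le_of_lipOn_le hθ hsep ENNReal.toReal_nonneg ?_ hy hy'
  rw [ENNReal.ofReal_toReal h.ne]
  exact le_iSup (lipOn T P θ f) j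

end Lip

/-! ### Norm estimates and completeness of 𝓑_θ. -/

namespace BTheta

variable {Ω ι : Type*} [MeasurableSpace Ω] {T : Ω → Ω} {P : ι → Set Ω} {θ : ℝ}

/-- `|f|_∞` as a real number. -/
def sup (f : BTheta T P θ) : ℝ := (supNormE f.toFun).toReal

/-- `|f|_θ` as a real number. -/
def lip (f : BTheta T P θ) : ℝ := (lipSemi T P θ f.toFun).toReal

theorem norm_eq (f : BTheta T P θ) : ‖f‖ = f.sup + f.lip :=
  ENNReal.toReal_add f.mem.2.1.ne f.mem.2.2.ne

theorem sup_nonneg (f : BTheta T P θ) : 0 ≤ f.sup := ENNReal.toReal_nonneg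

theorem lip_nonneg (f : BTheta T P θ) : 0 ≤ f.lip := ENNReal.toReal_nonneg

theorem sup_le_norm (f : BTheta T P θ) : f.sup ≤ ‖f‖ := by
  rw [norm_eq]; linarith [f.lip_nonneg]

theorem lip_le_norm (f : BTheta T P θ) : f.lip ≤ ‖f‖ := by
  rw [norm_eq]; linarith [f.sup_nonneg]

theorem norm_apply_le (f : BTheta T P θ) (y : Ω) : ‖f y‖ ≤ f.sup := by
  rw [← toReal_enorm]
  exact ENNReal.toReal_mono f.mem.2.1.ne (le_iSup (fun y => ‖f y‖ₑ) y)

theorem norm_apply_sub_le (hθ : 0 < θ)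
    (hsep : ∀ y y', sepTimes T P y y' = ∅ → y = y') (f : BTheta T P θ)
    {j : ι} {y y' : Ω} (hy : y ∈ P j) (hy' : y' ∈ P j) :
    ‖f y - f y'‖ ≤ f.lip * dTheta T P θ y y' :=
  norm_sub_le_of_lipSemi_lt_top hθ hsep f.mem.2.2 hy hy'

theorem sup_le {f : BTheta T P θ} {M : ℝ} (hM : 0 ≤ M) (h : ∀ y, ‖f y‖ ≤ M) : f.sup ≤ M := by
  refine ENNReal.toReal_le_of_le_ofReal hM (iSup_le fun y => ?_)
  rw [← ofReal_norm]
  exact ENNReal.ofReal_le_ofReal (h y)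

theorem lip_le (hθ : 0 ≤ θ) {f : BTheta T P θ} {D : ℝ} (hD : 0 ≤ D)
    (h : ∀ j, ∀ y ∈ P j, ∀ y' ∈ P j, ‖f y - f y'‖ ≤ D * dTheta T P θ y y') : f.lip ≤ D :=
  ENNReal.toReal_le_of_le_ofReal hD (lipSemi_le_ofReal hθ h)

/-- The element of `𝓑_θ` given by a measurable function with a uniform bound and a uniform
Lipschitz constant. -/
def mk (f : Ω → ℂ) (hf : Measurable f) (hb : ∃ M : ℝ, ∀ y, ‖f y‖ ≤ M) (hθ : 0 ≤ θ)
    (hl : ∃ D : ℝ, ∀ j, ∀ y ∈ P j, ∀ y' ∈ P j, ‖f y - f y'‖ ≤ D * dTheta T P θ y y') :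
    BTheta T P θ :=
  ⟨f, hf, by
    obtain ⟨M, hM⟩ := hb
    refine lt_of_le_of_lt (iSup_le fun y => ?_) (ENNReal.ofReal_lt_top (r := M))
    rw [← ofReal_norm]
    exact ENNReal.ofReal_le_ofReal (hM y), by
    obtain ⟨D, hD⟩ := hl
    exact (lipSemi_le_ofReal hθ hD).trans_lt ENNReal.ofReal_lt_top⟩

@[simp] theorem mk_apply (f : Ω → ℂ) (hf : Measurable f) (hb : ∃ M : ℝ, ∀ y, ‖f y‖ ≤ M)
    (hθ : 0 ≤ θ)
    (hl : ∃ D : ℝ, ∀ j, ∀ y ∈ P j, ∀ y' ∈ P j, ‖f y - f y'‖ ≤ D * dTheta T P θ y y') (y : Ω) :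
    (mk f hf hb hθ hl : BTheta T P θ) y = f y := rfl

@[ext] theorem ext {f g : BTheta T P θ} (h : ∀ y, f y = g y) : f = g :=
  Subtype.ext (funext h)

@[simp] theorem add_apply (f g : BTheta T P θ) (y : Ω) : (f + g) y = f y + g y := rfl
@[simp] theorem sub_apply (f g : BTheta T P θ) (y : Ω) : (f - g) y = f y - g y := rfl
@[simp] theorem smul_apply (c : ℂ) (f : BTheta T P θ) (y : Ω) : (c • f) y = c * f y := rfl
@[simp] theorem zero_apply (y : Ω) : (0 : BTheta T P θ) y = 0 := rfl

theorem measurable (f : BTheta T P θ) : Measurable f.toFun := f.mem.1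

theorem integrable (f : BTheta T P θ) (μ : Measure Ω) [IsFiniteMeasure μ] :
    Integrable f.toFun μ :=
  Integrable.of_bound f.measurable.aestronglyMeasurable f.sup
    (ae_of_all _ fun y => f.norm_apply_le y)

/-- The constant functions. -/
def const (hθ : 0 ≤ θ) (c : ℂ) : BTheta T P θ :=
  mk (fun _ => c) measurable_const ⟨‖c‖, fun _ => le_rfl⟩ hθ ⟨0, by simp⟩

@[simp] theorem const_apply (hθ : 0 ≤ θ) (c : ℂ) (y : Ω) :
    (const hθ c : BTheta T P θ) y = c := rfl

theorem completeSpace (hθ : 0 < θ)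
    (hsep : ∀ y y', sepTimes T P y y' = ∅ → y = y') : CompleteSpace (BTheta T P θ) := by
  refine Metric.complete_of_cauchySeq_tendsto fun u hu => ?_
  have hpt : ∀ y, CauchySeq fun n => u n y := fun y => by
    rw [Metric.cauchySeq_iff'] at hu ⊢
    intro ε hε
    obtain ⟨N, hN⟩ := hu ε hε
    refine ⟨N, fun n hn => lt_of_le_of_lt ?_ (hN n hn)⟩
    rw [dist_eq_norm, dist_eq_norm, ← sub_apply]
    exact ((u n - u N).norm_apply_le y).trans (sup_le_norm _)
  choose f hf using fun y => cauchySeq_tendsto_of_complete (hpt y)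
  -- Letting m → ∞ in the Cauchy estimate for u n - u m bounds both u n - f and its local Lipschitz
  -- constants by ε.
  have hlim : ∀ ε > 0, ∃ N, ∀ n ≥ N, (∀ y, ‖u n y - f y‖ ≤ ε) ∧
      ∀ j, ∀ y ∈ P j, ∀ y' ∈ P j,
        ‖(u n y - f y) - (u n y' - f y')‖ ≤ ε * dTheta T P θ y y' := by
    intro ε hε
    obtain ⟨N, hN⟩ := Metric.cauchySeq_iff.1 hu ε hε
    refine ⟨N, fun n hn => ⟨fun y => ?_, fun j y hy y' hy' => ?_⟩⟩
    · refine le_of_tendsto ((tendsto_const_nhds.sub (hf y)).norm) ?_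
      filter_upwards [eventually_ge_atTop N] with m hm
      have := (hN n hn m hm).le
      rw [dist_eq_norm] at this
      exact ((u n - u m).norm_apply_le y).trans ((sup_le_norm _).trans this)
    · refine le_of_tendsto (((tendsto_const_nhds.sub (hf y)).sub
        (tendsto_const_nhds.sub (hf y'))).norm) ?_
      filter_upwards [eventually_ge_atTop N] with m hm
      have := (hN n hn m hm).le
      rw [dist_eq_norm] at this
      exact ((u n - u m).norm_apply_sub_le hθ hsep hy hy').trans
        (mul_le_mul_of_nonneg_right ((lip_le_norm _).trans this) (dTheta_nonneg hθ.le _ _))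
  have hfm : Measurable f :=
    measurable_of_tendsto_metrizable (fun n => (u n).measurable) (tendsto_pi_nhds.2 hf)
  obtain ⟨N, hN⟩ := hlim 1 one_pos
  obtain ⟨hN1, hN2⟩ := hN N le_rfl
  let F : BTheta T P θ := mk f hfm
    ⟨(u N).sup + 1, fun y => by
      have h1 := hN1 y
      have h2 := (u N).norm_apply_le y
      have h3 := norm_le_norm_add_norm_sub' (f y) (u N y)
      rw [norm_sub_rev] at h3
      linarith⟩ hθ.le
    ⟨(u N).lip + 1, fun j y hy y' hy' => by
      have h1 := hN2 j y hy y' hy'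
      have h2 := (u N).norm_apply_sub_le hθ hsep hy hy'
      have h3 : f y - f y' = (u N y - u N y') - ((u N y - f y) - (u N y' - f y')) := by ring
      rw [h3, add_mul]
      exact (norm_sub_le _ _).trans (add_le_add h2 h1)⟩
  refine ⟨F, Metric.tendsto_atTop.2 fun ε hε => ?_⟩
  obtain ⟨N, hN⟩ := hlim (ε / 3) (by positivity)
  refine ⟨N, fun n hn => ?_⟩
  have h1 : (u n - F).sup ≤ ε / 3 := sup_le (by positivity) (hN n hn).1
  have h2 : (u n - F).lip ≤ ε / 3 := lip_le hθ.le (by positivity) (hN n hn).2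
  rw [dist_eq_norm, norm_eq]
  linarith

end BTheta

/-! ### Inverse branches and weights -/

/-- The inverse branch of `T` on `P j`. -/
def branch {Ω ι : Type*} [Nonempty Ω] (T : Ω → Ω) (P : ι → Set Ω) (j : ι) : Ω → Ω :=
  Function.invFunOn T (P j)

/-- The weight of the branch `j`, extended by `0` off the image of `P j`. -/
def branchWeight {Ω ι : Type*} [Nonempty Ω] (T : Ω → Ω) (P : ι → Set Ω) (g : Ω → ℝ) (j : ι) :
    Ω → ℝ :=
  (T '' P j).indicator fun x => g (branch T P j x)

/-- `g` is a version of `dμ / d(μ ∘ T)` for which the oscillation of `g` on `P j` is controlled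
by `μ (P j)`. -/
structure IsWeight {Ω ι : Type*} [MeasurableSpace Ω] (μ : Measure Ω) (T : Ω → Ω)
    (P : ι → Set Ω) (θ : ℝ) (g : Ω → ℝ) (C : ℝ) : Prop where
  measurable : Measurable g
  pos : ∀ y, 0 < g y
  density : μ = (compMeasure μ T P).withDensity (fun y => ENNReal.ofReal (g y))
  const_nonneg : 0 ≤ C
  le_mul : ∀ j, ∀ y ∈ P j, g y ≤ C * μ.real (P j)
  abs_sub_le : ∀ j, ∀ y ∈ P j, ∀ y' ∈ P j,
    |g y - g y'| ≤ C * μ.real (P j) * dTheta T P θ y y'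

theorem branch_mem {Ω ι : Type*} [Nonempty Ω] {T : Ω → Ω} {P : ι → Set Ω} {j : ι}
    {x : Ω} (hx : x ∈ T '' P j) : branch T P j x ∈ P j :=
  Function.invFunOn_mem hx

theorem apply_branch {Ω ι : Type*} [Nonempty Ω] {T : Ω → Ω} {P : ι → Set Ω} {j : ι}
    {x : Ω} (hx : x ∈ T '' P j) : T (branch T P j x) = x :=
  Function.invFunOn_eq hx

section Branches

variable {Ω ι : Type*} [MeasurableSpace Ω] {μ : Measure Ω} {T : Ω → Ω} {P : ι → Set Ω} {θ : ℝ}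

theorem IsGibbsMarkov.measurableSet_image (h : IsGibbsMarkov μ T P θ) (j : ι) :
    MeasurableSet (T '' P j) :=
  h.measurable_image j _ Subset.rfl (h.measurableSet j)

theorem IsGibbsMarkov.measurable (h : IsGibbsMarkov μ T P θ) : Measurable T :=
  h.ergodic.toMeasurePreserving.measurable

theorem measurableEmbedding_restrict (h : IsGibbsMarkov μ T P θ) (j : ι) :
    MeasurableEmbedding (fun x : P j => T x) where
  injective := fun x y hxy => Subtype.ext (h.injOn j x.2 y.2 hxy)
  measurable := h.measurable.comp measurable_subtype_coe
  measurableSet_image' := fun s hs => by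
    have : (fun x : P j => T x) '' s = T '' (Subtype.val '' s) := by
      rw [image_image]
    rw [this]
    exact h.measurable_image j _ (by rintro _ ⟨x, _, rfl⟩; exact x.2)
      ((h.measurableSet j).subtype_image hs)

section
variable [Nonempty Ω] {g : Ω → ℝ} {C : ℝ}

theorem branch_apply (h : IsGibbsMarkov μ T P θ) {j : ι} {y : Ω} (hy : y ∈ P j) :
    branch T P j (T y) = y :=
  (h.injOn j).leftInvOn_invFunOn hy

theorem measurable_branch (h : IsGibbsMarkov μ T P θ) (j : ι) : Measurable (branch T P j) := by
  classical
  intro A hA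
  have h1 : branch T P j ⁻¹' A =
      T '' (P j ∩ A) ∪ ((T '' P j)ᶜ ∩ branch T P j ⁻¹' A) := by
    ext x
    by_cases hx : x ∈ T '' P j
    · obtain ⟨y, hy, rfl⟩ := hx
      have hm : T y ∈ T '' P j := ⟨y, hy, rfl⟩
      simp only [mem_preimage, branch_apply h hy, mem_union, mem_inter_iff, mem_compl_iff, hm,
        not_true_eq_false, false_and, or_false, mem_image]
      refine ⟨fun hA => ⟨y, ⟨hy, hA⟩, rfl⟩, ?_⟩
      rintro ⟨z, ⟨hz, hzA⟩, hzy⟩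
      rwa [← h.injOn j hz hy hzy]
    · simp only [mem_preimage, mem_union, mem_inter_iff, mem_compl_iff, hx, not_false_eq_true,
        true_and, iff_or_self]
      rintro ⟨z, ⟨hz, hzA⟩, rfl⟩
      exact absurd ⟨z, hz, rfl⟩ hx
  rw [h1]
  refine (h.measurable_image j _ inter_subset_left ((h.measurableSet j).inter hA)).union ?_
  -- Off the image of P j the branch takes a single default value, so this piece of the preimage is
  -- the whole complement or empty.
  by_cases hc : Classical.choice ‹Nonempty Ω› ∈ A
  · convert! (h.measurableSet_image j).compl using 1
    refine inter_eq_left.2 fun x hx => ?_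
    rw [mem_preimage, branch, Function.invFunOn_neg hx]
    exact hc
  · convert! MeasurableSet.empty using 1
    refine eq_empty_of_forall_notMem fun x hx => hc ?_
    have := hx.2
    rwa [mem_preimage, branch, Function.invFunOn_neg hx.1] at this

theorem measurable_branchWeight (h : IsGibbsMarkov μ T P θ) (hg : Measurable g) (j : ι) :
    Measurable (branchWeight T P g j) :=
  (hg.comp (measurable_branch h j)).indicator (h.measurableSet_image j)

/-- Only the j-th summand of μ∘T charges P j, and there T is a measurable isomorphism onto its
image. -/
theorem lintegral_compMeasure_restrict (h : IsGibbsMarkov μ T P θ) (j : ι) {F : Ω → ℝ≥0∞}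
    (hF : Measurable F) :
    ∫⁻ y in P j, F y ∂(compMeasure μ T P) = ∫⁻ x in T '' P j, F (branch T P j x) ∂μ := by
  classical
  rw [← lintegral_indicator (h.measurableSet j), compMeasure, lintegral_sum_measure,
    tsum_eq_single j]
  · rw [lintegral_map (hF.indicator (h.measurableSet j)) measurable_subtype_coe]
    have hr : T '' P j = range (fun x : P j => T x) := by
      ext x; simp
    rw [hr, ← (measurableEmbedding_restrict h j).map_comap,
      (measurableEmbedding_restrict h j).lintegral_map]
    refine lintegral_congr fun x => ?_
    rw [indicator_of_mem x.2, branch_apply h x.2]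
  · intro i hij
    rw [lintegral_map (hF.indicator (h.measurableSet j)) measurable_subtype_coe]
    have : ∀ x : P i, (P j).indicator F x = 0 := fun x =>
      indicator_of_notMem (fun hx => disjoint_left.1 (h.disjoint hij) x.2 hx) _
    simp [this]

/-- Change of variables along one branch, after writing μ as g times μ∘T. The weight vanishes off
T(P j), so the right side can run over all of Ω. -/
theorem setLIntegral_partition (h : IsGibbsMarkov μ T P θ) (hg : IsWeight μ T P θ g C) (j : ι)
    {F : Ω → ℝ≥0∞} (hF : Measurable F) :
    ∫⁻ y in P j, F y ∂μ
      = ∫⁻ x, ENNReal.ofReal (branchWeight T P g j x) * F (branch T P j x) ∂μ := by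
  have h1 : ∫⁻ y in P j, F y ∂μ
      = ∫⁻ y in P j, ENNReal.ofReal (g y) * F y ∂(compMeasure μ T P) := by
    conv_lhs => rw [hg.density]
    rw [restrict_withDensity (h.measurableSet j),
      lintegral_withDensity_eq_lintegral_mul _ hg.measurable.ennreal_ofReal hF]
    rfl
  refine h1.trans ((lintegral_compMeasure_restrict h j
    (hg.measurable.ennreal_ofReal.mul hF)).trans ?_)
  rw [← lintegral_indicator (h.measurableSet_image j)]
  refine lintegral_congr fun x => ?_
  by_cases hx : x ∈ T '' P j <;> simp [branchWeight, hx]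

/-- The change of variables as an identity of measures, which carries it over to vector-valued
integrands. -/
theorem restrict_partition_eq (h : IsGibbsMarkov μ T P θ) (hg : IsWeight μ T P θ g C) (j : ι) :
    μ.restrict (P j) = (μ.withDensity fun x => ENNReal.ofReal (branchWeight T P g j x)).map
      (branch T P j) := by
  ext A hA
  rw [Measure.map_apply (measurable_branch h j) hA,
    withDensity_apply _ (measurable_branch h j hA), ← lintegral_indicator_one hA,
    setLIntegral_partition h hg j (measurable_one.indicator hA),
    ← lintegral_indicator (measurable_branch h j hA)]
  refine lintegral_congr fun x => ?_
  by_cases hx : branch T P j x ∈ A <;> simp [hx]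

theorem setIntegral_partition {E : Type*} [NormedAddCommGroup E] [NormedSpace ℝ E]
    (h : IsGibbsMarkov μ T P θ) (hg : IsWeight μ T P θ g C) (j : ι)
    {F : Ω → E} (hF : StronglyMeasurable F) :
    ∫ y in P j, F y ∂μ = ∫ x, branchWeight T P g j x • F (branch T P j x) ∂μ := by
  rw [restrict_partition_eq h hg j,
    integral_map (measurable_branch h j).aemeasurable hF.aestronglyMeasurable,
    integral_withDensity_eq_integral_toReal_smul
      (measurable_branchWeight h hg.measurable j).ennreal_ofReal (by simp)]
  refine integral_congr_ae (ae_of_all _ fun x => ?_)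
  have : 0 ≤ branchWeight T P g j x := indicator_nonneg (fun x _ => (hg.pos _).le) x
  simp only [ENNReal.toReal_ofReal this]

end

/-! ### Consequences of the Gibbs–Markov property -/

theorem nonempty_partition (h : IsGibbsMarkov μ T P θ) (j : ι) : (P j).Nonempty := by
  obtain ⟨c, hc, hcj⟩ := h.big_images
  rw [nonempty_iff_ne_empty]
  intro he
  have := hcj j
  rw [he, image_empty, measure_empty] at this
  exact absurd hc (not_lt.2 this)

/-- The partition element that contains a point. -/
def IsGibbsMarkov.idx (h : IsGibbsMarkov μ T P θ) (y : Ω) : ι :=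
  (mem_iUnion.1 (h.cover.symm ▸ mem_univ y : y ∈ ⋃ j, P j)).choose

theorem IsGibbsMarkov.mem_idx (h : IsGibbsMarkov μ T P θ) (y : Ω) : y ∈ P (h.idx y) :=
  (mem_iUnion.1 (h.cover.symm ▸ mem_univ y : y ∈ ⋃ j, P j)).choose_spec

theorem IsGibbsMarkov.idx_eq (h : IsGibbsMarkov μ T P θ) {y : Ω} {j : ι} (hy : y ∈ P j) :
    h.idx y = j := by
  by_contra hne
  exact disjoint_left.1 (h.disjoint hne) (h.mem_idx y) hy

theorem partition_subset_image (h : IsGibbsMarkov μ T P θ) {j k : ι} {x : Ω} (hx : x ∈ P k)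
    (hxj : x ∈ T '' P j) : P k ⊆ T '' P j := by
  obtain ⟨J, hJ⟩ := h.markov j
  rw [hJ] at hxj ⊢
  obtain ⟨i, hi, hxi⟩ := mem_iUnion₂.1 hxj
  have : i = k := by rw [← h.idx_eq hx, h.idx_eq hxi]
  exact this ▸ subset_biUnion_of_mem hi

/-- This is the use of the Markov property: images are unions of elements, so two points of one
element have preimages under the same branches. -/
theorem mem_image_iff (h : IsGibbsMarkov μ T P θ) {j k : ι} {x x' : Ω} (hx : x ∈ P k)
    (hx' : x' ∈ P k) : x ∈ T '' P j ↔ x' ∈ T '' P j :=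
  ⟨fun hj => partition_subset_image h hx hj hx', fun hj => partition_subset_image h hx' hj hx⟩

theorem hasSum_measureReal [Countable ι] [IsProbabilityMeasure μ] (h : IsGibbsMarkov μ T P θ) :
    HasSum (fun j => μ.real (P j)) 1 := by
  have h1 := measure_iUnion (μ := μ) h.disjoint h.measurableSet
  rw [h.cover, measure_univ] at h1
  have h2 : Summable fun j => (μ (P j)).toReal := ENNReal.summable_toReal (by rw [← h1]; simp)
  have h3 := h2.hasSum
  rw [← ENNReal.tsum_toReal_eq (fun j => measure_ne_top μ _), ← h1, ENNReal.toReal_one] at h3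
  exact h3

/-- By bounded distortion g varies on P j by a factor at most e^|C|. Integrating g along the branch
over T(P j), whose measure is bounded below, then bounds g on P j by a multiple of μ(P j). The
Lipschitz bound for log g becomes one for g after multiplication by this bound. -/
theorem exists_isWeight [IsProbabilityMeasure μ] (h : IsGibbsMarkov μ T P θ) :
    ∃ g C, IsWeight μ T P θ g C := by
  obtain ⟨g, hgm, hgpos, hdens, C, hC⟩ := h.distortion
  obtain ⟨c, hc, hcj⟩ := h.big_images
  have : Nonempty Ω := μ.nonempty_of_neZero
  have hC' : ∀ j, ∀ y ∈ P j, ∀ y' ∈ P j,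
      |Real.log (g y) - Real.log (g y')| ≤ |C| * dTheta T P θ y y' := fun j y hy y' hy' =>
    (hC j y hy y' hy').trans (mul_le_mul_of_nonneg_right (le_abs_self C)
      (dTheta_nonneg h.theta_pos.le _ _))
  have hratio : ∀ j, ∀ y ∈ P j, ∀ y' ∈ P j, g y ≤ Real.exp |C| * g y' := by
    intro j y hy y' hy'
    have h1 := (hC' j y hy y' hy').trans (mul_le_of_le_one_right (abs_nonneg C)
      (dTheta_le_one h.theta_pos.le h.theta_lt_one.le y y'))
    have h2 := (abs_le.1 h1).2
    rw [← Real.exp_log (hgpos y), ← Real.exp_log (hgpos y'), ← Real.exp_add]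
    exact Real.exp_le_exp.2 (by linarith)
  -- The cut at 1 keeps the real value positive, since an infinite c would be sent to 0.
  set c' : ℝ := (min c 1).toReal with hc'
  have hc'pos : 0 < c' := ENNReal.toReal_pos (lt_min hc one_pos).ne' (by simp)
  have hcj' : ∀ j, c' ≤ μ.real (T '' P j) := fun j =>
    ENNReal.toReal_mono (measure_ne_top μ _) ((min_le_left _ _).trans (hcj j))
  have hle : ∀ j, ∀ y ∈ P j, g y ≤ Real.exp |C| / c' * μ.real (P j) := by
    intro j y hy
    have h1 : μ (P j) = ∫⁻ x in T '' P j, ENNReal.ofReal (g (branch T P j x)) ∂μ := by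
      have := lintegral_compMeasure_restrict h j hgm.ennreal_ofReal
      rw [← this, ← withDensity_apply _ (h.measurableSet j), ← hdens]
    have h2 : ENNReal.ofReal (g y * Real.exp (-|C|)) * μ (T '' P j) ≤ μ (P j) := by
      rw [h1, ← setLIntegral_const]
      refine setLIntegral_mono' (h.measurableSet_image j) fun x hx => ?_
      refine ENNReal.ofReal_le_ofReal ?_
      have := hratio j y hy _ (branch_mem hx)
      rw [Real.exp_neg, ← div_eq_mul_inv, div_le_iff₀ (Real.exp_pos _)]
      linarith
    have h3 : g y * Real.exp (-|C|) * μ.real (T '' P j) ≤ μ.real (P j) := by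
      have := ENNReal.toReal_mono (measure_ne_top μ _) h2
      rwa [ENNReal.toReal_mul, ENNReal.toReal_ofReal
        (mul_nonneg (hgpos y).le (Real.exp_pos _).le)] at this
    have h4 : g y * Real.exp (-|C|) * c' ≤ μ.real (P j) :=
      (mul_le_mul_of_nonneg_left (hcj' j)
        (mul_nonneg (hgpos y).le (Real.exp_pos _).le)).trans h3
    rw [Real.exp_neg] at h4
    rw [div_mul_eq_mul_div, le_div_iff₀ hc'pos]
    have h5 := mul_le_mul_of_nonneg_left h4 (Real.exp_pos |C|).le
    calc g y * c' = Real.exp |C| * (g y * (Real.exp |C|)⁻¹ * c') := by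
          field_simp
      _ ≤ _ := h5
  set K := Real.exp |C| / c' with hK
  have hK0 : 0 ≤ K := by positivity
  -- One constant for both estimates: K bounds g relative to μ(P j), and K |C| its Lipschitz
  -- constant.
  refine ⟨g, K * (|C| + 1), hgm, hgpos, hdens, by positivity, fun j y hy => ?_,
    fun j y hy y' hy' => ?_⟩
  · refine (hle j y hy).trans (mul_le_mul_of_nonneg_right ?_ measureReal_nonneg)
    nlinarith [abs_nonneg C]
  -- This is log x ≤ x - 1 at x = b / a.
  · have key : ∀ a b : ℝ, 0 < a → 0 < b → a - b ≤ a * |Real.log a - Real.log b| := by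
      intro a b ha hb
      have h1 : Real.log b - Real.log a + 1 ≤ b / a := by
        rw [← Real.log_div hb.ne' ha.ne']
        linarith [Real.log_le_sub_one_of_pos (div_pos hb ha)]
      have h2 : a * (Real.log b - Real.log a + 1) ≤ b := by
        have := mul_le_mul_of_nonneg_left h1 ha.le
        rwa [mul_div_cancel₀ _ ha.ne'] at this
      nlinarith [le_abs_self (Real.log a - Real.log b)]
    have hm := hC' j y hy y' hy'
    have hd := dTheta_nonneg (T := T) (P := P) h.theta_pos.le y y'
    have hbound : ∀ z ∈ P j, g z * |Real.log (g y) - Real.log (g y')|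
        ≤ K * (|C| + 1) * μ.real (P j) * dTheta T P θ y y' := by
      intro z hz
      calc g z * |Real.log (g y) - Real.log (g y')|
          ≤ (K * μ.real (P j)) * (|C| * dTheta T P θ y y') :=
            mul_le_mul (hle j z hz) hm (abs_nonneg _) (mul_nonneg hK0 measureReal_nonneg)
        _ ≤ (K * μ.real (P j)) * ((|C| + 1) * dTheta T P θ y y') := by
            gcongr; linarith
        _ = _ := by ring
    rw [abs_le']
    constructor
    · exact (key _ _ (hgpos y) (hgpos y')).trans (hbound y hy)
    · rw [neg_sub]
      refine (key _ _ (hgpos y') (hgpos y)).trans ?_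
      rw [abs_sub_comm]
      exact hbound y' hy'

end Branches

/-! ### The transfer operator as a pointwise sum over inverse branches -/

/-- `u ↦ ∑ j, g (y_j) u (y_j)`, where `y_j` is the preimage in `P j`. -/
def branchSum {Ω ι E : Type*} [Nonempty Ω] [NormedAddCommGroup E] [NormedSpace ℝ E]
    (T : Ω → Ω) (P : ι → Set Ω) (g : Ω → ℝ) (u : Ω → E) (x : Ω) : E :=
  ∑' j, branchWeight T P g j x • u (branch T P j x)

/-- `u` is measurable, and it is bounded and Lipschitz on each `P j` with constants which are at
most the values on `P j` of the integrable function `ψ`. -/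
structure DominatedBy {Ω ι : Type*} [MeasurableSpace Ω] (μ : Measure Ω) (T : Ω → Ω)
    (P : ι → Set Ω) (θ : ℝ) (u : Ω → ℂ) (ψ : Ω → ℝ) : Prop where
  measurable : Measurable u
  integrable : Integrable ψ μ
  norm_le : ∀ j, ∀ y ∈ P j, ∀ z ∈ P j, ‖u y‖ ≤ ψ z
  norm_sub_le : ∀ j, ∀ y ∈ P j, ∀ y' ∈ P j, ∀ z ∈ P j,
    ‖u y - u y'‖ ≤ ψ z * dTheta T P θ y y'

section BranchSum

variable {Ω ι : Type*} [MeasurableSpace Ω] {μ : Measure Ω} {T : Ω → Ω} {P : ι → Set Ω} {θ : ℝ}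
  [Nonempty Ω] {g : Ω → ℝ} {C : ℝ}
variable {E : Type*} [NormedAddCommGroup E] [NormedSpace ℝ E]

theorem branchWeight_nonneg (hg : IsWeight μ T P θ g C) (j : ι) (x : Ω) :
    0 ≤ branchWeight T P g j x :=
  indicator_nonneg (fun _ _ => (hg.pos _).le) x

theorem branchWeight_le (hg : IsWeight μ T P θ g C) (j : ι) (x : Ω) :
    branchWeight T P g j x ≤ C * μ.real (P j) := by
  by_cases hx : x ∈ T '' P j
  · rw [branchWeight, indicator_of_mem hx]
    exact hg.le_mul j _ (branch_mem hx)
  · rw [branchWeight, indicator_of_notMem hx]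
    exact mul_nonneg hg.const_nonneg measureReal_nonneg

theorem measureReal_mul_le_setIntegral [IsFiniteMeasure μ] (h : IsGibbsMarkov μ T P θ)
    {ψ : Ω → ℝ} (hψ : Integrable ψ μ) {j : ι} {a : ℝ} (ha : ∀ z ∈ P j, a ≤ ψ z) :
    μ.real (P j) * a ≤ ∫ z in P j, ψ z ∂μ := by
  have := setIntegral_mono_on (integrableOn_const (μ := μ) (s := P j) (C := a))
    hψ.integrableOn (h.measurableSet j) ha
  simpa [smul_eq_mul] using this

theorem hasSum_setIntegral [Countable ι] (h : IsGibbsMarkov μ T P θ)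
    {F : Ω → E} (hF : Integrable F μ) :
    HasSum (fun j => ∫ z in P j, F z ∂μ) (∫ z, F z ∂μ) := by
  have := hasSum_integral_iUnion h.measurableSet h.disjoint (hF.integrableOn (s := ⋃ j, P j))
  rwa [h.cover, setIntegral_univ] at this

/-- The weight is at most C μ(P j) and u is bounded on P j by every value of ψ there, so the product
is at most C times the integral of ψ over P j. The bound is uniform in x and summable in j. -/
theorem norm_branchWeight_smul_le [IsFiniteMeasure μ] (h : IsGibbsMarkov μ T P θ)
    (hg : IsWeight μ T P θ g C) {u : Ω → E} {ψ : Ω → ℝ} (hψ : Integrable ψ μ)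
    (hu : ∀ j, ∀ y ∈ P j, ∀ z ∈ P j, ‖u y‖ ≤ ψ z) (j : ι) (x : Ω) :
    ‖branchWeight T P g j x • u (branch T P j x)‖ ≤ C * ∫ z in P j, ψ z ∂μ := by
  have h0 : 0 ≤ ∫ z in P j, ψ z ∂μ :=
    setIntegral_nonneg (h.measurableSet j) fun z hz => (norm_nonneg _).trans (hu j z hz z hz)
  by_cases hx : x ∈ T '' P j
  · rw [norm_smul, Real.norm_of_nonneg (branchWeight_nonneg hg j x)]
    calc _ ≤ C * μ.real (P j) * ‖u (branch T P j x)‖ := by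
          gcongr; exact branchWeight_le hg j x
      _ = C * (μ.real (P j) * ‖u (branch T P j x)‖) := by ring
      _ ≤ _ := mul_le_mul_of_nonneg_left
        (measureReal_mul_le_setIntegral h hψ fun z hz => hu j _ (branch_mem hx) z hz)
        hg.const_nonneg
  · rw [branchWeight, indicator_of_notMem hx, zero_smul, norm_zero]
    exact mul_nonneg hg.const_nonneg h0

theorem summable_norm_branchSum [Countable ι] [IsFiniteMeasure μ] (h : IsGibbsMarkov μ T P θ)
    (hg : IsWeight μ T P θ g C) {u : Ω → E} {ψ : Ω → ℝ} (hψ : Integrable ψ μ)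
    (hu : ∀ j, ∀ y ∈ P j, ∀ z ∈ P j, ‖u y‖ ≤ ψ z) (x : Ω) :
    Summable fun j => ‖branchWeight T P g j x • u (branch T P j x)‖ :=
  Summable.of_nonneg_of_le (fun _ => norm_nonneg _)
    (fun j => norm_branchWeight_smul_le h hg hψ hu j x)
    ((hasSum_setIntegral h hψ).summable.mul_left C)

theorem norm_branchSum_le [Countable ι] [IsFiniteMeasure μ] (h : IsGibbsMarkov μ T P θ)
    (hg : IsWeight μ T P θ g C) {u : Ω → E} {ψ : Ω → ℝ} (hψ : Integrable ψ μ)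
    (hu : ∀ j, ∀ y ∈ P j, ∀ z ∈ P j, ‖u y‖ ≤ ψ z) (x : Ω) :
    ‖branchSum T P g u x‖ ≤ C * ∫ z, ψ z ∂μ :=
  tsum_of_norm_bounded ((hasSum_setIntegral h hψ).mul_left C)
    fun j => norm_branchWeight_smul_le h hg hψ hu j x

/-- Product rule. The increment of u keeps its exact weight and the factor θ gained from
contraction, because the weights sum to 1 and this term yields the contraction in the Lasota–Yorke
inequality. The increment of the weight is estimated more crudely. -/
theorem norm_branchWeight_smul_sub_le (h : IsGibbsMarkov μ T P θ) (hg : IsWeight μ T P θ g C)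
    {u : Ω → E} {j k : ι} {M D : ℝ} (hM : 0 ≤ M)
    (hu : ∀ y ∈ P j, ‖u y‖ ≤ M)
    (hu' : ∀ y ∈ P j, ∀ y' ∈ P j, ‖u y - u y'‖ ≤ D * dTheta T P θ y y')
    (hD : 0 ≤ D) {x x' : Ω} (hx : x ∈ P k) (hx' : x' ∈ P k) :
    ‖branchWeight T P g j x • u (branch T P j x)
        - branchWeight T P g j x' • u (branch T P j x')‖
      ≤ (branchWeight T P g j x * D * θ + C * μ.real (P j) * M) * dTheta T P θ x x' := by
  have hd := dTheta_nonneg (T := T) (P := P) h.theta_pos.le x x'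
  by_cases hj : x ∈ T '' P j
  · have hj' := (mem_image_iff h hx hx').1 hj
    have hb := branch_mem (T := T) hj
    have hb' := branch_mem (T := T) hj'
    have hdb : dTheta T P θ (branch T P j x) (branch T P j x') ≤ θ * dTheta T P θ x x' := by
      have := dTheta_le_mul_dTheta_apply (T := T) (P := P) h.theta_pos.le ⟨j, hb, hb'⟩
      rwa [apply_branch hj, apply_branch hj'] at this
    have hdb1 : dTheta T P θ (branch T P j x) (branch T P j x') ≤ dTheta T P θ x x' :=
      hdb.trans (mul_le_of_le_one_left hd h.theta_lt_one.le)
    have hw : |branchWeight T P g j x - branchWeight T P g j x'|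
        ≤ C * μ.real (P j) * dTheta T P θ x x' := by
      rw [branchWeight, indicator_of_mem hj, indicator_of_mem hj']
      exact (hg.abs_sub_le j _ hb _ hb').trans (mul_le_mul_of_nonneg_left hdb1
        (mul_nonneg hg.const_nonneg measureReal_nonneg))
    have e : branchWeight T P g j x • u (branch T P j x)
        - branchWeight T P g j x' • u (branch T P j x')
        = branchWeight T P g j x • (u (branch T P j x) - u (branch T P j x'))
          + (branchWeight T P g j x - branchWeight T P g j x') • u (branch T P j x') := by
      rw [smul_sub, sub_smul]; abel
    rw [e, add_mul]
    refine (norm_add_le _ _).trans (add_le_add ?_ ?_)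
    · rw [norm_smul, Real.norm_of_nonneg (branchWeight_nonneg hg j x), mul_assoc, mul_assoc]
      exact mul_le_mul_of_nonneg_left ((hu' _ hb _ hb').trans
        (mul_le_mul_of_nonneg_left hdb hD)) (branchWeight_nonneg hg j x)
    · rw [norm_smul, Real.norm_eq_abs]
      calc _ ≤ (C * μ.real (P j) * dTheta T P θ x x') * M :=
            mul_le_mul hw (hu _ hb') (norm_nonneg _)
              (mul_nonneg (mul_nonneg hg.const_nonneg measureReal_nonneg) hd)
        _ = _ := by ring
  · have hj' : x' ∉ T '' P j := fun hn => hj ((mem_image_iff h hx hx').2 hn)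
    simp only [branchWeight, indicator_of_notMem hj, indicator_of_notMem hj', zero_smul, sub_zero,
      norm_zero, zero_mul, zero_add]
    exact mul_nonneg (mul_nonneg (mul_nonneg hg.const_nonneg measureReal_nonneg) hM) hd

variable [Countable ι] [IsProbabilityMeasure μ]

theorem summable_norm_branchSum_of_bounded (h : IsGibbsMarkov μ T P θ)
    (hg : IsWeight μ T P θ g C) {u : Ω → E} {M : ℝ} (hu : ∀ y, ‖u y‖ ≤ M) (x : Ω) :
    Summable fun j => ‖branchWeight T P g j x • u (branch T P j x)‖ :=
  summable_norm_branchSum h hg (ψ := fun _ => M) (integrable_const M)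
    (fun _ y _ _ _ => hu y) x

theorem measurable_branchSum [CompleteSpace E] [SecondCountableTopology E] [MeasurableSpace E]
    [BorelSpace E] (h : IsGibbsMarkov μ T P θ) (hg : IsWeight μ T P θ g C) {u : Ω → E}
    (hu : Measurable u) : Measurable (branchSum T P g u) :=
  Measurable.tsum fun j =>
    (measurable_branchWeight h hg.measurable j).smul (hu.comp (measurable_branch h j))

/-- Split the integral of u · (φ∘T) over the partition and change variables on each piece, where T
undoes the branch. The bound C μ(P j) M K on the terms allows the sum and the integral to be
exchanged. -/
theorem isTransferImage_branchSum (h : IsGibbsMarkov μ T P θ) (hg : IsWeight μ T P θ g C)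
    {u : Ω → ℂ} (hu : Measurable u) {M : ℝ} (hM : ∀ y, ‖u y‖ ≤ M) :
    IsTransferImage μ T u (branchSum T P g u) := by
  refine ⟨Integrable.of_bound (measurable_branchSum h hg hu).aestronglyMeasurable
    (C * ∫ _, M ∂μ) (ae_of_all _ fun x =>
      norm_branchSum_le h hg (integrable_const M) (fun _ y _ _ _ => hM y) x), ?_⟩
  rintro φ hφ ⟨K, hK⟩
  have hK0 : 0 ≤ K := (norm_nonneg _).trans (hK (Classical.arbitrary Ω))
  have hM0 : 0 ≤ M := (norm_nonneg _).trans (hM (Classical.arbitrary Ω))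
  have hprod : Measurable fun y => u y * φ (T y) := hu.mul (hφ.comp h.measurable)
  have hpi : Integrable (fun y => u y * φ (T y)) μ :=
    Integrable.of_bound hprod.aestronglyMeasurable (M * K) (ae_of_all _ fun y => by
      rw [norm_mul]; exact mul_le_mul (hM y) (hK _) (norm_nonneg _) hM0)
  have h1 : ∀ j x, branchWeight T P g j x • u (branch T P j x) * φ x
      = branchWeight T P g j x • (u (branch T P j x) * φ (T (branch T P j x))) := by
    intro j x
    by_cases hx : x ∈ T '' P j
    · rw [apply_branch hx, smul_mul_assoc]
    · simp [branchWeight, indicator_of_notMem hx]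
  have hmeas : ∀ j, Measurable fun x => branchWeight T P g j x • u (branch T P j x) * φ x :=
    fun j => ((measurable_branchWeight h hg.measurable j).smul
      (hu.comp (measurable_branch h j))).mul hφ
  have hbd : ∀ j x, ‖branchWeight T P g j x • u (branch T P j x) * φ x‖
      ≤ C * μ.real (P j) * (M * K) := by
    intro j x
    rw [norm_mul, norm_smul, Real.norm_of_nonneg (branchWeight_nonneg hg j x), mul_assoc]
    exact mul_le_mul (branchWeight_le hg j x)
      (mul_le_mul (hM _) (hK _) (norm_nonneg _) hM0) (by positivity)
      (mul_nonneg hg.const_nonneg measureReal_nonneg)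
  have hint : ∀ j, Integrable (fun x => branchWeight T P g j x • u (branch T P j x) * φ x) μ :=
    fun j => Integrable.of_bound (hmeas j).aestronglyMeasurable _ (ae_of_all _ (hbd j))
  have hs := hasSum_integral_of_summable_integral_norm hint (by
    refine Summable.of_nonneg_of_le (fun j => integral_nonneg fun x => norm_nonneg _)
      (fun j => ?_) (((hasSum_measureReal h).summable.mul_left C).mul_right (M * K))
    have := integral_mono_of_nonneg (μ := μ) (ae_of_all _ fun x => norm_nonneg _)
      (integrable_const (C * μ.real (P j) * (M * K))) (ae_of_all _ (hbd j))
    simpa using this)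
  have hs2 := hasSum_setIntegral h hpi
  have e : ∀ j, ∫ z in P j, u z * φ (T z) ∂μ
      = ∫ x, branchWeight T P g j x • u (branch T P j x) * φ x ∂μ := fun j => by
    rw [setIntegral_partition h hg j hprod.stronglyMeasurable]
    exact integral_congr_ae (ae_of_all _ fun x => (h1 j x).symm)
  simp_rw [e] at hs2
  rw [hs2.unique hs]
  refine integral_congr_ae (ae_of_all _ fun x => ?_)
  exact ((summable_norm_branchSum_of_bounded h hg hM x).of_norm.tsum_mul_right (φ x)).symm

/-! ### Cylinders have positive measure -/

/-- The branch weight is strictly positive on T(P j), so pulling back along the branch preserves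
positivity of measure. -/
theorem measure_inter_preimage_pos (h : IsGibbsMarkov μ T P θ) (hg : IsWeight μ T P θ g C)
    {j : ι} {D : Set Ω} (hD : MeasurableSet D) (hsub : D ⊆ T '' P j) (hpos : 0 < μ D) :
    0 < μ (P j ∩ T ⁻¹' D) := by
  rw [pos_iff_ne_zero]
  intro h0
  have h1 : ∫⁻ y in P j, (T ⁻¹' D).indicator 1 y ∂μ = 0 := by
    rw [lintegral_indicator_one (h.measurable hD), Measure.restrict_apply (h.measurable hD),
      inter_comm, h0]
  rw [setLIntegral_partition h hg j (measurable_one.indicator (h.measurable hD)),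
    lintegral_eq_zero_iff (by
      exact (measurable_branchWeight h hg.measurable j).ennreal_ofReal.mul
        ((measurable_one.indicator (h.measurable hD)).comp (measurable_branch h j)))] at h1
  refine hpos.ne' (measure_mono_null (fun x hx => ?_) h1)
  have hxj := hsub hx
  simp only [mem_compl_iff, mem_ofPred_eq, Pi.zero_apply]
  rw [indicator_of_mem (by rw [mem_preimage, apply_branch hxj]; exact hx), branchWeight,
    indicator_of_mem hxj]
  simpa using hg.pos _

/-- At any point of P j one has 0 < g ≤ C μ(P j). -/
theorem measure_partition_pos (h : IsGibbsMarkov μ T P θ) (hg : IsWeight μ T P θ g C) (j : ι) :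
    0 < μ (P j) := by
  obtain ⟨y, hy⟩ := nonempty_partition h j
  have h1 := (hg.pos y).trans_le (hg.le_mul j y hy)
  have h2 : μ.real (P j) ≠ 0 := fun h0 => by simp [h0] at h1
  exact pos_iff_ne_zero.2 fun h0 => h2 (by simp [measureReal_def, h0])

end BranchSum

/-! ### Pointwise values are controlled by almost-everywhere information. -/

section Cylinders

variable {Ω ι : Type*} [MeasurableSpace Ω] {μ : Measure Ω} {T : Ω → Ω} {P : ι → Set Ω} {θ : ℝ}
  [Nonempty Ω] {g : Ω → ℝ} {C : ℝ} [Countable ι] [IsProbabilityMeasure μ]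

/-- The points whose first `n` iterates visit the same partition elements as those of `y`. -/
def IsGibbsMarkov.cyl (h : IsGibbsMarkov μ T P θ) (n : ℕ) (y : Ω) : Set Ω :=
  {z | ∀ k < n, T^[k] z ∈ P (h.idx (T^[k] y))}

theorem measurableSet_cyl (h : IsGibbsMarkov μ T P θ) (n : ℕ) (y : Ω) :
    MeasurableSet (h.cyl n y) := by
  have : h.cyl n y = ⋂ k, ⋂ (_ : k < n), T^[k] ⁻¹' P (h.idx (T^[k] y)) := by
    ext z; simp [IsGibbsMarkov.cyl]
  rw [this]
  exact .iInter fun k => .iInter fun _ => (h.measurable.iterate k) (h.measurableSet _)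

theorem dTheta_le_of_mem_cyl (h : IsGibbsMarkov μ T P θ) {n : ℕ} {y z : Ω} (hz : z ∈ h.cyl n y) :
    dTheta T P θ y z ≤ θ ^ n :=
  dTheta_le_pow h.theta_pos.le h.theta_lt_one.le fun k hk => ⟨_, h.mem_idx _, hz k hk⟩

/-- Induction: one branch pulls the length-n cylinder of T y back into the length-(n+1) cylinder of
y. The intersection with the element of y keeps the set inside the image of a single branch, also
for n = 0, when the cylinder is all of Ω. -/
theorem measure_inter_cyl_pos (h : IsGibbsMarkov μ T P θ) (hg : IsWeight μ T P θ g C) (n : ℕ)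
    (y : Ω) : 0 < μ (P (h.idx y) ∩ h.cyl n y) := by
  induction n generalizing y with
  | zero =>
    have : h.cyl 0 y = univ := by ext z; simp [IsGibbsMarkov.cyl]
    rw [this, inter_univ]
    exact measure_partition_pos h hg _
  | succ n ih =>
    refine (measure_inter_preimage_pos h hg (j := h.idx y)
      ((h.measurableSet _).inter (measurableSet_cyl h n (T y)))
      (inter_subset_left.trans (partition_subset_image h (h.mem_idx (T y))
        ⟨y, h.mem_idx y, rfl⟩)) (ih (T y))).trans_le (measure_mono ?_)
    rintro z ⟨hz, hz'⟩
    refine ⟨hz, fun k hk => ?_⟩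
    rcases k with _ | k
    · exact hz
    · exact hz'.2 k (by omega)

/-- Every cylinder around y has positive measure, so it contains a point where the bound holds, at
distance at most θ^n from y. Let n → ∞. -/
theorem norm_apply_le_of_ae_le (h : IsGibbsMarkov μ T P θ) (hg : IsWeight μ T P θ g C)
    (f : BTheta T P θ) {M : ℝ} (hM : ∀ᵐ y ∂μ, ‖f y‖ ≤ M) (y : Ω) : ‖f y‖ ≤ M := by
  have key : ∀ n : ℕ, ‖f y‖ ≤ M + f.lip * θ ^ n := by
    intro n
    obtain ⟨z, ⟨hz, hzc⟩, hzM⟩ : ((P (h.idx y) ∩ h.cyl n y) ∩ {z | ‖f z‖ ≤ M}).Nonempty := by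
      refine nonempty_of_measure_ne_zero (μ := μ) ?_
      have : μ ((P (h.idx y) ∩ h.cyl n y) ∩ {z | ‖f z‖ ≤ M}) = μ (P (h.idx y) ∩ h.cyl n y) :=
        measure_inter_conull hM
      rw [this]
      exact (measure_inter_cyl_pos h hg n y).ne'
    have h1 := f.norm_apply_sub_le h.theta_pos h.separating (h.mem_idx y) hz
    have h2 := mul_le_mul_of_nonneg_left (dTheta_le_of_mem_cyl h hzc) f.lip_nonneg
    have h3 := norm_le_norm_add_norm_sub' (f y) (f z)
    have h4 : ‖f z‖ ≤ M := hzM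
    linarith
  have hlim : Tendsto (fun n : ℕ => M + f.lip * θ ^ n) atTop (𝓝 (M + f.lip * 0)) :=
    ((tendsto_pow_atTop_nhds_zero_of_lt_one h.theta_pos.le h.theta_lt_one).const_mul _).const_add _
  simpa using ge_of_tendsto' hlim key

theorem BTheta.eq_of_ae_eq (h : IsGibbsMarkov μ T P θ) (hg : IsWeight μ T P θ g C)
    {f f' : BTheta T P θ} (hff : f.toFun =ᵐ[μ] f'.toFun) : f = f' := by
  ext y
  have := norm_apply_le_of_ae_le h hg (f - f') (M := 0) (by
    filter_upwards [hff] with z hz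
    rw [BTheta.sub_apply, hz, sub_self, norm_zero]) y
  exact sub_eq_zero.1 (norm_le_zero_iff.1 this)

theorem eLpNorm_top_eq_supNormE (h : IsGibbsMarkov μ T P θ) (hg : IsWeight μ T P θ g C)
    (f : BTheta T P θ) : eLpNorm f.toFun ⊤ μ = supNormE f.toFun := by
  rw [eLpNorm_exponent_top]
  refine le_antisymm (eLpNormEssSup_le_of_ae_enorm_bound (ae_of_all _ fun y =>
    le_iSup (fun y => ‖f y‖ₑ) y)) (iSup_le fun y => ?_)
  have hlt : eLpNormEssSup f.toFun μ < ⊤ :=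
    (eLpNormEssSup_le_of_ae_enorm_bound (ae_of_all _ fun y =>
      le_iSup (fun y => ‖f y‖ₑ) y)).trans_lt f.mem.2.1
  have := norm_apply_le_of_ae_le h hg f (M := (eLpNormEssSup f.toFun μ).toReal) (by
    filter_upwards [enorm_ae_le_eLpNormEssSup f.toFun μ] with z hz
    rw [← toReal_enorm]
    exact ENNReal.toReal_mono hlt.ne hz) y
  rw [← ofReal_norm]
  exact ENNReal.ofReal_le_of_le_toReal this

end Cylinders

/-! ### Weighted transfer operators on `𝓑_θ` -/

namespace DominatedBy

variable {Ω ι : Type*} [MeasurableSpace Ω] {μ : Measure Ω} {T : Ω → Ω} {P : ι → Set Ω} {θ : ℝ}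
  [Nonempty Ω] {g : Ω → ℝ} {C : ℝ} [Countable ι] [IsProbabilityMeasure μ] {u : Ω → ℂ} {ψ : Ω → ℝ}

theorem nonneg (h : IsGibbsMarkov μ T P θ) (hu : DominatedBy μ T P θ u ψ) (z : Ω) : 0 ≤ ψ z :=
  (norm_nonneg _).trans (hu.norm_le _ z (h.mem_idx z) z (h.mem_idx z))

theorem norm_branchSum_sub_le (h : IsGibbsMarkov μ T P θ) (hg : IsWeight μ T P θ g C)
    (hu : DominatedBy μ T P θ u ψ) {k : ι} {x x' : Ω} (hx : x ∈ P k) (hx' : x' ∈ P k) :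
    ‖branchSum T P g u x - branchSum T P g u x'‖
      ≤ 2 * C * (∫ z, ψ z ∂μ) * dTheta T P θ x x' := by
  have hd := dTheta_nonneg (T := T) (P := P) h.theta_pos.le x x'
  have hs := fun x => (summable_norm_branchSum h hg hu.integrable hu.norm_le x).of_norm
  rw [branchSum, branchSum, ← (hs x).tsum_sub (hs x')]
  refine tsum_of_norm_bounded (((hasSum_setIntegral h hu.integrable).mul_left (2 * C)).mul_right
    _) fun j => ?_
  obtain ⟨y0, hy0⟩ := nonempty_partition h j
  have : Nonempty (P j) := ⟨⟨y0, hy0⟩⟩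
  -- The infimum of ψ over P j serves as both bound and Lipschitz constant of u, and μ(P j) M is at
  -- most the integral of ψ. The two terms of the product rule give the factor 2.
  set M : ℝ := ⨅ z : P j, ψ z
  have hbdd : BddBelow (range fun z : P j => ψ z) :=
    ⟨0, by rintro _ ⟨z, rfl⟩; exact hu.nonneg h z⟩
  have hM0 : 0 ≤ M := le_ciInf fun z => hu.nonneg h z
  have hMz : ∀ z ∈ P j, M ≤ ψ z := fun z hz => ciInf_le hbdd (⟨z, hz⟩ : P j)
  refine (norm_branchWeight_smul_sub_le h hg (D := M) hM0
    (fun y hy => le_ciInf fun z => hu.norm_le j y hy z z.2) (fun y hy y' hy' => ?_) hM0 hx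
    hx').trans (mul_le_mul_of_nonneg_right ?_ hd)
  · rw [Real.iInf_mul_of_nonneg (dTheta_nonneg h.theta_pos.le _ _)]
    exact le_ciInf fun z => hu.norm_sub_le j y hy y' hy' z z.2
  · have h1 := measureReal_mul_le_setIntegral h hu.integrable hMz
    have h2 : branchWeight T P g j x * M * θ ≤ C * μ.real (P j) * M :=
      (mul_le_of_le_one_right (mul_nonneg (branchWeight_nonneg hg j x) hM0)
        h.theta_lt_one.le).trans (mul_le_mul_of_nonneg_right (branchWeight_le hg j x) hM0)
    nlinarith [mul_le_mul_of_nonneg_left h1 hg.const_nonneg]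

theorem mul_apply (h : IsGibbsMarkov μ T P θ) (hu : DominatedBy μ T P θ u ψ)
    (f : BTheta T P θ) : DominatedBy μ T P θ (fun y => u y * f y) (fun z => ψ z * ‖f‖) where
  measurable := hu.measurable.mul f.measurable
  integrable := hu.integrable.mul_const _
  norm_le j y hy z hz := by
    rw [norm_mul]
    exact mul_le_mul (hu.norm_le j y hy z hz) ((f.norm_apply_le y).trans f.sup_le_norm)
      (norm_nonneg _) (hu.nonneg h z)
  norm_sub_le j y hy y' hy' z hz := by
    have e : u y * f y - u y' * f y' = u y * (f y - f y') + (u y - u y') * f y' := by ring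
    have hd := dTheta_nonneg (T := T) (P := P) h.theta_pos.le y y'
    rw [e, f.norm_eq]
    refine (norm_add_le _ _).trans ?_
    rw [norm_mul, norm_mul]
    have h1 : ‖u y‖ * ‖f y - f y'‖ ≤ ψ z * (f.lip * dTheta T P θ y y') :=
      mul_le_mul (hu.norm_le j y hy z hz)
        (f.norm_apply_sub_le h.theta_pos h.separating hy hy') (norm_nonneg _) (hu.nonneg h z)
    have h2 : ‖u y - u y'‖ * ‖f y'‖ ≤ ψ z * dTheta T P θ y y' * f.sup :=
      mul_le_mul (hu.norm_sub_le j y hy y' hy' z hz) (f.norm_apply_le y') (norm_nonneg _)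
        (mul_nonneg (hu.nonneg h z) hd)
    linarith

/-- The function `R (u f)`, for a dominated function `u` and `f ∈ 𝓑_θ`. -/
def opFun (h : IsGibbsMarkov μ T P θ) (hg : IsWeight μ T P θ g C)
    (hu : DominatedBy μ T P θ u ψ) (f : BTheta T P θ) : BTheta T P θ :=
  BTheta.mk (branchSum T P g fun y => u y * f y)
    (measurable_branchSum h hg (hu.mul_apply h f).measurable)
    ⟨_, norm_branchSum_le h hg (hu.mul_apply h f).integrable (hu.mul_apply h f).norm_le⟩
    h.theta_pos.le
    ⟨_, fun _ _ hy _ hy' => (hu.mul_apply h f).norm_branchSum_sub_le h hg hy hy'⟩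

theorem summable (h : IsGibbsMarkov μ T P θ) (hg : IsWeight μ T P θ g C)
    (hu : DominatedBy μ T P θ u ψ) (f : BTheta T P θ) (x : Ω) :
    Summable fun j => branchWeight T P g j x • (u (branch T P j x) * f (branch T P j x)) :=
  (summable_norm_branchSum h hg (hu.mul_apply h f).integrable (hu.mul_apply h f).norm_le
    x).of_norm

/-- The constant is C for the supremum plus 2C for the Lipschitz seminorm. -/
theorem norm_opFun_le (h : IsGibbsMarkov μ T P θ) (hg : IsWeight μ T P θ g C)
    (hu : DominatedBy μ T P θ u ψ) (f : BTheta T P θ) :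
    ‖hu.opFun h hg f‖ ≤ 3 * C * (∫ z, ψ z ∂μ) * ‖f‖ := by
  have hI0 : 0 ≤ ∫ z, ψ z * ‖f‖ ∂μ :=
    integral_nonneg fun z => mul_nonneg (hu.nonneg h z) (norm_nonneg _)
  have hI : ∫ z, ψ z * ‖f‖ ∂μ = (∫ z, ψ z ∂μ) * ‖f‖ := integral_mul_const _ _
  have h1 : (hu.opFun h hg f).sup ≤ C * ∫ z, ψ z * ‖f‖ ∂μ :=
    BTheta.sup_le (mul_nonneg hg.const_nonneg hI0)
      (norm_branchSum_le h hg (hu.mul_apply h f).integrable (hu.mul_apply h f).norm_le)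
  have h2 : (hu.opFun h hg f).lip ≤ 2 * C * ∫ z, ψ z * ‖f‖ ∂μ :=
    BTheta.lip_le h.theta_pos.le (mul_nonneg (mul_nonneg zero_le_two hg.const_nonneg) hI0)
      fun _ _ hy _ hy' => (hu.mul_apply h f).norm_branchSum_sub_le h hg hy hy'
  rw [BTheta.norm_eq]
  rw [hI] at h1 h2
  linarith

/-- The operator `f ↦ R (u f)` on `𝓑_θ`, for a dominated function `u`. -/
def op (h : IsGibbsMarkov μ T P θ) (hg : IsWeight μ T P θ g C)
    (hu : DominatedBy μ T P θ u ψ) : BTheta T P θ →L[ℂ] BTheta T P θ :=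
  LinearMap.mkContinuous
    { toFun := hu.opFun h hg
      map_add' := fun f f' => by
        ext x
        simp only [opFun, BTheta.mk_apply, BTheta.add_apply, branchSum, mul_add, smul_add]
        exact (hu.summable h hg f x).tsum_add (hu.summable h hg f' x)
      map_smul' := fun c f => by
        ext x
        simp only [opFun, BTheta.mk_apply, BTheta.smul_apply, branchSum, RingHom.id_apply]
        rw [← tsum_mul_left]
        refine tsum_congr fun j => ?_
        rw [Complex.real_smul, Complex.real_smul]; ring }
    (3 * C * ∫ z, ψ z ∂μ) (hu.norm_opFun_le h hg)

theorem op_apply (h : IsGibbsMarkov μ T P θ) (hg : IsWeight μ T P θ g C)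
    (hu : DominatedBy μ T P θ u ψ) (f : BTheta T P θ) (x : Ω) :
    hu.op h hg f x = branchSum T P g (fun y => u y * f y) x := rfl

theorem norm_op_le (h : IsGibbsMarkov μ T P θ) (hg : IsWeight μ T P θ g C)
    (hu : DominatedBy μ T P θ u ψ) : ‖hu.op h hg‖ ≤ 3 * C * ∫ z, ψ z ∂μ :=
  LinearMap.mkContinuous_norm_le _ (mul_nonneg (mul_nonneg (by norm_num) hg.const_nonneg)
    (integral_nonneg fun z => hu.nonneg h z)) _

/-- The norm of an operator that acts as `f ↦ R (u f)` is controlled by any function that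
dominates `u`. -/
theorem norm_le_of_apply_eq (h : IsGibbsMarkov μ T P θ) (hg : IsWeight μ T P θ g C)
    (hu : DominatedBy μ T P θ u ψ) {A : BTheta T P θ →L[ℂ] BTheta T P θ}
    (hA : ∀ f x, A f x = branchSum T P g (fun y => u y * f y) x) :
    ‖A‖ ≤ 3 * C * ∫ z, ψ z ∂μ := by
  have : A = hu.op h hg := by
    ext f x; rw [hA, op_apply]
  rw [this]
  exact hu.norm_op_le h hg

end DominatedBy

/-! ### A criterion for a spectral gap -/

/-- Q₀ is a projection onto the line of e that commutes with A and satisfies A Q₀ = Q₀. Hence D = A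
- Q₀ annihilates and is annihilated by Q₀, and D^n = A^n - Q₀ for n ≥ 1. Since some power of D has
norm below 1, D has spectral radius below 1, and the spectral data of A are read off from those of D
and Q₀. -/
theorem hypH3_of_norm_pow_sub_lt_one {B : Type*} [NormedAddCommGroup B] [NormedSpace ℂ B]
    [CompleteSpace B] {A Q₀ : B →L[ℂ] B} {e : B} (he : e ≠ 0) (hAe : A e = e) (hQe : Q₀ e = e)
    (hQ : ∀ f, ∃ c : ℂ, Q₀ f = c • e) (hQA : ∀ f, Q₀ (A f) = Q₀ f) {N : ℕ} (hN : N ≠ 0)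
    (hlt : ‖A ^ N - Q₀‖ < 1) : HypH3 A := by
  have hAQ : A * Q₀ = Q₀ := by
    ext f
    obtain ⟨c, hc⟩ := hQ f
    simp [hc, hAe]
  have hQA' : Q₀ * A = Q₀ := by ext f; exact hQA f
  have hQQ : Q₀ * Q₀ = Q₀ := by
    ext f
    obtain ⟨c, hc⟩ := hQ f
    simp [hc, hQe]
  set D := A - Q₀ with hD
  have hDQ : D * Q₀ = 0 := by rw [hD, sub_mul, hAQ, hQQ, sub_self]
  have hQD : Q₀ * D = 0 := by rw [hD, mul_sub, hQA', hQQ, sub_self]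
  have hDpow : ∀ n : ℕ, D ^ (n + 1) = A ^ (n + 1) - Q₀ := by
    intro n
    induction n with
    | zero => simp [hD]
    | succ n ih =>
      have h1 : A ^ (n + 1) * Q₀ = Q₀ := by
        clear ih
        induction n with
        | zero => simpa using hAQ
        | succ n ih => rw [pow_succ, mul_assoc, hAQ, ih]
      rw [pow_succ, ih, sub_mul, hQD, sub_zero, hD, mul_sub, h1, ← pow_succ]
  have hDN : ‖D ^ N‖ < 1 := by
    obtain ⟨m, rfl⟩ := Nat.exists_eq_succ_of_ne_zero hN
    rw [Nat.succ_eq_add_one, hDpow]; exact hlt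
  have : Nontrivial B := ⟨e, 0, he⟩
  set r : ℝ := ‖D ^ N‖ ^ ((N : ℝ)⁻¹) with hr
  have hN0 : (N : ℝ) ≠ 0 := by exact_mod_cast hN
  have hr0 : 0 ≤ r := by positivity
  have hr1 : r < 1 := Real.rpow_lt_one (norm_nonneg _) hDN (by positivity)
  have hspec : ∀ z ∈ spectrum ℂ D, ‖z‖ ≤ r := by
    intro z hz
    have h1 : z ^ N ∈ spectrum ℂ (D ^ N) := spectrum.pow_image_subset D N ⟨z, hz, rfl⟩
    have h2 := spectrum.norm_le_norm_of_mem h1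
    rw [norm_pow] at h2
    rw [hr, Real.le_rpow_inv_iff_of_pos (norm_nonneg _) (norm_nonneg _)
      (Nat.cast_pos.2 (Nat.pos_of_ne_zero hN)), Real.rpow_natCast]
    exact h2
  have hfix : ∀ f, A f = f → Q₀ f = f := by
    intro f hf
    -- The defect f - Q₀ f is fixed by D, hence by D^N, which is a strict contraction; so it
    -- vanishes.
    have hDf : D (f - Q₀ f) = f - Q₀ f := by
      have h0 : D (Q₀ f) = 0 := congrArg (fun L : B →L[ℂ] B => L f) hDQ
      rw [map_sub, h0, sub_zero, hD, sub_apply, hf]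
    have hDn : ∀ n : ℕ, (D ^ n) (f - Q₀ f) = f - Q₀ f := by
      intro n
      induction n with
      | zero => simp
      | succ n ih => rw [pow_succ, mul_apply_eq_comp, hDf, ih]
    have h1 := (D ^ N).le_opNorm (f - Q₀ f)
    rw [hDn] at h1
    have h2 : ‖f - Q₀ f‖ = 0 := by
      by_contra hne
      have : 0 < ‖f - Q₀ f‖ := lt_of_le_of_ne (norm_nonneg _) (Ne.symm hne)
      nlinarith
    exact (sub_eq_zero.1 (norm_eq_zero.1 h2)).symm
  have hker : ∀ f, f ∈ LinearMap.ker (A - 1).toLinearMap ↔ A f = f := by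
    intro f
    rw [LinearMap.mem_ker]
    change A f - f = 0 ↔ _
    exact sub_eq_zero
  refine ⟨?_, ?_, r, hr1, ?_⟩
  · have : LinearMap.ker (A - 1).toLinearMap = Submodule.span ℂ {e} := by
      ext f
      rw [hker, Submodule.mem_span_singleton]
      constructor
      · intro hf
        obtain ⟨c, hc⟩ := hQ f
        exact ⟨c, by rw [← hc, hfix f hf]⟩
      · rintro ⟨c, rfl⟩
        rw [map_smul, hAe]
    rw [this, finrank_span_singleton he]
  · rw [isCompl_iff, Submodule.disjoint_def, codisjoint_iff_le_sup]
    constructor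
    · rintro f hf ⟨x, hx⟩
      have h1 : A x - x = f := hx
      rw [← hfix f ((hker f).1 hf), ← h1, map_sub, hQA, sub_self]
    · intro f _
      have hu : IsUnit (1 - D) := by
        have : (1 : ℂ) ∉ spectrum ℂ D := fun h1 => by
          have := hspec 1 h1; rw [norm_one] at this; linarith
        have := spectrum.notMem_iff.1 this
        rwa [map_one] at this
      obtain ⟨V, hV⟩ := hu.exists_right_inv
      have hVf : ∀ y, V y - D (V y) = y := fun y => by
        have := congrArg (fun L : B →L[ℂ] B => L y) hV
        simpa using this
      -- With V the inverse of 1 - D, the second summand is (A - 1) applied to -V (f - Q₀ f). This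
      -- works because Q₀ kills V (f - Q₀ f), so that A and D agree on it.
      refine Submodule.mem_sup.2 ⟨Q₀ f, ?_, f - Q₀ f, ?_, by abel⟩
      · rw [hker]; exact congrArg (fun L : B →L[ℂ] B => L f) hAQ
      · refine ⟨-V (f - Q₀ f), ?_⟩
        have hq : Q₀ (V (f - Q₀ f)) = 0 := by
          have h2 : Q₀ (D (V (f - Q₀ f))) = 0 :=
            congrArg (fun L : B →L[ℂ] B => L (V (f - Q₀ f))) hQD
          have h3 : Q₀ (Q₀ f) = Q₀ f := congrArg (fun L : B →L[ℂ] B => L f) hQQ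
          calc Q₀ (V (f - Q₀ f)) = Q₀ (V (f - Q₀ f) - D (V (f - Q₀ f))) := by
                rw [map_sub Q₀ (V _), h2, sub_zero]
            _ = Q₀ (f - Q₀ f) := by rw [hVf]
            _ = 0 := by rw [map_sub, h3, sub_self]
        change A (-V (f - Q₀ f)) - -V (f - Q₀ f) = f - Q₀ f
        have h4 := hVf (f - Q₀ f)
        rw [hD, sub_apply, hq, sub_zero] at h4
        rw [map_neg, sub_neg_eq_add, ← sub_eq_neg_add]
        exact h4
  · intro z hz hz1
    by_contra hlt'
    have hz0 : z ≠ 0 := by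
      rintro rfl; rw [norm_zero] at hlt'; exact hlt' hr0
    have hzD : IsUnit (algebraMap ℂ (B →L[ℂ] B) z - D) :=
      spectrum.notMem_iff.1 fun hmem => hlt' (hspec z hmem)
    have hzQ : IsUnit (algebraMap ℂ (B →L[ℂ] B) z - Q₀) := by
      have h0 : Commute (z • (1 : B →L[ℂ] B) - Q₀) Q₀ :=
        ((Commute.one_left Q₀).smul_left z).sub_left (Commute.refl Q₀)
      have hc : Commute (z • (1 : B →L[ℂ] B) - Q₀) (z⁻¹ • (1 - Q₀) + (z - 1)⁻¹ • Q₀) :=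
        (((Commute.one_right _).sub_right h0).smul_right _).add_right (h0.smul_right _)
      have hz1' : z - 1 ≠ 0 := sub_ne_zero.2 hz1
      -- A projection has the explicit resolvent z⁻¹ (1 - Q₀) + (z - 1)⁻¹ Q₀.
      have h1 : (z • (1 : B →L[ℂ] B) - Q₀) * (z⁻¹ • (1 - Q₀) + (z - 1)⁻¹ • Q₀) = 1 := by
        ext f
        have h3 : Q₀ (Q₀ f) = Q₀ f := congrArg (fun L : B →L[ℂ] B => L f) hQQ
        simp only [mul_apply_eq_comp, sub_apply, add_apply, smul_apply, one_apply_eq_self, map_add,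
          map_smul, map_sub, h3]
        match_scalars
        · field_simp
        · field_simp; ring
      have h2 := hc.eq.symm.trans h1
      rw [Algebra.algebraMap_eq_smul_one]
      exact ⟨⟨_, _, h1, h2⟩, rfl⟩
    -- Since D Q₀ = 0, (z - D)(z - Q₀) = z (z - A); for z ≠ 0, 1 outside the spectrum of D this
    -- makes z - A invertible.
    have hprod : (algebraMap ℂ (B →L[ℂ] B) z - D) * (algebraMap ℂ (B →L[ℂ] B) z - Q₀)
        = algebraMap ℂ (B →L[ℂ] B) z * (algebraMap ℂ (B →L[ℂ] B) z - A) := by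
      have e1 : A = D + Q₀ := by rw [hD, sub_add_cancel]
      rw [sub_mul, mul_sub D, hDQ, sub_zero, mul_sub, mul_sub, e1, mul_add,
        (Algebra.commutes z D).symm]
      abel
    have hu := hzD.mul hzQ
    rw [hprod] at hu
    have hzu : IsUnit (algebraMap ℂ (B →L[ℂ] B) z) := (isUnit_iff_ne_zero.2 hz0).map _
    obtain ⟨U, hU⟩ := hzu
    rw [← hU, Units.isUnit_units_mul, hU] at hu
    exact spectrum.mem_iff.1 hz hu

/-! ### Lasota–Yorke inequality and the spectral gap of mixing maps. -/

section Gap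

variable {Ω ι : Type*} [MeasurableSpace Ω] {μ : Measure Ω} {T : Ω → Ω} {P : ι → Set Ω} {θ : ℝ}
  [Nonempty Ω] {g : Ω → ℝ} {C : ℝ} [Countable ι] [IsProbabilityMeasure μ]

theorem dominatedBy_one (h : IsGibbsMarkov μ T P θ) :
    DominatedBy μ T P θ (fun _ => 1) (fun _ => 1) where
  measurable := measurable_const
  integrable := integrable_const 1
  norm_le := by simp
  norm_sub_le := by simp [dTheta_nonneg h.theta_pos.le]

/-- The transfer operator on `𝓑_θ`. -/
def IsGibbsMarkov.op (h : IsGibbsMarkov μ T P θ) (hg : IsWeight μ T P θ g C) :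
    BTheta T P θ →L[ℂ] BTheta T P θ :=
  (dominatedBy_one h).op h hg

theorem gmOp_apply (h : IsGibbsMarkov μ T P θ) (hg : IsWeight μ T P θ g C) (f : BTheta T P θ)
    (x : Ω) : h.op hg f x = branchSum T P g f.toFun x := by
  simp [IsGibbsMarkov.op, DominatedBy.op_apply]

theorem integral_gmOp_mul (h : IsGibbsMarkov μ T P θ) (hg : IsWeight μ T P θ g C)
    (f : BTheta T P θ) {φ : Ω → ℂ} (hφ : Measurable φ) (hb : ∃ M : ℝ, ∀ x, ‖φ x‖ ≤ M) :
    ∫ x, h.op hg f x * φ x ∂μ = ∫ x, f x * φ (T x) ∂μ := by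
  simp_rw [gmOp_apply]
  exact (isTransferImage_branchSum h hg f.measurable f.norm_apply_le).2 φ hφ hb

theorem integral_gmOp_pow_mul (h : IsGibbsMarkov μ T P θ) (hg : IsWeight μ T P θ g C) (m : ℕ)
    (f : BTheta T P θ) {φ : Ω → ℂ} (hφ : Measurable φ) (hb : ∃ M : ℝ, ∀ x, ‖φ x‖ ≤ M) :
    ∫ x, (h.op hg ^ m) f x * φ x ∂μ = ∫ x, f x * φ (T^[m] x) ∂μ := by
  induction m generalizing f with
  | zero => rfl
  | succ m ih =>
    obtain ⟨M, hM⟩ := hb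
    rw [pow_succ, mul_apply_eq_comp, ih]
    exact integral_gmOp_mul h hg f (hφ.comp (h.measurable.iterate m)) ⟨M, fun x => hM _⟩

/-- Invariance of μ gives this almost everywhere, and elements of 𝓑_θ that agree almost everywhere
agree at every point. -/
theorem gmOp_const (h : IsGibbsMarkov μ T P θ) (hg : IsWeight μ T P θ g C) :
    h.op hg (BTheta.const h.theta_pos.le 1) = BTheta.const h.theta_pos.le 1 := by
  refine BTheta.eq_of_ae_eq h hg ?_
  have h1 := isTransferImage_branchSum h hg (u := fun _ => 1) measurable_const (M := 1) (by simp)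
  have h2 : IsTransferImage μ T (fun _ => (1 : ℂ)) (fun _ => 1) := by
    refine ⟨integrable_const _, fun φ hφ _ => ?_⟩
    simp only [one_mul]
    have hmp := h.ergodic.toMeasurePreserving
    conv_lhs => rw [← hmp.map_eq]
    exact integral_map hmp.measurable.aemeasurable hφ.aestronglyMeasurable
  filter_upwards [h1.ae_eq h2] with x hx
  rw [gmOp_apply]
  exact hx

/-- R fixes the function 1 at every point, so R f is everywhere an average of f over preimages; no
exceptional null set remains. -/
theorem hasSum_branchWeight (h : IsGibbsMarkov μ T P θ) (hg : IsWeight μ T P θ g C) (x : Ω) :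
    HasSum (fun j => branchWeight T P g j x) 1 := by
  have hs : Summable fun j => branchWeight T P g j x :=
    Summable.of_nonneg_of_le (fun j => branchWeight_nonneg hg j x)
      (fun j => branchWeight_le hg j x) ((hasSum_measureReal h).summable.mul_left C)
  have h1 := congrArg (fun f : BTheta T P θ => f x) (gmOp_const h hg)
  simp only [gmOp_apply, BTheta.const_apply] at h1
  have h2 : ((∑' j, branchWeight T P g j x : ℝ) : ℂ) = 1 := by
    rw [← h1, Complex.ofReal_tsum, branchSum]
    refine tsum_congr fun j => ?_
    simp
  have h3 : ∑' j, branchWeight T P g j x = 1 := by exact_mod_cast h2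
  exact h3 ▸ hs.hasSum

theorem sup_gmOp_le (h : IsGibbsMarkov μ T P θ) (hg : IsWeight μ T P θ g C)
    (f : BTheta T P θ) : (h.op hg f).sup ≤ f.sup := by
  refine BTheta.sup_le f.sup_nonneg fun x => ?_
  rw [gmOp_apply]
  have := tsum_of_norm_bounded ((hasSum_branchWeight h hg x).mul_right f.sup)
    (f := fun j => branchWeight T P g j x • f (branch T P j x)) fun j => by
      rw [norm_smul, Real.norm_of_nonneg (branchWeight_nonneg hg j x)]
      exact mul_le_mul_of_nonneg_left (f.norm_apply_le _) (branchWeight_nonneg hg j x)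
  rwa [one_mul] at this

/-- Lasota–Yorke inequality: the contraction terms carry weights that sum to 1 and leave the factor
θ, while the oscillation of the weights costs C μ(P j) |f|_∞ per branch, in total C |f|_∞. -/
theorem lip_gmOp_le (h : IsGibbsMarkov μ T P θ) (hg : IsWeight μ T P θ g C)
    (f : BTheta T P θ) : (h.op hg f).lip ≤ θ * f.lip + C * f.sup := by
  refine BTheta.lip_le h.theta_pos.le (add_nonneg (mul_nonneg h.theta_pos.le f.lip_nonneg)
    (mul_nonneg hg.const_nonneg f.sup_nonneg)) fun k x hx x' hx' => ?_
  have hs := fun x => (summable_norm_branchSum_of_bounded h hg f.norm_apply_le x).of_norm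
  rw [gmOp_apply, gmOp_apply, branchSum, branchSum, ← (hs x).tsum_sub (hs x')]
  have h1 := ((((hasSum_branchWeight h hg x).mul_right f.lip).mul_right θ).add
    (((hasSum_measureReal h).mul_left C).mul_right f.sup)).mul_right (dTheta T P θ x x')
  have := tsum_of_norm_bounded h1 fun j =>
    norm_branchWeight_smul_sub_le h hg f.sup_nonneg (fun y _ => f.norm_apply_le y)
      (fun y hy y' hy' => f.norm_apply_sub_le h.theta_pos h.separating hy hy') f.lip_nonneg hx hx'
  refine this.trans_eq ?_
  ring

theorem sup_gmOp_pow_le (h : IsGibbsMarkov μ T P θ) (hg : IsWeight μ T P θ g C) (m : ℕ)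
    (f : BTheta T P θ) : ((h.op hg ^ m) f).sup ≤ f.sup := by
  induction m generalizing f with
  | zero => rfl
  | succ m ih =>
    rw [pow_succ, mul_apply_eq_comp]
    exact (ih _).trans (sup_gmOp_le h hg f)

theorem lip_gmOp_pow_le (h : IsGibbsMarkov μ T P θ) (hg : IsWeight μ T P θ g C) (m : ℕ)
    (f : BTheta T P θ) :
    ((h.op hg ^ m) f).lip ≤ θ ^ m * f.lip + C / (1 - θ) * f.sup := by
  have hθ : 0 < 1 - θ := by linarith [h.theta_lt_one]
  induction m with
  | zero =>
    simp only [pow_zero, one_mul]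
    exact le_add_of_nonneg_right (mul_nonneg (div_nonneg hg.const_nonneg hθ.le) f.sup_nonneg)
  | succ m ih =>
    rw [pow_succ', mul_apply_eq_comp]
    refine (lip_gmOp_le h hg _).trans ?_
    have h1 := mul_le_mul_of_nonneg_left ih h.theta_pos.le
    have h2 := mul_le_mul_of_nonneg_left (sup_gmOp_pow_le h hg m f) hg.const_nonneg
    have e : C / (1 - θ) * f.sup = θ * (C / (1 - θ) * f.sup) + C * f.sup := by
      field_simp; ring
    rw [e, pow_succ']
    linarith

theorem norm_gmOp_pow_apply_le (h : IsGibbsMarkov μ T P θ) (hg : IsWeight μ T P θ g C) (m : ℕ)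
    (f : BTheta T P θ) :
    ‖(h.op hg ^ m) f‖ ≤ (1 + C / (1 - θ)) * f.sup + θ ^ m * f.lip := by
  rw [BTheta.norm_eq]
  linarith [sup_gmOp_pow_le h hg m f, lip_gmOp_pow_le h hg m f]

/-! ### Escape from a finite alphabet. -/

open Classical in
/-- The number of times `k < n` at which the orbit of `y` is outside `⋃ j ∈ J, P j`. -/
def exitCount (T : Ω → Ω) (P : ι → Set Ω) (J : Finset ι) (n : ℕ) (y : Ω) : ℝ :=
  ∑ k ∈ Finset.range n, if T^[k] y ∈ ⋃ j ∈ J, P j then 0 else 1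

theorem exitCount_nonneg (J : Finset ι) (n : ℕ) (y : Ω) : 0 ≤ exitCount T P J n y :=
  Finset.sum_nonneg fun k _ => by split_ifs <;> norm_num

open Classical in
theorem exitCount_succ (J : Finset ι) (n : ℕ) (y : Ω) :
    exitCount T P J (n + 1) y
      = (if y ∈ ⋃ j ∈ J, P j then 0 else 1) + exitCount T P J n (T y) := by
  rw [exitCount, Finset.sum_range_succ', add_comm]
  rfl

theorem one_le_exitCount {J : Finset ι} {n k : ℕ} {y : Ω} (hk : k < n)
    (hy : T^[k] y ∉ ⋃ j ∈ J, P j) : 1 ≤ exitCount T P J n y := by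
  classical
  have := Finset.single_le_sum (f := fun k => if T^[k] y ∈ ⋃ j ∈ J, P j then (0 : ℝ) else 1)
    (fun k _ => by split_ifs <;> norm_num) (Finset.mem_range.2 hk)
  simp only [if_neg hy] at this
  exact this

/-- R^n averages over the preimages of order n. At each step a branch outside J is taken with total
weight at most δ, so the mean number of exits is at most n δ. The induction peels off one step at a
time, each step raising a by b δ. -/
theorem norm_gmOp_pow_apply_le_of_le_exitCount (h : IsGibbsMarkov μ T P θ)
    (hg : IsWeight μ T P θ g C) {J : Finset ι} {δ : ℝ}
    (hδ : ∀ x, 1 - ∑ j ∈ J, branchWeight T P g j x ≤ δ) (n : ℕ) (f : BTheta T P θ) {a b : ℝ}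
    (hb : 0 ≤ b) (hf : ∀ y, ‖f y‖ ≤ a + b * exitCount T P J n y) (x : Ω) :
    ‖(h.op hg ^ n) f x‖ ≤ a + b * (n * δ) := by
  classical
  induction n generalizing f a with
  | zero => simpa [exitCount] using hf x
  | succ n ih =>
    rw [pow_succ, mul_apply_eq_comp]
    refine (ih (h.op hg f) (a := a + b * δ) fun y => ?_).trans_eq (by push_cast; ring)
    rw [gmOp_apply]
    set K := a + b * exitCount T P J n y
    -- Branches outside J are charged K + b, one exit more, and branches in J only K; the total is K
    -- plus b times the weight outside J.
    have hs : HasSum (fun j => branchWeight T P g j y * (K + b)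
        - if j ∈ J then branchWeight T P g j y * b else 0)
        (1 * (K + b) - ∑ j ∈ J, if j ∈ J then branchWeight T P g j y * b else 0) :=
      ((hasSum_branchWeight h hg y).mul_right (K + b)).sub
        (hasSum_sum_of_ne_finset_zero fun j hj => if_neg hj)
    have h1 := tsum_of_norm_bounded hs
      (f := fun j => branchWeight T P g j y • f (branch T P j y)) fun j => by
        have hw := branchWeight_nonneg hg j y
        by_cases hy : y ∈ T '' P j
        · rw [norm_smul, Real.norm_of_nonneg hw]
          have h2 := mul_le_mul_of_nonneg_left (hf (branch T P j y)) hw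
          rw [exitCount_succ, apply_branch hy] at h2
          refine h2.trans ?_
          by_cases hj : j ∈ J
          · have : branch T P j y ∈ ⋃ j ∈ J, P j := mem_biUnion hj (branch_mem hy)
            rw [if_pos this, if_pos hj, zero_add]
            simp only [K]
            exact le_of_eq (by ring)
          · rw [if_neg hj, sub_zero]
            refine mul_le_mul_of_nonneg_left ?_ hw
            have : (if branch T P j y ∈ ⋃ j ∈ J, P j then (0 : ℝ) else 1) ≤ 1 := by
              split_ifs <;> norm_num
            simp only [K]
            nlinarith
        · simp [branchWeight, indicator_of_notMem hy]
    refine h1.trans ?_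
    rw [Finset.sum_congr rfl fun j hj => if_pos hj, ← Finset.sum_mul]
    have := mul_le_mul_of_nonneg_left (hδ y) hb
    simp only [K]
    linarith

/-- Compare the two tails outside J term by term. The bound is uniform in x, so one finite alphabet
serves all points. -/
theorem one_sub_sum_branchWeight_le (h : IsGibbsMarkov μ T P θ) (hg : IsWeight μ T P θ g C)
    (J : Finset ι) (x : Ω) :
    1 - ∑ j ∈ J, branchWeight T P g j x ≤ C * (1 - ∑ j ∈ J, μ.real (P j)) := by
  classical
  have aux : ∀ w : ι → ℝ, HasSum w 1 →
      HasSum (fun j => w j - if j ∈ J then w j else 0) (1 - ∑ j ∈ J, w j) := fun w hw => by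
    have := hw.sub (hasSum_sum_of_ne_finset_zero (f := fun j => if j ∈ J then w j else 0)
      fun j hj => if_neg hj)
    rwa [Finset.sum_congr rfl fun j hj => if_pos hj] at this
  refine hasSum_le (fun j => ?_) (aux _ (hasSum_branchWeight h hg x))
    ((aux _ (hasSum_measureReal h)).mul_left C)
  by_cases hj : j ∈ J
  · simp [hj]
  · simpa [hj] using branchWeight_le hg j x

theorem exists_finset_one_sub_lt (h : IsGibbsMarkov μ T P θ) {ε : ℝ} (hε : 0 < ε) :
    ∃ J : Finset ι, 1 - ∑ j ∈ J, μ.real (P j) < ε := by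
  obtain ⟨J, hJ⟩ := ((hasSum_measureReal h).eventually_const_lt
    (show 1 - ε < 1 by linarith)).exists
  exact ⟨J, by linarith⟩

theorem integral_exitCount (h : IsGibbsMarkov μ T P θ) (J : Finset ι) (n : ℕ) :
    Integrable (exitCount T P J n) μ ∧
      ∫ y, exitCount T P J n y ∂μ = n * (1 - ∑ j ∈ J, μ.real (P j)) := by
  classical
  have hU : MeasurableSet (⋃ j ∈ J, P j) := J.measurableSet_biUnion fun j _ => h.measurableSet j
  have e : ∀ k y, (if T^[k] y ∈ ⋃ j ∈ J, P j then (0 : ℝ) else 1)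
      = (T^[k] ⁻¹' (⋃ j ∈ J, P j)ᶜ).indicator (fun _ => 1) y := fun k y => by
    by_cases hy : T^[k] y ∈ ⋃ j ∈ J, P j
    · rw [if_pos hy, indicator_of_notMem (by simpa using hy)]
    · rw [if_neg hy, indicator_of_mem hy]
  have hm : ∀ k, MeasurableSet (T^[k] ⁻¹' (⋃ j ∈ J, P j)ᶜ) := fun k =>
    h.measurable.iterate k hU.compl
  have hi : ∀ k, Integrable (fun y => if T^[k] y ∈ ⋃ j ∈ J, P j then (0 : ℝ) else 1) μ :=
    fun k => by
      simp_rw [e]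
      exact (integrable_const 1).indicator (hm k)
  have hJ : μ.real (⋃ j ∈ J, P j) = ∑ j ∈ J, μ.real (P j) :=
    measureReal_biUnion_finset (fun i _ j _ hij => h.disjoint hij) fun j _ => h.measurableSet j
  refine ⟨integrable_finsetSum _ fun k _ => hi k, ?_⟩
  simp only [exitCount]
  rw [integral_finsetSum _ fun k _ => hi k]
  have : ∀ k, ∫ y, (if T^[k] y ∈ ⋃ j ∈ J, P j then (0 : ℝ) else 1) ∂μ
      = 1 - ∑ j ∈ J, μ.real (P j) := fun k => by
    simp_rw [e]
    have hmp := (h.ergodic.toMeasurePreserving.iterate k)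
    rw [integral_indicator_const _ (hm k), measureReal_def,
      hmp.measure_preimage hU.compl.nullMeasurableSet, ← measureReal_def,
      probReal_compl_eq_one_sub hU, hJ]
    simp
  simp_rw [this]
  simp [mul_sub]

/-! ### Cylinders over a finite alphabet, and uniform mixing. -/

/-- The cylinder of the points whose itinerary begins with `w`. -/
def wordCyl (T : Ω → Ω) (P : ι → Set Ω) {n : ℕ} (w : Fin n → ι) : Set Ω :=
  {z | ∀ k : Fin n, T^[k] z ∈ P (w k)}

theorem measurableSet_wordCyl (h : IsGibbsMarkov μ T P θ) {n : ℕ} (w : Fin n → ι) :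
    MeasurableSet (wordCyl T P w) := by
  have : wordCyl T P w = ⋂ k : Fin n, T^[k] ⁻¹' P (w k) := by ext z; simp [wordCyl]
  rw [this]
  exact .iInter fun k => (h.measurable.iterate k) (h.measurableSet _)

theorem norm_sub_le_of_mem_wordCyl (h : IsGibbsMarkov μ T P θ) (f : BTheta T P θ) {n : ℕ}
    (hn : 0 < n) {w : Fin n → ι} {y z : Ω} (hy : y ∈ wordCyl T P w) (hz : z ∈ wordCyl T P w) :
    ‖f y - f z‖ ≤ f.lip * θ ^ n :=
  (f.norm_apply_sub_le h.theta_pos h.separating (hy ⟨0, hn⟩) (hz ⟨0, hn⟩)).trans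
    (mul_le_mul_of_nonneg_left (dTheta_le_pow h.theta_pos.le h.theta_lt_one.le fun k hk =>
      ⟨_, hy ⟨k, hk⟩, hz ⟨k, hk⟩⟩) f.lip_nonneg)

theorem mem_wordCyl_idx (h : IsGibbsMarkov μ T P θ) (n : ℕ) (y : Ω) :
    y ∈ wordCyl T P fun k : Fin n => h.idx (T^[k] y) :=
  fun _ => h.mem_idx _

theorem wordCyl_eq (h : IsGibbsMarkov μ T P θ) {n : ℕ} {w : Fin n → ι} {y : Ω}
    (hy : y ∈ wordCyl T P w) : (fun k : Fin n => h.idx (T^[k] y)) = w :=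
  funext fun k => h.idx_eq (hy k)

theorem measure_wordCyl_pos (h : IsGibbsMarkov μ T P θ) (hg : IsWeight μ T P θ g C) (n : ℕ)
    (y : Ω) : 0 < μ (wordCyl T P fun k : Fin n => h.idx (T^[k] y)) :=
  (measure_inter_cyl_pos h hg n y).trans_le (measure_mono fun _ hz k => hz.2 k k.2)

open Classical in
/-- The words of length `n` in the alphabet `J` whose cylinder is not empty. -/
def words (T : Ω → Ω) (P : ι → Set Ω) (J : Finset ι) (n : ℕ) : Finset (Fin n → ι) :=
  (Fintype.piFinset fun _ => J).filter fun w => (wordCyl T P w).Nonempty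

theorem idx_mem_words (h : IsGibbsMarkov μ T P θ) {J : Finset ι} {n : ℕ} {y : Ω}
    (hy : ∀ k < n, T^[k] y ∈ ⋃ j ∈ J, P j) :
    (fun k : Fin n => h.idx (T^[k] y)) ∈ words T P J n := by
  classical
  refine Finset.mem_filter.2 ⟨Fintype.mem_piFinset.2 fun k => ?_, y, mem_wordCyl_idx h n y⟩
  obtain ⟨j, hj, hyj⟩ := mem_iUnion₂.1 (hy k k.2)
  rw [h.idx_eq hyj]
  exact hj

theorem nonempty_of_mem_words {J : Finset ι} {n : ℕ} {w : Fin n → ι}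
    (hw : w ∈ words T P J n) : (wordCyl T P w).Nonempty := by
  classical
  exact (Finset.mem_filter.1 hw).2

theorem measureReal_wordCyl_pos (h : IsGibbsMarkov μ T P θ) (hg : IsWeight μ T P θ g C)
    {J : Finset ι} {n : ℕ} {w : Fin n → ι} (hw : w ∈ words T P J n) :
    0 < μ.real (wordCyl T P w) := by
  obtain ⟨y, hy⟩ := nonempty_of_mem_words hw
  have := measure_wordCyl_pos h hg n y
  rw [wordCyl_eq h hy] at this
  exact ENNReal.toReal_pos this.ne' (measure_ne_top _ _)

/-- A function whose averages over the cylinders of length `n` in a finite alphabet are small is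
small, up to the oscillation on cylinders, except at points that leave the alphabet. -/
theorem norm_apply_le_of_average_le (h : IsGibbsMarkov μ T P θ) (hg : IsWeight μ T P θ g C)
    {J : Finset ι} {n : ℕ} (hn : 0 < n) (f : BTheta T P θ) {η : ℝ} (hη0 : 0 ≤ η)
    (hη : ∀ w ∈ words T P J n,
      ‖∫ z in wordCyl T P w, f z ∂μ‖ ≤ η * μ.real (wordCyl T P w)) (y : Ω) :
    ‖f y‖ ≤ (f.lip * θ ^ n + η) + f.sup * exitCount T P J n y := by
  have hθ := h.theta_pos.le
  by_cases hy : ∀ k < n, T^[k] y ∈ ⋃ j ∈ J, P j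
  · have hw := idx_mem_words h hy
    have hyw := mem_wordCyl_idx h n y
    set w := fun k : Fin n => h.idx (T^[k] y)
    have hpos := measureReal_wordCyl_pos h hg hw
    have h1 : ‖∫ z in wordCyl T P w, (f y - f z) ∂μ‖
        ≤ f.lip * θ ^ n * μ.real (wordCyl T P w) :=
      norm_setIntegral_le_of_norm_le_const (measure_lt_top _ _)
        fun z hz => norm_sub_le_of_mem_wordCyl h f hn hyw hz
    rw [integral_sub (integrable_const _) (f.integrable μ).integrableOn, setIntegral_const] at h1
    have h2 := norm_le_norm_add_norm_sub' (μ.real (wordCyl T P w) • f y)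
      (∫ z in wordCyl T P w, f z ∂μ)
    rw [norm_smul, Real.norm_of_nonneg hpos.le] at h2
    have h3 : ‖f y‖ ≤ f.lip * θ ^ n + η := by
      have := hη w hw
      refine le_of_mul_le_mul_left ?_ hpos
      linarith
    exact h3.trans (le_add_of_nonneg_right (mul_nonneg f.sup_nonneg (exitCount_nonneg _ _ _)))
  · push Not at hy
    obtain ⟨k, hk, hky⟩ := hy
    have h1 := mul_le_mul_of_nonneg_left (one_le_exitCount hk hky) f.sup_nonneg
    have h2 := f.norm_apply_le y
    have h3 : 0 ≤ f.lip * θ ^ n := mul_nonneg f.lip_nonneg (pow_nonneg hθ n)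
    linarith

open Classical in
/-- A function is close to a combination of indicators of cylinders. -/
theorem norm_sub_sum_indicator_le (h : IsGibbsMarkov μ T P θ) {J : Finset ι} {n : ℕ}
    (hn : 0 < n) (f : BTheta T P θ) {p : (Fin n → ι) → Ω}
    (hp : ∀ w ∈ words T P J n, p w ∈ wordCyl T P w) (y : Ω) :
    ‖f y - ∑ w ∈ words T P J n, f (p w) * (wordCyl T P w).indicator 1 y‖
      ≤ f.lip * θ ^ n + f.sup * exitCount T P J n y := by
  have hl : 0 ≤ f.lip * θ ^ n := mul_nonneg f.lip_nonneg (pow_nonneg h.theta_pos.le n)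
  by_cases hy : ∀ k < n, T^[k] y ∈ ⋃ j ∈ J, P j
  · have hw := idx_mem_words h hy
    have hyw := mem_wordCyl_idx h n y
    rw [Finset.sum_eq_single_of_mem _ hw fun w' _ hne => ?_]
    · rw [indicator_of_mem hyw, Pi.one_apply, mul_one]
      exact (norm_sub_le_of_mem_wordCyl h f hn hyw (hp _ hw)).trans
        (le_add_of_nonneg_right (mul_nonneg f.sup_nonneg (exitCount_nonneg _ _ _)))
    · rw [indicator_of_notMem fun hy' => hne (wordCyl_eq h hy').symm, mul_zero]
  · push Not at hy
    obtain ⟨k, hk, hky⟩ := hy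
    rw [Finset.sum_eq_zero fun w hw => ?_]
    · have h1 := mul_le_mul_of_nonneg_left (one_le_exitCount hk hky) f.sup_nonneg
      have h2 := f.norm_apply_le y
      rw [sub_zero]
      linarith
    · rw [indicator_of_notMem fun hy' => hky ?_, mul_zero]
      have := Fintype.mem_piFinset.1 (Finset.mem_filter.1 hw).1 ⟨k, hk⟩
      exact mem_biUnion this (hy' ⟨k, hk⟩)

/-- Mixing is assumed for one pair of sets at a time. Uniformity over the unit ball comes from
replacing f by a combination of finitely many cylinder indicators with coefficients at most ‖f‖; for
these only finitely many pairs matter. -/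
theorem eventually_norm_setIntegral_gmOp_pow_le (h : IsGibbsMarkov μ T P θ) (hmix : IsMixing μ T)
    (hg : IsWeight μ T P θ g C) {D : Set Ω} (hD : MeasurableSet D) {ε : ℝ} (hε : 0 < ε) :
    ∀ᶠ m : ℕ in atTop, ∀ f : BTheta T P θ, ∫ y, f y ∂μ = 0 →
      ‖∫ y in D, (h.op hg ^ m) f y ∂μ‖ ≤ ε * ‖f‖ := by
  classical
  -- The error of the approximation is later integrated against a function bounded by 2, so a
  -- quarter of ε each for oscillation and exits leaves ε / 2.
  obtain ⟨n, hnθ, hn⟩ : ∃ n : ℕ, θ ^ n < ε / 4 ∧ 0 < n :=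
    ((((tendsto_pow_atTop_nhds_zero_of_lt_one h.theta_pos.le h.theta_lt_one).eventually_lt_const
      (show 0 < ε / 4 by positivity))).and (eventually_gt_atTop 0)).exists
  have hn' : (0 : ℝ) < n := by exact_mod_cast hn
  obtain ⟨J, hJ⟩ := exists_finset_one_sub_lt h (show 0 < ε / 4 / n by positivity)
  have hJ' : n * (1 - ∑ j ∈ J, μ.real (P j)) ≤ ε / 4 := by
    rw [lt_div_iff₀ hn'] at hJ; linarith
  have hW : ∀ w : Fin n → ι, ∃ p, w ∈ words T P J n → p ∈ wordCyl T P w := fun w => by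
    by_cases hw : w ∈ words T P J n
    · obtain ⟨y, hy⟩ := nonempty_of_mem_words hw
      exact ⟨y, fun _ => hy⟩
    · exact ⟨Classical.arbitrary Ω, fun hw' => absurd hw' hw⟩
  choose p hp using hW
  set W := words T P J n with hWdef
  have hlim : Tendsto (fun m : ℕ => ∑ w ∈ W,
      |μ.real (wordCyl T P w ∩ T^[m] ⁻¹' D) - μ.real (wordCyl T P w) * μ.real D|) atTop
      (𝓝 0) := by
    rw [show (0 : ℝ) = ∑ w ∈ W, 0 by simp]
    refine tendsto_finsetSum _ fun w _ => ?_
    have h1 := (ENNReal.tendsto_toReal (by finiteness)).comp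
      (hmix _ D (measurableSet_wordCyl h w) hD)
    rw [ENNReal.toReal_mul] at h1
    have h2 := (h1.sub_const (μ.real (wordCyl T P w) * μ.real D)).abs
    simpa [measureReal_def] using h2
  filter_upwards [hlim.eventually_lt_const (show 0 < ε / 2 by positivity)] with m hm f hf0
  set φ : Ω → ℂ := D.indicator 1 with hφ
  have hφm : Measurable φ := measurable_one.indicator hD
  have hφb : ∀ x, ‖φ x‖ ≤ 1 := fun x => by
    by_cases hx : x ∈ D <;> simp [hφ, hx]
  -- Subtracting μ(D) is free because f has mean zero, and it turns the integral of G over a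
  -- cylinder into the defect in the mixing relation.
  set G : Ω → ℂ := fun y => φ (T^[m] y) - μ.real D with hG
  have hGm : Measurable G := (hφm.comp (h.measurable.iterate m)).sub_const _
  have hGb : ∀ y, ‖G y‖ ≤ 2 := fun y => by
    refine (norm_sub_le _ _).trans ?_
    rw [Complex.norm_real, Real.norm_of_nonneg measureReal_nonneg]
    linarith [hφb (T^[m] y), measureReal_le_one (μ := μ) (s := D)]
  have e1 : ∫ y in D, (h.op hg ^ m) f y ∂μ = ∫ y, f y * G y ∂μ := by
    have h1 := integral_gmOp_pow_mul h hg m f hφm ⟨1, hφb⟩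
    have h2 : ∫ y in D, (h.op hg ^ m) f y ∂μ = ∫ y, (h.op hg ^ m) f y * φ y ∂μ := by
      rw [← integral_indicator hD]
      refine integral_congr_ae (ae_of_all _ fun y => ?_)
      by_cases hy : y ∈ D <;> simp [hφ, hy]
    have hi : Integrable (fun y => f y * φ (T^[m] y)) μ :=
      (f.integrable μ).mul_bdd (c := 1) (hφm.comp (h.measurable.iterate m)).aestronglyMeasurable
        (ae_of_all _ fun y => hφb _)
    simp only [hG, mul_sub]
    rw [integral_sub hi ((f.integrable μ).mul_const _), integral_mul_const, hf0, zero_mul,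
      sub_zero, h2, h1]
  set s : Ω → ℂ := fun y => ∑ w ∈ W, f (p w) * (wordCyl T P w).indicator 1 y with hs
  have hcm : ∀ w : Fin n → ι, Measurable ((wordCyl T P w).indicator (1 : Ω → ℂ)) := fun w =>
    measurable_one.indicator (measurableSet_wordCyl h w)
  have hGi : Integrable G μ := Integrable.of_bound hGm.aestronglyMeasurable 2 (ae_of_all _ hGb)
  have hcG : ∀ w : Fin n → ι, Integrable (fun y => (wordCyl T P w).indicator 1 y * G y) μ :=
    fun w => hGi.bdd_mul (c := 1) (hcm w).aestronglyMeasurable (ae_of_all _ fun y => by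
      by_cases hy : y ∈ wordCyl T P w <;> simp [hy])
  have hsG : Integrable (fun y => s y * G y) μ := by
    simp only [hs, Finset.sum_mul, mul_assoc]
    exact integrable_finsetSum _ fun w _ => (hcG w).const_mul _
  have hfG : Integrable (fun y => f y * G y) μ :=
    (f.integrable μ).mul_bdd (c := 2) hGm.aestronglyMeasurable (ae_of_all _ hGb)
  have e2 : ∫ y, f y * G y ∂μ = ∫ y, (f y - s y) * G y ∂μ + ∫ y, s y * G y ∂μ := by
    rw [← integral_add ?_ hsG]
    · simp only [sub_mul, sub_add_cancel]
    · simp only [sub_mul]; exact hfG.sub hsG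
  have e3 : ∀ w : Fin n → ι, ∫ y, (wordCyl T P w).indicator 1 y * G y ∂μ
      = ((μ.real (wordCyl T P w ∩ T^[m] ⁻¹' D) - μ.real (wordCyl T P w) * μ.real D : ℝ) : ℂ) := by
    intro w
    have hDm : MeasurableSet (T^[m] ⁻¹' D) := h.measurable.iterate m hD
    have hA : ∀ y, (wordCyl T P w).indicator (1 : Ω → ℂ) y * G y
        = (wordCyl T P w ∩ T^[m] ⁻¹' D).indicator (fun _ => (1 : ℂ)) y
          - (wordCyl T P w).indicator (fun _ => (μ.real D : ℂ)) y := fun y => by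
      by_cases hy : y ∈ wordCyl T P w <;> by_cases hy' : T^[m] y ∈ D <;>
        simp [hG, hφ, hy, hy']
    simp_rw [hA]
    rw [integral_sub ((integrable_const _).indicator ((measurableSet_wordCyl h w).inter hDm))
      ((integrable_const _).indicator (measurableSet_wordCyl h w)),
      integral_indicator_const _ ((measurableSet_wordCyl h w).inter hDm),
      integral_indicator_const _ (measurableSet_wordCyl h w)]
    simp
  have b1 : ‖∫ y, (f y - s y) * G y ∂μ‖ ≤ ε / 2 * ‖f‖ := by
    obtain ⟨hci, hce⟩ := integral_exitCount h J n
    have hbi : Integrable (fun y => (f.lip * θ ^ n + f.sup * exitCount T P J n y) * 2) μ :=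
      ((integrable_const _).add (hci.const_mul _)).mul_const _
    refine (norm_integral_le_of_norm_le hbi (ae_of_all _ fun y => ?_)).trans ?_
    · rw [norm_mul]
      exact mul_le_mul (norm_sub_sum_indicator_le h hn f (fun w hw => hp w hw) y) (hGb y)
        (norm_nonneg _) (add_nonneg (mul_nonneg f.lip_nonneg (pow_nonneg h.theta_pos.le n))
          (mul_nonneg f.sup_nonneg (exitCount_nonneg _ _ _)))
    · rw [integral_mul_const, integral_add (integrable_const _) (hci.const_mul _),
        integral_const_mul f.sup, hce, integral_const, f.norm_eq]
      simp only [probReal_univ, one_smul]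
      have h1 := mul_le_mul_of_nonneg_left hnθ.le f.lip_nonneg
      have h2 := mul_le_mul_of_nonneg_left hJ' f.sup_nonneg
      linarith
  have b2 : ‖∫ y, s y * G y ∂μ‖ ≤ ε / 2 * ‖f‖ := by
    simp only [hs, Finset.sum_mul, mul_assoc]
    rw [integral_finsetSum _ fun w _ => (hcG w).const_mul _]
    refine (norm_sum_le _ _).trans ?_
    calc ∑ w ∈ W, ‖∫ y, f (p w) * ((wordCyl T P w).indicator 1 y * G y) ∂μ‖
        ≤ ∑ w ∈ W, ‖f‖ * |μ.real (wordCyl T P w ∩ T^[m] ⁻¹' D)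
            - μ.real (wordCyl T P w) * μ.real D| := Finset.sum_le_sum fun w _ => by
          rw [integral_const_mul, e3, norm_mul, Complex.norm_real, Real.norm_eq_abs]
          exact mul_le_mul_of_nonneg_right ((f.norm_apply_le _).trans f.sup_le_norm) (abs_nonneg _)
      _ ≤ _ := by
          rw [← Finset.mul_sum, mul_comm]
          exact mul_le_mul_of_nonneg_right hm.le (norm_nonneg _)
  rw [e1, e2]
  exact (norm_add_le _ _).trans (by linarith)

/-- The N = m + n + n iterates have three tasks: m make the averages over the chosen cylinders small
by mixing, n make the supremum small by averaging out the exits, and n make the Lipschitz seminorm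
small by Lasota–Yorke. -/
theorem exists_norm_gmOp_pow_le (h : IsGibbsMarkov μ T P θ) (hmix : IsMixing μ T)
    (hg : IsWeight μ T P θ g C) {ε : ℝ} (hε : 0 < ε) :
    ∃ N : ℕ, N ≠ 0 ∧ ∀ f : BTheta T P θ, ∫ y, f y ∂μ = 0 → ‖(h.op hg ^ N) f‖ ≤ ε * ‖f‖ := by
  have hθ : 0 < 1 - θ := by linarith [h.theta_lt_one]
  set H := 1 + C / (1 - θ) with hH
  have hH1 : 1 ≤ H := le_add_of_nonneg_right (div_nonneg hg.const_nonneg hθ.le)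
  have hH0 : 0 < H := by linarith
  have hbd : ∀ m (f : BTheta T P θ), ‖(h.op hg ^ m) f‖ ≤ H * ‖f‖ := fun m f => by
    refine (norm_gmOp_pow_apply_le h hg m f).trans ?_
    have h1 : θ ^ m * f.lip ≤ H * f.lip := mul_le_mul_of_nonneg_right
      ((pow_le_one₀ h.theta_pos.le h.theta_lt_one.le).trans hH1) f.lip_nonneg
    rw [f.norm_eq, mul_add]
    linarith
  -- The final bound is H · 3 ε₁ H from the supremum and ε₁ H ≤ ε₁ H² from the Lipschitz part,
  -- together 4 H² ε₁ = ε.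
  set ε₁ := ε / (4 * H * H) with hε₁
  have hε₁0 : 0 < ε₁ := by positivity
  obtain ⟨n, hnθ, hn⟩ : ∃ n : ℕ, θ ^ n < ε₁ ∧ 0 < n :=
    ((((tendsto_pow_atTop_nhds_zero_of_lt_one h.theta_pos.le h.theta_lt_one).eventually_lt_const
      hε₁0)).and (eventually_gt_atTop 0)).exists
  have hn' : (0 : ℝ) < n := by exact_mod_cast hn
  have hC1 : 0 < C + 1 := by linarith [hg.const_nonneg]
  obtain ⟨J, hJ⟩ := exists_finset_one_sub_lt h (show 0 < ε₁ / n / (C + 1) by positivity)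
  set δ := C * (1 - ∑ j ∈ J, μ.real (P j)) with hδ
  have hsum : 0 ≤ 1 - ∑ j ∈ J, μ.real (P j) := by
    have := sum_le_hasSum J (fun j _ => measureReal_nonneg) (hasSum_measureReal h)
    linarith
  have hδ1 : n * δ ≤ ε₁ := by
    rw [lt_div_iff₀ hC1, lt_div_iff₀ hn'] at hJ
    have : n * δ = (1 - ∑ j ∈ J, μ.real (P j)) * C * n := by rw [hδ]; ring
    rw [this]
    nlinarith [mul_nonneg hsum hn'.le]
  have hδw := one_sub_sum_branchWeight_le h hg J
  -- There are finitely many words, each with a cylinder of positive measure, so a single m works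
  -- for all of them even relative to that measure.
  have hev : ∀ᶠ m : ℕ in atTop, ∀ w ∈ words T P J n, ∀ f : BTheta T P θ, ∫ y, f y ∂μ = 0 →
      ‖∫ y in wordCyl T P w, (h.op hg ^ m) f y ∂μ‖
        ≤ ε₁ * μ.real (wordCyl T P w) * ‖f‖ := by
    rw [Filter.eventually_all_finset]
    intro w hw
    exact eventually_norm_setIntegral_gmOp_pow_le h hmix hg (measurableSet_wordCyl h w)
      (mul_pos hε₁0 (measureReal_wordCyl_pos h hg hw))
  obtain ⟨m, hm⟩ := hev.exists
  refine ⟨n + (n + m), by omega, fun f hf => ?_⟩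
  set u := (h.op hg ^ m) f with hu
  have hu1 : ‖u‖ ≤ H * ‖f‖ := hbd m f
  set x := (h.op hg ^ n) u with hx
  have hxf : x = (h.op hg ^ (n + m)) f := by
    rw [hx, hu, pow_add, mul_apply_eq_comp]
  have hsup : x.sup ≤ 3 * ε₁ * H * ‖f‖ := by
    have hf0 := norm_nonneg f
    refine BTheta.sup_le (by positivity) fun y => ?_
    have h1 := norm_apply_le_of_average_le h hg hn u (η := ε₁ * ‖f‖) (by positivity)
      (fun w hw => (hm w hw f hf).trans_eq (by ring))
    have h2 := norm_gmOp_pow_apply_le_of_le_exitCount h hg hδw n u u.sup_nonneg h1 y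
    refine h2.trans ?_
    have h3 : u.lip * θ ^ n ≤ H * ‖f‖ * ε₁ :=
      mul_le_mul (u.lip_le_norm.trans hu1) hnθ.le (pow_nonneg h.theta_pos.le n)
        (by positivity)
    have h4 : u.sup * (n * δ) ≤ H * ‖f‖ * ε₁ :=
      mul_le_mul (u.sup_le_norm.trans hu1) hδ1 (mul_nonneg hn'.le
        (mul_nonneg hg.const_nonneg hsum)) (by positivity)
    have h5 : ε₁ * ‖f‖ ≤ H * ‖f‖ * ε₁ := by
      nlinarith [mul_nonneg hε₁0.le hf0]
    linarith
  have hlip : x.lip ≤ H * ‖f‖ := by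
    rw [hxf]; exact (BTheta.lip_le_norm _).trans (hbd _ f)
  have e : (h.op hg ^ (n + (n + m))) f = (h.op hg ^ n) x := by
    rw [pow_add, mul_apply_eq_comp, hxf]
  rw [e]
  refine (norm_gmOp_pow_apply_le h hg n x).trans ?_
  have h6 : H * x.sup ≤ H * (3 * ε₁ * H * ‖f‖) := mul_le_mul_of_nonneg_left hsup hH0.le
  have h7 : θ ^ n * x.lip ≤ ε₁ * (H * ‖f‖) :=
    mul_le_mul hnθ.le hlip x.lip_nonneg hε₁0.le
  have h8 : ε₁ * (H * ‖f‖) ≤ H * (ε₁ * H * ‖f‖) := by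
    have : 0 ≤ ε₁ * (H * ‖f‖) := by positivity
    nlinarith
  have h9 : 4 * (H * (ε₁ * H * ‖f‖)) = ε * ‖f‖ := by
    rw [hε₁]; field_simp
  linarith

/-! ### The projection onto constants and (H3). -/

theorem BTheta.norm_integral_le (f : BTheta T P θ) : ‖∫ y, f y ∂μ‖ ≤ f.sup := by
  simpa using norm_integral_le_of_norm_le_const (μ := μ) (ae_of_all _ f.norm_apply_le)

theorem BTheta.norm_const_le (hθ : 0 ≤ θ) (c : ℂ) : ‖(BTheta.const hθ c : BTheta T P θ)‖ ≤ ‖c‖ := by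
  have h1 : (BTheta.const hθ c : BTheta T P θ).sup ≤ ‖c‖ :=
    BTheta.sup_le (norm_nonneg _) fun _ => le_rfl
  have h2 : (BTheta.const hθ c : BTheta T P θ).lip ≤ 0 := BTheta.lip_le hθ le_rfl (by simp)
  rw [BTheta.norm_eq]
  linarith

/-- The projection `f ↦ ∫ f dμ` onto the constants. -/
def IsGibbsMarkov.meanProj (h : IsGibbsMarkov μ T P θ) : BTheta T P θ →L[ℂ] BTheta T P θ :=
  LinearMap.mkContinuous
    { toFun := fun f => BTheta.const h.theta_pos.le (∫ y, f y ∂μ)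
      map_add' := fun f f' => by
        ext x
        exact integral_add (f.integrable μ) (f'.integrable μ)
      map_smul' := fun c f => by
        ext x
        exact integral_const_mul c _ } 1 fun f => by
      rw [one_mul]
      exact (BTheta.norm_const_le h.theta_pos.le _).trans
        (f.norm_integral_le.trans f.sup_le_norm)

theorem meanProj_apply (h : IsGibbsMarkov μ T P θ) (f : BTheta T P θ) :
    h.meanProj f = BTheta.const h.theta_pos.le (∫ y, f y ∂μ) := rfl

theorem hypH3_gmOp (h : IsGibbsMarkov μ T P θ) (hmix : IsMixing μ T)
    (hg : IsWeight μ T P θ g C) : HypH3 (h.op hg) := by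
  have := BTheta.completeSpace h.theta_pos h.separating
  set e : BTheta T P θ := BTheta.const h.theta_pos.le 1 with he
  have hAe : h.op hg e = e := gmOp_const h hg
  have hmean : ∀ c : ℂ, (BTheta.const h.theta_pos.le c : BTheta T P θ) = c • e := fun c => by
    ext x; simp [he]
  -- Removing the mean at most doubles the norm, so 1 / 4 on mean-zero functions gives 1 / 2 for the
  -- difference from the projection.
  obtain ⟨N, hN0, hN⟩ := exists_norm_gmOp_pow_le h hmix hg (ε := 1 / 4) (by norm_num)
  have hpow : ∀ n : ℕ, (h.op hg ^ n) e = e := fun n => by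
    induction n with
    | zero => rfl
    | succ n ih => rw [pow_succ, mul_apply_eq_comp, hAe, ih]
  refine hypH3_of_norm_pow_sub_lt_one (Q₀ := h.meanProj) (e := e) ?_ hAe ?_
    (fun f => ⟨_, hmean _⟩) (fun f => ?_) hN0 ?_
  · intro h0
    have := congrArg (fun f : BTheta T P θ => f (Classical.arbitrary Ω)) h0
    simp [he] at this
  · rw [meanProj_apply]; simp [he]
  · have := integral_gmOp_mul h hg f (φ := fun _ => 1) measurable_const ⟨1, by simp⟩
    simp only [mul_one] at this
    rw [meanProj_apply, meanProj_apply, this]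
  · refine lt_of_le_of_lt (ContinuousLinearMap.opNorm_le_bound _ (by norm_num : (0 : ℝ) ≤ 1 / 2)
      fun f => ?_) (by norm_num : (1 / 2 : ℝ) < 1)
    set c := ∫ y, f y ∂μ with hc
    have e1 : (h.op hg ^ N - h.meanProj) f = (h.op hg ^ N) (f - h.meanProj f) := by
      rw [sub_apply, map_sub, meanProj_apply, hmean, map_smul, hpow]
    have h0 : ∫ y, (f - h.meanProj f) y ∂μ = 0 := by
      simp only [BTheta.sub_apply, meanProj_apply, BTheta.const_apply]
      rw [integral_sub (f.integrable μ) (integrable_const _)]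
      simp
    have h1 : ‖h.meanProj f‖ ≤ ‖f‖ :=
      (BTheta.norm_const_le h.theta_pos.le _).trans (f.norm_integral_le.trans f.sup_le_norm)
    rw [e1]
    refine (hN _ h0).trans ?_
    have := norm_sub_le f (h.meanProj f)
    linarith

end Gap

/-! ### Truncated moments of functions with regularly varying tails -/

/-- The nonnegative function `w` has its tail bounded by `G`, which is nonincreasing and, along
dyadic sequences, regularly varying of index `-α`. -/
structure HasTail {Ω : Type*} [MeasurableSpace Ω] (μ : Measure Ω) (w : Ω → ℝ) (G : ℝ → ℝ)
    (α : ℝ) : Prop where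
  measurable : Measurable w
  nonneg : ∀ y, 0 ≤ w y
  antitone : Antitone G
  tail_le : ∀ x, 0 < x → μ.real {y | x < w y} ≤ G x
  eventually_pos : ∀ᶠ x in atTop, 0 < G x
  tendsto : Tendsto (fun x => G (2 * x) / G x) atTop (𝓝 (2 ^ (-α)))

/-- Every x ≥ x₀ arises by repeated doubling from [x₀, 2x₀]. The moment estimates are run this way,
so only the ratio of the tails at 2x and x enters. -/
theorem dyadic_induction {F : ℝ → Prop} {x₀ : ℝ} (hx₀ : 0 < x₀)
    (base : ∀ x, x₀ ≤ x → x ≤ 2 * x₀ → F x) (step : ∀ x, x₀ ≤ x → F x → F (2 * x)) (x : ℝ)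
    (hx : x₀ ≤ x) : F x := by
  have key : ∀ n : ℕ, ∀ x, x₀ ≤ x → x ≤ 2 ^ (n + 1) * x₀ → F x := by
    intro n
    induction n with
    | zero => intro x h1 h2; exact base x h1 (by simpa using h2)
    | succ n ih =>
      intro x h1 h2
      by_cases h3 : x ≤ 2 * x₀
      · exact base x h1 h3
      · have h4 := step (x / 2) (by linarith) (ih (x / 2) (by linarith) (by
          rw [pow_succ] at h2; linarith))
        rwa [mul_div_cancel₀ _ two_ne_zero] at h4
  obtain ⟨n, hn⟩ := pow_unbounded_of_one_lt (x / x₀) one_lt_two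
  refine key n x hx ?_
  rw [div_lt_iff₀ hx₀] at hn
  rw [pow_succ]
  nlinarith [mul_pos (pow_pos (two_pos : (0 : ℝ) < 2) n) hx₀]

namespace HasTail

variable {Ω : Type*} [MeasurableSpace Ω] {μ : Measure Ω} {w : Ω → ℝ} {G : ℝ → ℝ} {α : ℝ}

theorem G_nonneg (h : HasTail μ w G α) {x : ℝ} (hx : 0 < x) : 0 ≤ G x :=
  measureReal_nonneg.trans (h.tail_le x hx)

theorem eventually_le (h : HasTail μ w G α) {β : ℝ} (hβ : β < α) :
    ∀ᶠ x in atTop, G (2 * x) ≤ 2 ^ (-β) * G x := by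
  have h1 : (2 : ℝ) ^ (-α) < 2 ^ (-β) := Real.rpow_lt_rpow_of_exponent_lt one_lt_two (by linarith)
  filter_upwards [h.tendsto.eventually_lt_const h1, h.eventually_pos] with x hx hpos
  exact ((div_lt_iff₀ hpos).1 hx).le

theorem eventually_ge (h : HasTail μ w G α) {β : ℝ} (hβ : α < β) :
    ∀ᶠ x in atTop, 2 ^ (-β) * G x ≤ G (2 * x) := by
  have h1 : (2 : ℝ) ^ (-β) < 2 ^ (-α) := Real.rpow_lt_rpow_of_exponent_lt one_lt_two (by linarith)
  filter_upwards [h.tendsto.eventually_const_lt h1, h.eventually_pos] with x hx hpos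
  exact ((lt_div_iff₀ hpos).1 hx).le

variable [IsProbabilityMeasure μ]

/-- Split at the levels 2^k x: w^a is at most (2^(k+1) x)^a up to the next level, and the
probability of passing level k decays like 2^(-βk) G x. The sum is geometric with ratio 2^(a-β). -/
theorem exists_lintegral_tail_le (h : HasTail μ w G α) {a : ℝ} (ha : 0 < a) (haα : a < α) :
    ∃ C : ℝ, 0 ≤ C ∧ ∀ᶠ x in atTop,
      ∫⁻ y in {y | x < w y}, ENNReal.ofReal (w y ^ a) ∂μ ≤ ENNReal.ofReal (C * (x ^ a * G x)) := by
  -- Any β strictly between a and α works: β < α allows the decay bound for G, and a < β makes the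
  -- series converge.
  set β := (a + α) / 2 with hβ
  obtain ⟨x₀, hx₀⟩ := eventually_atTop.1 (h.eventually_le (show β < α by rw [hβ]; linarith))
  set ρ : ℝ := 2 ^ (a - β) with hρ
  have hρ0 : 0 < ρ := by positivity
  have hρ1 : ρ < 1 := Real.rpow_lt_one_of_one_lt_of_neg one_lt_two (by rw [hβ]; linarith)
  refine ⟨2 ^ a * (1 - ρ)⁻¹, mul_nonneg (by positivity) (inv_nonneg.2 (by linarith)), ?_⟩
  filter_upwards [eventually_ge_atTop x₀, eventually_gt_atTop 0] with x hx hx0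
  have hG : ∀ k : ℕ, G (2 ^ k * x) ≤ (2 ^ (-β)) ^ k * G x := by
    intro k
    induction k with
    | zero => simp
    | succ k ih =>
      have h1 : x₀ ≤ 2 ^ k * x := hx.trans (le_mul_of_one_le_left hx0.le (one_le_pow₀ one_le_two))
      have h2 := hx₀ _ h1
      rw [← mul_assoc, ← pow_succ'] at h2
      rw [pow_succ' ((2 : ℝ) ^ (-β)), mul_assoc]
      exact h2.trans (mul_le_mul_of_nonneg_left ih (by positivity))
  set c : ℕ → ℝ := fun k => (2 ^ (k + 1) * x) ^ a with hc
  have hpt : ∀ y ∈ {y | x < w y}, ENNReal.ofReal (w y ^ a)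
      ≤ ∑' k, {y | 2 ^ k * x < w y}.indicator (fun _ => ENNReal.ofReal (c k)) y := by
    intro y hy
    have hy' : x < w y := hy
    obtain ⟨k, hk1, hk2⟩ : ∃ k : ℕ, 2 ^ k * x < w y ∧ w y ≤ 2 ^ (k + 1) * x := by
      classical
      have hex : ∃ n : ℕ, w y ≤ 2 ^ n * x := by
        obtain ⟨n, hn⟩ := pow_unbounded_of_one_lt (w y / x) one_lt_two
        exact ⟨n, ((div_lt_iff₀ hx0).1 hn).le⟩
      have h0 : Nat.find hex ≠ 0 := fun h0 => by
        have := Nat.find_spec hex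
        rw [h0, pow_zero, one_mul] at this
        linarith
      obtain ⟨k, hk⟩ := Nat.exists_eq_succ_of_ne_zero h0
      refine ⟨k, not_le.1 (Nat.find_min hex (by omega)), ?_⟩
      have := Nat.find_spec hex
      rwa [hk] at this
    refine le_trans ?_ (ENNReal.le_tsum k)
    rw [indicator_of_mem (by exact hk1)]
    exact ENNReal.ofReal_le_ofReal (Real.rpow_le_rpow (h.nonneg y) hk2 ha.le)
  have hms : ∀ x : ℝ, MeasurableSet {y | x < w y} := fun x =>
    measurableSet_lt measurable_const h.measurable
  calc ∫⁻ y in {y | x < w y}, ENNReal.ofReal (w y ^ a) ∂μ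
      ≤ ∫⁻ y in {y | x < w y},
          ∑' k, {y | 2 ^ k * x < w y}.indicator (fun _ => ENNReal.ofReal (c k)) y ∂μ :=
        setLIntegral_mono' (hms x) hpt
    _ ≤ ∫⁻ y, ∑' k, {y | 2 ^ k * x < w y}.indicator (fun _ => ENNReal.ofReal (c k)) y ∂μ :=
        setLIntegral_le_lintegral _ _
    _ = ∑' k, ENNReal.ofReal (c k) * μ {y | 2 ^ k * x < w y} := by
        rw [lintegral_tsum fun k => (measurable_const.indicator (hms _)).aemeasurable]
        exact tsum_congr fun k => lintegral_indicator_const (hms _) _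
    _ ≤ ∑' k, ENNReal.ofReal (2 ^ a * (x ^ a * G x) * ρ ^ k) := by
        refine ENNReal.tsum_le_tsum fun k => ?_
        rw [← ofReal_measureReal, ← ENNReal.ofReal_mul (by positivity)]
        refine ENNReal.ofReal_le_ofReal ?_
        have h1 := (h.tail_le (2 ^ k * x) (by positivity)).trans (hG k)
        refine (mul_le_mul_of_nonneg_left h1 (by positivity)).trans_eq ?_
        have e1 : c k = 2 ^ a * (2 ^ a) ^ k * x ^ a := by
          rw [hc]
          simp only
          rw [Real.mul_rpow (by positivity) hx0.le, pow_succ',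
            Real.mul_rpow zero_le_two (by positivity), ← Real.rpow_natCast (2 : ℝ) k,
            ← Real.rpow_mul zero_le_two, mul_comm (k : ℝ) a, Real.rpow_mul zero_le_two,
            Real.rpow_natCast]
        have e2 : ρ ^ k = (2 ^ a) ^ k * (2 ^ (-β)) ^ k := by
          rw [← mul_pow, ← Real.rpow_add two_pos, hρ, sub_eq_add_neg]
        rw [e1, e2]
        ring
    _ = ENNReal.ofReal (2 ^ a * (1 - ρ)⁻¹ * (x ^ a * G x)) := by
        rw [← ENNReal.ofReal_tsum_of_nonneg (fun k => by
          have := h.G_nonneg hx0; positivity)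
          ((summable_geometric_of_lt_one hρ0.le hρ1).mul_left _), tsum_mul_left,
          tsum_geometric_of_lt_one hρ0.le hρ1]
        congr 1
        ring

theorem integrable_rpow (h : HasTail μ w G α) {a : ℝ} (ha : 0 < a) (haα : a < α) :
    Integrable (fun y => w y ^ a) μ := by
  obtain ⟨C, _, hC⟩ := h.exists_lintegral_tail_le ha haα
  obtain ⟨x, hx, hx0⟩ := (hC.and (eventually_gt_atTop 0)).exists
  have hms : MeasurableSet {y | x < w y} := measurableSet_lt measurable_const h.measurable
  have hm : Measurable fun y => w y ^ a := h.measurable.pow_const a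
  rw [← integrableOn_univ, ← union_compl_self {y | x < w y}]
  refine IntegrableOn.union ⟨hm.aestronglyMeasurable, ?_⟩ ?_
  · rw [HasFiniteIntegral]
    refine lt_of_le_of_lt (le_of_eq ?_) (hx.trans_lt ENNReal.ofReal_lt_top)
    refine lintegral_congr fun y => ?_
    rw [← ofReal_norm, Real.norm_of_nonneg (Real.rpow_nonneg (h.nonneg y) a)]
  · refine Measure.integrableOn_of_bounded (M := x ^ a) (measure_ne_top _ _)
      hm.aestronglyMeasurable ?_
    refine (ae_restrict_iff' hms.compl).2 (ae_of_all _ fun y hy => ?_)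
    rw [Real.norm_of_nonneg (Real.rpow_nonneg (h.nonneg y) a)]
    exact Real.rpow_le_rpow (h.nonneg y) (not_lt.1 hy) ha.le

theorem integrable (h : HasTail μ w G α) (hα : 1 < α) : Integrable w μ := by
  simpa using h.integrable_rpow one_pos hα

theorem exists_setIntegral_tail_le (h : HasTail μ w G α) (hα : 1 < α) :
    ∃ C : ℝ, 0 ≤ C ∧ ∀ᶠ x in atTop, ∫ y in {y | x < w y}, w y ∂μ ≤ C * (x * G x) := by
  obtain ⟨C, hC0, hC⟩ := h.exists_lintegral_tail_le one_pos hα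
  refine ⟨C, hC0, ?_⟩
  filter_upwards [hC, eventually_gt_atTop 0] with x hx hx0
  rw [integral_eq_lintegral_of_nonneg_ae (ae_of_all _ h.nonneg) h.measurable.aestronglyMeasurable]
  simp only [Real.rpow_one] at hx
  exact ENNReal.toReal_le_of_le_ofReal
    (mul_nonneg hC0 (mul_nonneg hx0.le (h.G_nonneg hx0))) hx

theorem integrable_min (h : HasTail μ w G α) {x : ℝ} (hx : 0 ≤ x) :
    Integrable (fun y => min 1 (x * w y)) μ :=
  Integrable.of_bound (measurable_const.min (h.measurable.const_mul x)).aestronglyMeasurable 1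
    (ae_of_all _ fun y => by
      rw [Real.norm_of_nonneg (le_min zero_le_one (mul_nonneg hx (h.nonneg y)))]
      exact min_le_left _ _)

theorem integrable_mul_min (h : HasTail μ w G α) (hα : 1 < α) {x : ℝ} (hx : 0 ≤ x) :
    Integrable (fun y => w y * min 1 (x * w y)) μ :=
  (h.integrable hα).mono
    (h.measurable.mul (measurable_const.min (h.measurable.const_mul x))).aestronglyMeasurable
    (ae_of_all _ fun y => by
      rw [norm_mul]
      refine mul_le_of_le_one_right (norm_nonneg _) ?_
      rw [Real.norm_of_nonneg (le_min zero_le_one (mul_nonneg hx (h.nonneg y)))]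
      exact min_le_left _ _)

/-- For tail index `α < 1`, `E min(1, w / x) = O(G x)`. -/
theorem exists_integral_min_le (h : HasTail μ w G α) (hα : α < 1) :
    ∃ C : ℝ, 0 ≤ C ∧ ∀ᶠ x in atTop, ∫ y, min 1 (x⁻¹ * w y) ∂μ ≤ C * G x := by
  set β := (α + 1) / 2 with hβ
  obtain ⟨x₀, hx₀⟩ := eventually_atTop.1 (((h.eventually_ge (show α < β by rw [hβ]; linarith)).and
    h.eventually_pos).and (eventually_gt_atTop 0))
  have hx₀0 : 0 < x₀ := (hx₀ x₀ le_rfl).2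
  set ρ : ℝ := 2 ^ (β - 1) with hρ
  have hρ0 : 0 < ρ := by positivity
  have hρ1 : ρ < 1 := Real.rpow_lt_one_of_one_lt_of_neg one_lt_two (by rw [hβ]; linarith)
  have hG2 : 0 < G (2 * x₀) := (hx₀ (2 * x₀) (by linarith)).1.2
  -- The first entry covers the starting interval. The second gives (C + 1) ρ ≤ C, which reproduces
  -- the bound under doubling: the truncated mean at 2x is at most half that at x plus G x / 2, and
  -- G x ≤ 2ρ G (2x).
  set C := max (G (2 * x₀))⁻¹ (ρ / (1 - ρ)) with hC
  have hC0 : 0 ≤ C := le_max_of_le_left (inv_nonneg.2 hG2.le)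
  refine ⟨C, hC0, eventually_atTop.2 ⟨x₀, dyadic_induction hx₀0 (fun x hx hx2 => ?_)
    fun x hx ih => ?_⟩⟩
  · have hx0 : 0 < x := by linarith
    have h1 : ∫ y, min 1 (x⁻¹ * w y) ∂μ ≤ ∫ _, 1 ∂μ :=
      integral_mono (h.integrable_min (inv_nonneg.2 hx0.le)) (integrable_const _)
        fun y => min_le_left _ _
    have h2 : 1 ≤ C * G x := by
      have h3 : (G (2 * x₀))⁻¹ * G (2 * x₀) ≤ C * G x :=
        mul_le_mul (le_max_left _ _) (h.antitone hx2) hG2.le hC0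
      rwa [inv_mul_cancel₀ hG2.ne'] at h3
    exact h1.trans (by simpa using h2)
  · have hx0 : 0 < x := by linarith
    have hms : MeasurableSet {y | x < w y} := measurableSet_lt measurable_const h.measurable
    have hi1 := (h.integrable_min (inv_nonneg.2 hx0.le)).const_mul (1 / 2)
    have hi2 : Integrable ({y | x < w y}.indicator fun _ => (1 / 2 : ℝ)) μ :=
      (integrable_const _).indicator hms
    have h1 : ∫ y, min 1 ((2 * x)⁻¹ * w y) ∂μ
        ≤ ∫ y, (1 / 2 * min 1 (x⁻¹ * w y) + {y | x < w y}.indicator (fun _ => (1 / 2 : ℝ)) y) ∂μ := by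
      refine integral_mono (h.integrable_min (by positivity)) (hi1.add hi2) fun y => ?_
      by_cases hy : y ∈ {y | x < w y}
      · rw [indicator_of_mem hy]
        have : 1 ≤ x⁻¹ * w y := by
          rw [← div_eq_inv_mul, one_le_div hx0]; exact (show x < w y from hy).le
        rw [min_eq_left this]
        exact (min_le_left _ _).trans (by norm_num)
      · rw [indicator_of_notMem hy]
        have : x⁻¹ * w y ≤ 1 := by
          rw [← div_eq_inv_mul, div_le_one hx0]; exact not_lt.1 hy
        rw [min_eq_right this]
        refine (min_le_right _ _).trans (le_of_eq ?_)
        rw [mul_inv]; ring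
    rw [integral_add hi1 hi2, integral_const_mul, integral_indicator_const _ hms, smul_eq_mul] at h1
    have h2 := h.tail_le x hx0
    have h3 := (hx₀ x hx).1.1
    have h4 : G x ≤ 2 ^ β * G (2 * x) := by
      have := mul_le_mul_of_nonneg_left h3 (Real.rpow_nonneg zero_le_two β)
      rwa [← mul_assoc, ← Real.rpow_add two_pos, add_neg_cancel, Real.rpow_zero, one_mul] at this
    have hρβ : (2 : ℝ) ^ β = 2 * ρ := by
      rw [hρ, Real.rpow_sub two_pos, Real.rpow_one]; ring
    have h5 : (C + 1) * ρ ≤ C := by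
      have := le_max_right (G (2 * x₀))⁻¹ (ρ / (1 - ρ))
      rw [← hC, div_le_iff₀ (by linarith)] at this
      linarith
    have hG0 : 0 ≤ G (2 * x) := h.G_nonneg (by linarith)
    calc ∫ y, min 1 ((2 * x)⁻¹ * w y) ∂μ ≤ (C + 1) / 2 * G x := by linarith
      _ ≤ (C + 1) / 2 * (2 * ρ * G (2 * x)) := by
          rw [← hρβ]; exact mul_le_mul_of_nonneg_left h4 (by linarith)
      _ = (C + 1) * ρ * G (2 * x) := by ring
      _ ≤ C * G (2 * x) := mul_le_mul_of_nonneg_right h5 hG0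

/-- For t ≤ x doubling the truncation level exactly halves the expression; above x the left side is
at most t. -/
theorem _root_.mul_min_two_mul_le {x t : ℝ} (hx : 0 < x) (ht : 0 ≤ t) :
    t * min 1 ((2 * x)⁻¹ * t) ≤ 1 / 2 * (t * min 1 (x⁻¹ * t)) + if x < t then 1 / 2 * t else 0 := by
  split_ifs with hy
  · have : 1 ≤ x⁻¹ * t := by rw [← div_eq_inv_mul, one_le_div hx]; exact hy.le
    rw [min_eq_left this]
    have := mul_le_mul_of_nonneg_left (min_le_left 1 ((2 * x)⁻¹ * t)) ht
    linarith
  · have : x⁻¹ * t ≤ 1 := by rw [← div_eq_inv_mul, div_le_one hx]; exact not_lt.1 hy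
    rw [min_eq_right this]
    have := mul_le_mul_of_nonneg_left (min_le_right 1 ((2 * x)⁻¹ * t)) ht
    refine this.trans (le_of_eq ?_)
    rw [mul_inv]; ring

theorem integral_mul_min_two_mul_le (h : HasTail μ w G α) (hα : 1 < α) {x : ℝ} (hx : 0 < x) :
    ∫ y, w y * min 1 ((2 * x)⁻¹ * w y) ∂μ
      ≤ 1 / 2 * ∫ y, w y * min 1 (x⁻¹ * w y) ∂μ + 1 / 2 * ∫ y in {y | x < w y}, w y ∂μ := by
  have hms : MeasurableSet {y | x < w y} := measurableSet_lt measurable_const h.measurable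
  have hi1 := (h.integrable_mul_min hα (inv_nonneg.2 hx.le)).const_mul (1 / 2)
  have hi2 := ((h.integrable hα).const_mul (1 / 2)).indicator hms
  rw [← integral_const_mul, ← integral_const_mul, ← integral_indicator hms, ← integral_add hi1 hi2]
  refine integral_mono (h.integrable_mul_min hα (by positivity)) (hi1.add hi2) fun y => ?_
  refine (mul_min_two_mul_le hx (h.nonneg y)).trans_eq ?_
  simp [indicator_apply]

/-- For tail index `1 < α < 2`, `E w min(1, w / x) = O(x G x)`. -/
theorem exists_integral_mul_min_le (h : HasTail μ w G α) (hα : 1 < α) (hα2 : α < 2) :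
    ∃ C : ℝ, 0 ≤ C ∧ ∀ᶠ x in atTop, ∫ y, w y * min 1 (x⁻¹ * w y) ∂μ ≤ C * (x * G x) := by
  obtain ⟨C₁, hC₁0, hC₁⟩ := h.exists_setIntegral_tail_le hα
  set β := (α + 2) / 2 with hβ
  obtain ⟨x₀, hx₀⟩ := eventually_atTop.1 ((((h.eventually_ge
    (show α < β by rw [hβ]; linarith)).and h.eventually_pos).and (eventually_gt_atTop 0)).and hC₁)
  have hx₀0 : 0 < x₀ := (hx₀ x₀ le_rfl).1.2
  set ρ : ℝ := 2 ^ (β - 2) with hρ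
  have hρ0 : 0 < ρ := by positivity
  have hρ1 : ρ < 1 := Real.rpow_lt_one_of_one_lt_of_neg one_lt_two (by rw [hβ]; linarith)
  have hG2 : 0 < G (2 * x₀) := (hx₀ (2 * x₀) (by linarith)).1.1.2
  set m := ∫ y, w y ∂μ with hm
  have hm0 : 0 ≤ m := integral_nonneg h.nonneg
  -- The first entry covers the starting interval; the second gives (C + C₁) ρ ≤ C, where C₁ comes
  -- from the tail integral of w and G x ≤ 4ρ G (2x).
  set C := max (m * (x₀ * G (2 * x₀))⁻¹) (C₁ * ρ / (1 - ρ)) with hC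
  have hC0 : 0 ≤ C := le_max_of_le_left (by positivity)
  refine ⟨C, hC0, eventually_atTop.2 ⟨x₀, dyadic_induction hx₀0 (fun x hx hx2 => ?_)
    fun x hx ih => ?_⟩⟩
  · have hx0 : 0 < x := by linarith
    have h1 : ∫ y, w y * min 1 (x⁻¹ * w y) ∂μ ≤ m :=
      integral_mono (h.integrable_mul_min hα (inv_nonneg.2 hx0.le)) (h.integrable hα)
        fun y => mul_le_of_le_one_right (h.nonneg y) (min_le_left _ _)
    refine h1.trans ?_
    have h3 : m * (x₀ * G (2 * x₀))⁻¹ * (x₀ * G (2 * x₀)) ≤ C * (x * G x) :=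
      mul_le_mul (le_max_left _ _) (mul_le_mul hx (h.antitone hx2) hG2.le hx0.le)
        (by positivity) hC0
    rwa [inv_mul_cancel_right₀ (by positivity)] at h3
  · have hx0 : 0 < x := by linarith
    have h1 := h.integral_mul_min_two_mul_le hα hx0
    have h2 := (hx₀ x hx).2
    have h3 := (hx₀ x hx).1.1.1
    have h4 : G x ≤ 2 ^ β * G (2 * x) := by
      have := mul_le_mul_of_nonneg_left h3 (Real.rpow_nonneg zero_le_two β)
      rwa [← mul_assoc, ← Real.rpow_add two_pos, add_neg_cancel, Real.rpow_zero, one_mul] at this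
    have hρβ : (2 : ℝ) ^ β = 4 * ρ := by
      rw [hρ, Real.rpow_sub two_pos]; norm_num; ring
    have h5 : (C + C₁) * ρ ≤ C := by
      have := le_max_right (m * (x₀ * G (2 * x₀))⁻¹) (C₁ * ρ / (1 - ρ))
      rw [← hC, div_le_iff₀ (by linarith)] at this
      linarith
    have hG0 : 0 ≤ 2 * x * G (2 * x) := mul_nonneg (by linarith) (h.G_nonneg (by linarith))
    calc ∫ y, w y * min 1 ((2 * x)⁻¹ * w y) ∂μ ≤ (C + C₁) / 2 * x * G x := by linarith
      _ ≤ (C + C₁) / 2 * x * (4 * ρ * G (2 * x)) := by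
          rw [← hρβ]; exact mul_le_mul_of_nonneg_left h4 (by positivity)
      _ = (C + C₁) * ρ * (2 * x * G (2 * x)) := by ring
      _ ≤ C * (2 * x * G (2 * x)) := mul_le_mul_of_nonneg_right h5 hG0

end HasTail

section Karamata

variable {Ω : Type*} [MeasurableSpace Ω] {μ : Measure Ω} [IsProbabilityMeasure μ] {w : Ω → ℝ}
  {G : ℝ → ℝ} {α : ℝ}

/-- The right side is E w min(x, w), which increases with x to E w² = ∞ by monotone convergence. -/
theorem HasTail.eventually_le_mul_integral (h : HasTail μ w G α) (hα : 1 < α)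
    (hinf : ∫⁻ y, ENNReal.ofReal (w y ^ 2) ∂μ = ⊤) (K : ℝ) :
    ∀ᶠ x in atTop, K ≤ x * ∫ y, w y * min 1 (x⁻¹ * w y) ∂μ := by
  have hmul : ∀ x : ℝ, 0 < x → ∀ t : ℝ, x * (t * min 1 (x⁻¹ * t)) = t * min x t := by
    intro x hx t
    rw [mul_left_comm, mul_min_of_nonneg _ _ hx.le, mul_one, mul_inv_cancel_left₀ hx.ne']
  have hmono : ∀ x x' : ℝ, 0 < x → x ≤ x' →
      x * ∫ y, w y * min 1 (x⁻¹ * w y) ∂μ ≤ x' * ∫ y, w y * min 1 (x'⁻¹ * w y) ∂μ := by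
    intro x x' hx hxx'
    rw [← integral_const_mul, ← integral_const_mul]
    refine integral_mono ((h.integrable_mul_min hα (inv_nonneg.2 hx.le)).const_mul _)
      ((h.integrable_mul_min hα (inv_nonneg.2 (hx.le.trans hxx'))).const_mul _) fun y => ?_
    simp only
    rw [hmul x hx, hmul x' (hx.trans_le hxx')]
    exact mul_le_mul_of_nonneg_left (min_le_min_right _ hxx') (h.nonneg y)
  suffices hex : ∃ x > 0, K ≤ x * ∫ y, w y * min 1 (x⁻¹ * w y) ∂μ by
    obtain ⟨x, hx0, hx⟩ := hex
    filter_upwards [eventually_ge_atTop x] with x' hx'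
    exact hx.trans (hmono x x' hx0 hx')
  by_contra! hcon
  have hlim := lintegral_tendsto_of_tendsto_of_monotone (μ := μ)
    (f := fun n : ℕ => fun y => ENNReal.ofReal (w y * min (n + 1 : ℝ) (w y)))
    (F := fun y => ENNReal.ofReal (w y ^ 2))
    (fun n => (h.measurable.mul (measurable_const.min h.measurable)).ennreal_ofReal.aemeasurable)
    (ae_of_all _ fun y n m hnm => ENNReal.ofReal_le_ofReal (mul_le_mul_of_nonneg_left
      (min_le_min_right _ (by simpa using hnm)) (h.nonneg y)))
    (ae_of_all _ fun y => by
      refine tendsto_const_nhds.congr' ?_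
      obtain ⟨N, hN⟩ := exists_nat_ge (w y)
      filter_upwards [eventually_ge_atTop N] with n hn
      have : w y ≤ (n : ℝ) + 1 := hN.trans ((Nat.cast_le.2 hn).trans (by linarith))
      rw [min_eq_right this, sq])
  rw [hinf] at hlim
  have hbd : ∀ n : ℕ, ∫⁻ y, ENNReal.ofReal (w y * min (n + 1 : ℝ) (w y)) ∂μ
      ≤ ENNReal.ofReal K := by
    intro n
    have hn : (0 : ℝ) < n + 1 := by positivity
    have hi := (h.integrable_mul_min hα (inv_nonneg.2 hn.le)).const_mul (n + 1 : ℝ)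
    simp_rw [hmul _ hn] at hi
    rw [← ofReal_integral_eq_lintegral_ofReal hi (ae_of_all _ fun y =>
      mul_nonneg (h.nonneg y) (le_min hn.le (h.nonneg y)))]
    refine ENNReal.ofReal_le_ofReal ?_
    have := (hcon _ hn).le
    rw [← integral_const_mul] at this
    simp_rw [hmul _ hn] at this
    exact this
  exact absurd (le_of_tendsto' hlim hbd) (by simp)

/-- For tail index `α = 2`, `E w min(1, w / x) = O(ℓ̂(x) / x)`. -/
theorem HasTail.exists_integral_mul_min_le_ellHat (h : HasTail μ w G 2) {ℓ : ℝ → ℝ}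
    (hint : ∀ x : ℝ, 1 ≤ x → IntervalIntegrable (fun u => ℓ u / u) volume 1 x)
    (hℓ : ∀ᶠ x in atTop, x ^ 2 * G x ≤ 2 * ℓ x) (hpos : ∀ᶠ x in atTop, 0 < ℓ x)
    (hinf : ∫⁻ y, ENNReal.ofReal (w y ^ 2) ∂μ = ⊤) :
    ∃ C : ℝ, 0 ≤ C ∧ ∀ᶠ x in atTop,
      ∫ y, w y * min 1 (x⁻¹ * w y) ∂μ ≤ C * (x⁻¹ * ellHat ℓ x) := by
  have hα : (1 : ℝ) < 2 := one_lt_two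
  obtain ⟨C₁, hC₁0, hC₁⟩ := h.exists_setIntegral_tail_le hα
  obtain ⟨x₀, hx₀⟩ := eventually_atTop.1 (((((h.eventually_ge (show (2 : ℝ) < 3 by norm_num)).and
    hℓ).and (eventually_ge_atTop 1)).and hC₁).and hpos)
  have hx₀1 : 1 ≤ x₀ := (hx₀ x₀ le_rfl).1.1.2
  have hx₀0 : 0 < x₀ := by linarith
  -- H x = E w min(x, w) satisfies H (2x) ≤ H x + C₁ x² G x, and this increment is compared with
  -- that of `ellHat` from x to 2x.
  set H : ℝ → ℝ := fun x => x * ∫ y, w y * min 1 (x⁻¹ * w y) ∂μ with hH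
  have hsplit : ∀ x x', 0 ≤ x → x ≤ x' →
      ellHat ℓ x' - ellHat ℓ x = ∫ u in (1 + x)..(1 + x'), ℓ u / u := by
    intro x x' hx hxx'
    rw [ellHat, ellHat, ← intervalIntegral.integral_interval_sub_left
      (hint (1 + x') (by linarith)) (hint (1 + x) (by linarith))]
    ring
  have hii : ∀ x x', 0 ≤ x → x ≤ x' →
      IntervalIntegrable (fun u => ℓ u / u) volume (1 + x) (1 + x') := fun x x' hx hxx' =>
    (hint (1 + x) (by linarith)).symm.trans (hint (1 + x') (by linarith))
  set m := ∫ y, w y ∂μ with hm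
  have hm0 : 0 ≤ m := integral_nonneg h.nonneg
  -- Here 128 = 2 · 64: two doublings with exponent 3 give G x ≤ 64 G (4x), and u² G u ≤ 2 ℓ u. On
  -- the integration interval, of length x and inside [x, 4x], ℓ u / u is thus at least x G x / 128.
  set C := 128 * C₁ with hC
  have hC0 : 0 ≤ C := by positivity
  -- M only pays for the starting interval [x₀, 2x₀].
  set M := max (2 * x₀ * m - C * ellHat ℓ x₀) 0 with hM
  have key : ∀ x, x₀ ≤ x → H x ≤ C * ellHat ℓ x + M := by
    refine dyadic_induction hx₀0 (fun x hx hx2 => ?_) fun x hx ih => ?_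
    · have hx0 : 0 < x := by linarith
      have h1 : ∫ y, w y * min 1 (x⁻¹ * w y) ∂μ ≤ m :=
        integral_mono (h.integrable_mul_min hα (inv_nonneg.2 hx0.le)) (h.integrable hα)
          fun y => mul_le_of_le_one_right (h.nonneg y) (min_le_left _ _)
      have h2 : H x ≤ 2 * x₀ * m := mul_le_mul hx2 h1
        (integral_nonneg fun y => mul_nonneg (h.nonneg y) (le_min zero_le_one
          (mul_nonneg (inv_nonneg.2 hx0.le) (h.nonneg y)))) (by linarith)
      have h3 : ellHat ℓ x₀ ≤ ellHat ℓ x := by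
        rw [← sub_nonneg, hsplit x₀ x hx₀0.le hx]
        refine intervalIntegral.integral_nonneg (by linarith) fun u hu => ?_
        exact div_nonneg (hx₀ u (by linarith [hu.1])).2.le (by linarith [hu.1])
      have h4 := le_max_left (2 * x₀ * m - C * ellHat ℓ x₀) 0
      have h5 := mul_le_mul_of_nonneg_left h3 hC0
      linarith
    · have hx0 : 0 < x := by linarith
      have h1 := mul_le_mul_of_nonneg_left (h.integral_mul_min_two_mul_le hα hx0)
        (by linarith : 0 ≤ 2 * x)
      have h2 := mul_le_mul_of_nonneg_left (hx₀ x hx).1.2 hx0.le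
      have hdouble : ∀ x, x₀ ≤ x → G x ≤ 8 * G (2 * x) := fun x hx => by
        have := (hx₀ x hx).1.1.1.1
        rw [Real.rpow_neg zero_le_two] at this
        norm_num at this
        linarith
      have hG4 : G x ≤ 64 * G (4 * x) := by
        have e1 := hdouble x hx
        have e2 := hdouble (2 * x) (by linarith)
        rw [show 2 * (2 * x) = 4 * x by ring] at e2
        linarith
      have h3 : x ^ 2 * G x / 128 ≤ ellHat ℓ (2 * x) - ellHat ℓ x := by
        rw [hsplit x (2 * x) hx0.le (by linarith)]
        have h4 : ∫ u in (1 + x)..(1 + 2 * x), x * G x / 128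
            ≤ ∫ u in (1 + x)..(1 + 2 * x), ℓ u / u := by
          refine intervalIntegral.integral_mono_on (by linarith) (by simp)
            (hii x (2 * x) hx0.le (by linarith)) fun u hu => ?_
          have hu1 : x ≤ u := by linarith [hu.1]
          have hu2 : u ≤ 4 * x := by linarith [hu.2]
          have hu0 : 0 < u := by linarith
          have h5 := (hx₀ u (by linarith)).1.1.1.2
          have h6 := h.antitone hu2
          have h7 : 0 ≤ G (4 * x) := h.G_nonneg (by linarith)
          rw [le_div_iff₀ hu0]
          have h8 : x * G x ≤ 64 * (u * G u) := by
            have : x * G x ≤ x * (64 * G (4 * x)) := mul_le_mul_of_nonneg_left hG4 hx0.le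
            have h9 : x * G (4 * x) ≤ u * G u := mul_le_mul hu1 h6 h7 hu0.le
            linarith
          have h10 := mul_le_mul_of_nonneg_right h8 hu0.le
          nlinarith
        rw [intervalIntegral.integral_const, smul_eq_mul] at h4
        refine le_trans (le_of_eq ?_) h4
        ring
      have h4 := mul_le_mul_of_nonneg_left h3 hC0
      have e : C * (x ^ 2 * G x / 128) = x * (C₁ * (x * G x)) := by rw [hC]; ring
      simp only [hH] at ih ⊢
      rw [e] at h4
      linarith
  -- Since H tends to infinity, eventually M ≤ H / 2, and M is absorbed at the price of doubling C.
  refine ⟨2 * C, by positivity, ?_⟩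
  filter_upwards [h.eventually_le_mul_integral hα hinf (2 * M), eventually_ge_atTop x₀]
    with x hx hxx
  have hx0 : 0 < x := by linarith
  have h1 := key x hxx
  have h2 : x * ∫ y, w y * min 1 (x⁻¹ * w y) ∂μ ≤ 2 * C * ellHat ℓ x := by
    simp only [hH] at h1
    linarith
  calc ∫ y, w y * min 1 (x⁻¹ * w y) ∂μ
      = x⁻¹ * (x * ∫ y, w y * min 1 (x⁻¹ * w y) ∂μ) := by rw [inv_mul_cancel_left₀ hx0.ne']
    _ ≤ x⁻¹ * (2 * C * ellHat ℓ x) := mul_le_mul_of_nonneg_left h2 (inv_nonneg.2 hx0.le)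
    _ = _ := by ring

/-! ### Tails under (H1) -/

/-- `μ(v > x) + μ(v ≤ -x)`. -/
def twoSidedTail (μ : Measure Ω) (v : Ω → ℝ) (x : ℝ) : ℝ :=
  μ.real {y | x < v y} + μ.real {y | v y ≤ -x}

variable {v : Ω → ℝ} {p q : ℝ} {ℓ : ℝ → ℝ}

theorem HypH1.tendsto_twoSidedTail (h : HypH1 μ v α p q ℓ) :
    Tendsto (fun x => twoSidedTail μ v x / (ℓ x * x ^ (-α))) atTop (𝓝 1) := by
  rw [← h.add_eq_one]
  refine (h.right_tail.add h.left_tail).congr fun x => ?_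
  rw [twoSidedTail, add_div]

theorem HypH1.eventually_mul_rpow_pos (h : HypH1 μ v α p q ℓ) :
    ∀ᶠ x in atTop, 0 < ℓ x * x ^ (-α) := by
  filter_upwards [h.slowlyVarying.eventually_pos, eventually_gt_atTop 0] with x hx hx0
  positivity

theorem HypH1.eventually_twoSidedTail_le (h : HypH1 μ v α p q ℓ) :
    ∀ᶠ x in atTop, twoSidedTail μ v x ≤ 2 * (ℓ x * x ^ (-α)) := by
  filter_upwards [h.tendsto_twoSidedTail.eventually_lt_const one_lt_two,
    h.eventually_mul_rpow_pos] with x hx hpos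
  exact ((div_lt_iff₀ hpos).1 hx).le

/-- The tail of v itself is taken for G: it is monotone, which ℓ(x) x^(-α) need not be. Being
asymptotic to ℓ(x) x^(-α), it inherits the limit of the doubling ratio. -/
theorem HypH1.hasTail (h : HypH1 μ v α p q ℓ) (hv : Measurable v) :
    HasTail μ (fun y => |v y|) (twoSidedTail μ v) α where
  measurable := hv.norm
  nonneg y := abs_nonneg _
  antitone x x' hxx' := by
    refine add_le_add (measureReal_mono fun y hy => hxx'.trans_lt hy)
      (measureReal_mono fun y hy => ?_)
    have : v y ≤ -x' := hy
    exact this.trans (neg_le_neg hxx')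
  tail_le x _ := by
    refine (measureReal_mono fun y hy => ?_).trans (measureReal_union_le _ _)
    rcases lt_abs.1 (show x < |v y| from hy) with h1 | h1
    · exact Or.inl h1
    · exact Or.inr (show v y ≤ -x by linarith)
  eventually_pos := by
    filter_upwards [h.tendsto_twoSidedTail.eventually_const_lt zero_lt_one,
      h.eventually_mul_rpow_pos] with x hx hpos
    have := mul_pos hx hpos
    rwa [div_mul_cancel₀ _ hpos.ne'] at this
  tendsto := by
    have hR := h.tendsto_twoSidedTail
    have h2 : Tendsto (fun x : ℝ => 2 * x) atTop atTop :=
      tendsto_id.const_mul_atTop two_pos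
    have hlim := ((hR.comp h2).mul (h.slowlyVarying.tendsto 2 two_pos)).mul
      (hR.inv₀ one_ne_zero) |>.mul_const ((2 : ℝ) ^ (-α))
    rw [inv_one, mul_one, mul_one, one_mul] at hlim
    refine hlim.congr' ?_
    filter_upwards [h.slowlyVarying.eventually_pos, h2.eventually h.slowlyVarying.eventually_pos,
      eventually_gt_atTop 0] with x hx hx2 hx0
    have e : (2 * x) ^ (-α) = 2 ^ (-α) * x ^ (-α) := Real.mul_rpow zero_le_two hx0.le
    have h3 : (0 : ℝ) < x ^ (-α) := by positivity
    have h4 : (0 : ℝ) < 2 ^ (-α) := by positivity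
    simp only [Function.comp_apply]
    rw [e, inv_div]
    by_cases hG : twoSidedTail μ v x = 0
    · simp [hG]
    · field_simp

theorem exists_forall_one_div_abs_le {F Φ : ℝ → ℝ} {C : ℝ}
    (hF : ∀ᶠ x in atTop, F x ≤ C * Φ x) :
    ∃ ε > 0, ∀ t : ℝ, 0 < |t| → |t| < ε → F (1 / |t|) ≤ C * Φ (1 / |t|) := by
  obtain ⟨x₀, hx₀⟩ := eventually_atTop.1 hF
  refine ⟨(max x₀ 1)⁻¹, by positivity, fun t ht ht' => hx₀ _ ?_⟩
  rw [one_div]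
  refine (le_max_left x₀ 1).trans ?_
  rw [le_inv_comm₀ (by positivity) ht]
  exact ht'.le

theorem integral_min_one_pos (hv : Measurable v) (hv2 : ∫⁻ y, ‖v y‖ₑ ^ 2 ∂μ = ⊤) :
    0 < ∫ y, min 1 |v y| ∂μ := by
  have hi : Integrable (fun y => min 1 |v y|) μ :=
    Integrable.of_bound (measurable_const.min hv.norm).aestronglyMeasurable 1
      (ae_of_all _ fun y => by
        rw [Real.norm_of_nonneg (le_min zero_le_one (abs_nonneg _))]; exact min_le_left _ _)
  rw [integral_pos_iff_support_of_nonneg (fun y => le_min zero_le_one (abs_nonneg _)) hi,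
    pos_iff_ne_zero]
  intro h0
  have : ∫⁻ y, ‖v y‖ₑ ^ 2 ∂μ = 0 := by
    rw [lintegral_eq_zero_iff (by fun_prop)]
    refine measure_mono_null (fun y hy => ?_) h0
    rw [Function.mem_support]
    intro h1
    have h2 : v y = 0 := by
      rcases min_choice 1 |v y| with h3 | h3 <;> rw [h3] at h1
      · exact absurd h1 one_ne_zero
      · exact abs_eq_zero.1 h1
    exact hy (by simp [h2])
  rw [this] at hv2
  exact ENNReal.zero_ne_top hv2

/-- The bound for truncated first moments that gives (H2)(ii). -/
theorem HypH1.exists_integral_min_le (h : HypH1 μ v α p q ℓ) (hv : Measurable v)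
    (hv2 : ∫⁻ y, ‖v y‖ₑ ^ 2 ∂μ = ⊤) (hα : α < 1) :
    ∃ C ε : ℝ, 0 ≤ C ∧ 0 < ε ∧ ∀ t : ℝ, 0 < |t| → |t| < ε →
      ∫ y, min 1 (|t| * |v y|) ∂μ ≤ C * (|t| ^ α * ℓ (1 / |t|)) ∧
        |t| ≤ C * (|t| ^ α * ℓ (1 / |t|)) := by
  have hT := h.hasTail hv
  obtain ⟨C, hC0, hC⟩ := hT.exists_integral_min_le hα
  have h1 : ∀ᶠ x in atTop, ∫ y, min 1 (x⁻¹ * |v y|) ∂μ ≤ 2 * C * (ℓ x * x ^ (-α)) := by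
    filter_upwards [hC, h.eventually_twoSidedTail_le] with x hx hx'
    have := mul_le_mul_of_nonneg_left hx' hC0
    linarith
  obtain ⟨ε, hε0, hε⟩ := exists_forall_one_div_abs_le h1
  -- For |t| < 1 the truncated mean is at least |t| κ with κ > 0. This gives the bound for |t|
  -- itself, and with it the sign of the majorant.
  set κ := ∫ y, min 1 |v y| ∂μ with hκ
  have hκ0 : 0 < κ := integral_min_one_pos hv hv2
  have main : ∀ t : ℝ, 0 < |t| → |t| < ε →
      ∫ y, min 1 (|t| * |v y|) ∂μ ≤ 2 * C * (|t| ^ α * ℓ (1 / |t|)) := by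
    intro t ht ht'
    have h2 := hε t ht ht'
    simp only [one_div, inv_inv] at h2 ⊢
    rw [Real.inv_rpow ht.le, Real.rpow_neg ht.le, inv_inv, mul_comm (ℓ _)] at h2
    exact h2
  refine ⟨max (2 * C) (κ⁻¹ * (2 * C)), min ε 1, le_max_of_le_left (by positivity),
    by positivity, fun t ht ht' => ?_⟩
  have hmain := main t ht (ht'.trans_le (min_le_left _ _))
  have h3 : |t| * κ ≤ ∫ y, min 1 (|t| * |v y|) ∂μ := by
    rw [hκ, ← integral_const_mul]
    have h1' := hT.integrable_min zero_le_one
    simp only [one_mul] at h1'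
    refine integral_mono (h1'.const_mul _) (hT.integrable_min ht.le) fun y => ?_
    simp only
    rw [mul_min_of_nonneg _ _ ht.le, mul_one]
    exact min_le_min_right _ (ht'.le.trans (min_le_right _ _))
  set X := |t| ^ α * ℓ (1 / |t|)
  have hX : 0 ≤ 2 * C * X := (mul_nonneg ht.le hκ0.le).trans (h3.trans hmain)
  by_cases hCz : C = 0
  · exfalso
    rw [hCz] at hmain
    nlinarith [mul_pos ht hκ0]
  · have hX0 : 0 ≤ X := by
      have : 0 < 2 * C := by positivity
      exact nonneg_of_mul_nonneg_right hX this
    refine ⟨hmain.trans (mul_le_mul_of_nonneg_right (le_max_left _ _) hX0), ?_⟩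
    refine le_trans ?_ (mul_le_mul_of_nonneg_right (le_max_right _ _) hX0)
    rw [mul_assoc, ← div_eq_inv_mul, le_div_iff₀ hκ0]
    exact h3.trans hmain

/-- The bound for truncated second moments that gives (H2)(iv). -/
theorem HypH1.exists_integral_mul_min_le (h : HypH1 μ v α p q ℓ) (hv : Measurable v)
    (hv2 : ∫⁻ y, ‖v y‖ₑ ^ 2 ∂μ = ⊤) (hα : 1 < α) (hα2 : α ≤ 2)
    (hℓ : α = 2 → ∀ x : ℝ, 1 ≤ x → IntervalIntegrable (fun u => ℓ u / u) volume 1 x) :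
    ∃ C ε : ℝ, 0 ≤ C ∧ 0 < ε ∧ ∀ t : ℝ, 0 < |t| → |t| < ε →
      ∫ y, |v y| * min 1 (|t| * |v y|) ∂μ ≤ C * (|t| ^ (α - 1) * ellZero α ℓ (1 / |t|)) ∧
        |t| ≤ C * (|t| ^ (α - 1) * ellZero α ℓ (1 / |t|)) := by
  have hT := h.hasTail hv
  obtain ⟨C, hC0, hC⟩ : ∃ C : ℝ, 0 ≤ C ∧ ∀ᶠ x in atTop,
      ∫ y, |v y| * min 1 (x⁻¹ * |v y|) ∂μ ≤ C * (x ^ (1 - α) * ellZero α ℓ x) := by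
    rcases hα2.lt_or_eq with hlt | rfl
    · obtain ⟨C, hC0, hC⟩ := hT.exists_integral_mul_min_le hα hlt
      refine ⟨2 * C, by positivity, ?_⟩
      filter_upwards [hC, h.eventually_twoSidedTail_le, eventually_gt_atTop 0] with x hx hx' hx0
      refine hx.trans ?_
      have h1 := mul_le_mul_of_nonneg_left (mul_le_mul_of_nonneg_left hx' hx0.le) hC0
      refine h1.trans_eq ?_
      rw [ellZero, if_neg hlt.ne, sub_eq_add_neg, Real.rpow_add hx0, Real.rpow_one]
      ring
    · have hinf : ∫⁻ y, ENNReal.ofReal (|v y| ^ 2) ∂μ = ⊤ := by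
        rw [← hv2]
        refine lintegral_congr fun y => ?_
        rw [ENNReal.ofReal_pow (abs_nonneg _), ← Real.norm_eq_abs, ofReal_norm]
      have hℓ' : ∀ᶠ x in atTop, x ^ 2 * twoSidedTail μ v x ≤ 2 * ℓ x := by
        filter_upwards [h.eventually_twoSidedTail_le, eventually_gt_atTop 0] with x hx hx0
        have := mul_le_mul_of_nonneg_left hx (sq_nonneg x)
        refine this.trans_eq ?_
        rw [Real.rpow_neg hx0.le, Real.rpow_two]
        field_simp
      obtain ⟨C, hC0, hC⟩ := hT.exists_integral_mul_min_le_ellHat (hℓ rfl) hℓ'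
        h.slowlyVarying.eventually_pos hinf
      refine ⟨C, hC0, ?_⟩
      filter_upwards [hC, eventually_gt_atTop 0] with x hx hx0
      rw [ellZero, if_pos rfl, show (1 : ℝ) - 2 = -1 by norm_num, Real.rpow_neg_one]
      exact hx
  obtain ⟨ε, hε0, hε⟩ := exists_forall_one_div_abs_le hC
  -- Again a positive constant with |t| κ below the truncated moment when |t| < 1, so that linear
  -- errors can be absorbed.
  set κ := ∫ y, |v y| * min 1 |v y| ∂μ with hκ
  have hi1 := hT.integrable_mul_min hα zero_le_one
  simp only [one_mul] at hi1
  have hκ0 : 0 < κ := by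
    have h1 := integral_min_one_pos hv hv2
    by_contra hle
    have hz : κ = 0 := le_antisymm (not_lt.1 hle) (integral_nonneg fun y =>
      mul_nonneg (abs_nonneg _) (le_min zero_le_one (abs_nonneg _)))
    rw [hκ, integral_eq_zero_iff_of_nonneg (fun y =>
      mul_nonneg (abs_nonneg _) (le_min zero_le_one (abs_nonneg _))) hi1] at hz
    refine h1.ne' (integral_eq_zero_of_ae ?_)
    filter_upwards [hz] with y hy
    rcases mul_eq_zero.1 hy with h2 | h2
    · simp [h2]
    · exact h2
  have main : ∀ t : ℝ, 0 < |t| → |t| < ε →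
      ∫ y, |v y| * min 1 (|t| * |v y|) ∂μ ≤ C * (|t| ^ (α - 1) * ellZero α ℓ (1 / |t|)) := by
    intro t ht ht'
    have h2 := hε t ht ht'
    simp only [one_div, inv_inv] at h2 ⊢
    rw [Real.inv_rpow ht.le, ← Real.rpow_neg ht.le, neg_sub] at h2
    exact h2
  refine ⟨max C (κ⁻¹ * C), min ε 1, le_max_of_le_left hC0, by positivity, fun t ht ht' => ?_⟩
  have hmain := main t ht (ht'.trans_le (min_le_left _ _))
  have h3 : |t| * κ ≤ ∫ y, |v y| * min 1 (|t| * |v y|) ∂μ := by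
    rw [hκ, ← integral_const_mul]
    refine integral_mono (hi1.const_mul _) (hT.integrable_mul_min hα ht.le) fun y => ?_
    simp only
    rw [mul_left_comm, mul_min_of_nonneg _ _ ht.le, mul_one]
    exact mul_le_mul_of_nonneg_left (min_le_min_right _ (ht'.le.trans (min_le_right _ _)))
      (abs_nonneg _)
  set X := |t| ^ (α - 1) * ellZero α ℓ (1 / |t|)
  have hX : 0 < C * X := (mul_pos ht hκ0).trans_le (h3.trans hmain)
  have hX0 : 0 ≤ X := (pos_of_mul_pos_right hX hC0).le
  refine ⟨hmain.trans (mul_le_mul_of_nonneg_right (le_max_left _ _) hX0), ?_⟩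
  refine le_trans ?_ (mul_le_mul_of_nonneg_right (le_max_right _ _) hX0)
  rw [mul_assoc, ← div_eq_inv_mul, le_div_iff₀ hκ0]
  exact h3.trans hmain

end Karamata

/-! ### The perturbed operators -/

/-- `e^{itv}`. -/
def twist {Ω : Type*} (v : Ω → ℝ) (t : ℝ) (y : Ω) : ℂ :=
  Complex.exp (Complex.I * (t * v y : ℝ))

section Twist

variable {Ω : Type*} {v : Ω → ℝ}

theorem norm_twist (t : ℝ) (y : Ω) : ‖twist v t y‖ = 1 := by
  rw [twist, mul_comm, Complex.norm_exp_ofReal_mul_I]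

theorem twist_add (t s : ℝ) (y : Ω) : twist v (t + s) y = twist v t y * twist v s y := by
  rw [twist, twist, twist, ← Complex.exp_add]
  push_cast
  ring_nf

theorem twist_zero (y : Ω) : twist v 0 y = 1 := by simp [twist]

/-- Quadratic Taylor bound for |x| ≤ 1; for |x| ≥ 1 the three terms give 2 + |x| ≤ 3 |x|. -/
theorem norm_exp_sub_one_sub_le (x : ℝ) :
    ‖Complex.exp (Complex.I * x) - 1 - Complex.I * x‖ ≤ 3 * (|x| * min 1 |x|) := by
  have hx : ‖Complex.I * (x : ℂ)‖ = |x| := by simp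
  rcases le_total |x| 1 with h1 | h1
  · rw [min_eq_right h1]
    have := Complex.norm_exp_sub_one_sub_id_le (x := Complex.I * x) (by rwa [hx])
    rw [hx] at this
    nlinarith [abs_nonneg x]
  · rw [min_eq_left h1]
    have h2 : ‖Complex.exp (Complex.I * x)‖ = 1 := by
      rw [mul_comm, Complex.norm_exp_ofReal_mul_I]
    have h3 := norm_sub_le (Complex.exp (Complex.I * x) - 1) (Complex.I * x)
    have h4 := norm_sub_le (Complex.exp (Complex.I * x)) 1
    rw [h2, norm_one] at h4
    rw [hx] at h3
    linarith

theorem norm_twist_sub_one_le (s : ℝ) (y : Ω) : ‖twist v s y - 1‖ ≤ 2 * min 1 (|s| * |v y|) := by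
  rw [mul_min_of_nonneg _ _ zero_le_two, mul_one]
  refine le_min ?_ ?_
  · have := norm_sub_le (twist v s y) 1
    rw [norm_twist, norm_one] at this
    linarith
  · have := Real.norm_exp_I_mul_ofReal_sub_one_le (x := s * v y)
    rw [Real.norm_eq_abs, abs_mul] at this
    have h0 : 0 ≤ |s| * |v y| := by positivity
    rw [twist]
    linarith

theorem norm_twist_sub_twist_le (t : ℝ) (y y' : Ω) :
    ‖twist v t y - twist v t y'‖ ≤ |t| * |v y - v y'| := by
  have e : twist v t y - twist v t y'
      = twist v t y' * (Complex.exp (Complex.I * (t * (v y - v y') : ℝ)) - 1) := by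
    rw [mul_sub, mul_one, twist, twist, ← Complex.exp_add]
    push_cast
    ring_nf
  rw [e, norm_mul, norm_twist, one_mul, ← abs_mul, ← Real.norm_eq_abs]
  exact Real.norm_exp_I_mul_ofReal_sub_one_le

theorem min_one_mul_le {K a b : ℝ} (hK : 1 ≤ K) (hb : b ≤ K * a) :
    min 1 b ≤ K * min 1 a := by
  rw [mul_min_of_nonneg _ _ (by linarith), mul_one]
  exact le_min ((min_le_left _ _).trans hK) ((min_le_right _ _).trans hb)

theorem min_one_le_rpow {x a : ℝ} (hx : 0 ≤ x) (ha : 0 ≤ a) (ha1 : a ≤ 1) : min 1 x ≤ x ^ a := by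
  rcases le_total x 1 with h | h
  · rw [min_eq_right h]
    rcases hx.eq_or_lt with rfl | hx0
    · exact Real.rpow_nonneg le_rfl a
    · conv_lhs => rw [← Real.rpow_one x]
      exact Real.rpow_le_rpow_of_exponent_ge hx0 h ha1
  · rw [min_eq_left h]
    exact Real.one_le_rpow h ha

end Twist

/-- `v` is locally Lipschitz with constant `V`, and comparable, up to the factor `K`, to its values
on the same partition element. -/
structure IsTame {Ω ι : Type*} [MeasurableSpace Ω] (T : Ω → Ω) (P : ι → Set Ω) (θ : ℝ)
    (v : Ω → ℝ) (K V : ℝ) : Prop where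
  measurable : Measurable v
  one_le : 1 ≤ K
  nonneg : 0 ≤ V
  abs_le : ∀ j, ∀ y ∈ P j, ∀ z ∈ P j, |v y| ≤ K * |v z|
  abs_sub_le : ∀ j, ∀ y ∈ P j, ∀ y' ∈ P j, |v y - v y'| ≤ V * dTheta T P θ y y'

/-! ### Domination of the multipliers built from v. -/

section Tame

variable {Ω ι : Type*} [MeasurableSpace Ω] {μ : Measure Ω} {T : Ω → Ω} {P : ι → Set Ω} {θ : ℝ}
  {v : Ω → ℝ} {K V : ℝ}

/-- As d_θ ≤ 1, the oscillation of v on P j is at most C |v z| for every z in P j, hence |v y| ≤ (1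
+ C) |v z|. This lets bounds on an element be expressed through |v| at any one of its points. -/
theorem exists_isTame (h : IsGibbsMarkov μ T P θ) (hv : Measurable v)
    (hvLip : lipSemi T P θ v < ⊤)
    (hextra : ∃ C : ℝ≥0, ∀ j, lipOn T P θ v j ≤ C * ⨅ y ∈ P j, ‖v y‖ₑ) :
    ∃ K V, IsTame T P θ v K V := by
  obtain ⟨C, hC⟩ := hextra
  refine ⟨1 + C, (lipSemi T P θ v).toReal, hv, by simp, ENNReal.toReal_nonneg,
    fun j y hy z hz => ?_, fun j y hy y' hy' =>
      norm_sub_le_of_lipSemi_lt_top h.theta_pos h.separating hvLip hy hy'⟩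
  have h1 : lipOn T P θ v j ≤ ENNReal.ofReal (C * |v z|) := by
    refine (hC j).trans ?_
    rw [ENNReal.ofReal_mul C.coe_nonneg, ← Real.norm_eq_abs, ofReal_norm, ENNReal.ofReal_coe_nnreal]
    gcongr
    exact iInf₂_le z hz
  have h2 := enorm_sub_le_of_lipOn_le h.theta_pos h.separating
    (mul_nonneg C.coe_nonneg (abs_nonneg _)) h1 hy hz
  have h3 := h2.trans (mul_le_of_le_one_right (mul_nonneg C.coe_nonneg (abs_nonneg _))
    (dTheta_le_one h.theta_pos.le h.theta_lt_one.le y z))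
  have h4 := abs_sub_abs_le_abs_sub (v y) (v z)
  rw [Real.norm_eq_abs] at h3
  rw [add_mul, one_mul]
  change |v y| ≤ |v z| + (C : ℝ) * |v z|
  linarith

theorem measurable_twist (hv : IsTame T P θ v K V) (t : ℝ) : Measurable (twist v t) := by
  have := hv.measurable
  unfold twist
  fun_prop

namespace IsTame

theorem norm_twist_sub_twist_le (hv : IsTame T P θ v K V) (t : ℝ) {j : ι} {y y' : Ω}
    (hy : y ∈ P j) (hy' : y' ∈ P j) :
    ‖twist v t y - twist v t y'‖ ≤ |t| * V * dTheta T P θ y y' := by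
  rw [mul_assoc]
  exact (_root_.norm_twist_sub_twist_le t y y').trans
    (mul_le_mul_of_nonneg_left (hv.abs_sub_le j y hy y' hy') (abs_nonneg t))

theorem min_le (hv : IsTame T P θ v K V) (s : ℝ) {j : ι} {y z : Ω} (hy : y ∈ P j)
    (hz : z ∈ P j) : min 1 (|s| * |v y|) ≤ K * min 1 (|s| * |v z|) :=
  min_one_mul_le hv.one_le (by
    have := mul_le_mul_of_nonneg_left (hv.abs_le j y hy z hz) (abs_nonneg s)
    linarith)

theorem norm_twist_sub_one_le (hv : IsTame T P θ v K V) (s : ℝ) {j : ι} {y z : Ω}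
    (hy : y ∈ P j) (hz : z ∈ P j) : ‖twist v s y - 1‖ ≤ 2 * K * min 1 (|s| * |v z|) := by
  have h1 := _root_.norm_twist_sub_one_le (v := v) s y
  have h2 := hv.min_le s hy hz
  linarith

/-- Pointwise bounds for the increment of `t ↦ e^{itv}`. -/
theorem norm_increment_le (hv : IsTame T P θ v K V) (t s : ℝ) {j : ι} {y z : Ω}
    (hy : y ∈ P j) (hz : z ∈ P j) :
    ‖twist v (t + s) y - twist v t y‖ ≤ 2 * K * min 1 (|s| * |v z|) := by
  have e : twist v (t + s) y - twist v t y = twist v t y * (twist v s y - 1) := by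
    rw [twist_add]; ring
  rw [e, norm_mul, norm_twist, one_mul]
  exact hv.norm_twist_sub_one_le s hy hz

/-- Product rule for e^{itv} (e^{isv} - 1). -/
theorem norm_increment_sub_le (hv : IsTame T P θ v K V) (hθ : 0 ≤ θ) (t s : ℝ) {j : ι}
    {y y' z : Ω} (hy : y ∈ P j) (hy' : y' ∈ P j) (hz : z ∈ P j) :
    ‖(twist v (t + s) y - twist v t y) - (twist v (t + s) y' - twist v t y')‖
      ≤ (|t| * V * (2 * K * min 1 (|s| * |v z|)) + |s| * V) * dTheta T P θ y y' := by
  have hd := dTheta_nonneg (T := T) (P := P) hθ y y'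
  have e : (twist v (t + s) y - twist v t y) - (twist v (t + s) y' - twist v t y')
      = (twist v t y - twist v t y') * (twist v s y - 1)
        + twist v t y' * (twist v s y - twist v s y') := by
    rw [twist_add, twist_add]; ring
  rw [e, add_mul]
  refine (norm_add_le _ _).trans (add_le_add ?_ ?_)
  · rw [norm_mul]
    refine (mul_le_mul (hv.norm_twist_sub_twist_le t hy hy') (hv.norm_twist_sub_one_le s hy hz)
      (norm_nonneg _) (mul_nonneg (mul_nonneg (abs_nonneg _) hv.nonneg) hd)).trans_eq ?_
    ring
  · rw [norm_mul, norm_twist, one_mul]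
    exact hv.norm_twist_sub_twist_le s hy hy'

variable [IsProbabilityMeasure μ]

theorem dominatedBy_twist (hv : IsTame T P θ v K V) (hθ : 0 ≤ θ) (t : ℝ) :
    DominatedBy μ T P θ (twist v t) (fun _ => 1 + |t| * V) where
  measurable := measurable_twist hv t
  integrable := integrable_const _
  norm_le j y hy z hz := by
    rw [norm_twist]
    exact le_add_of_nonneg_right (mul_nonneg (abs_nonneg _) hv.nonneg)
  norm_sub_le j y hy y' hy' z hz := by
    refine (hv.norm_twist_sub_twist_le t hy hy').trans
      (mul_le_mul_of_nonneg_right (by linarith) (dTheta_nonneg hθ _ _))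

theorem integrable_min (hv : IsTame T P θ v K V) (s : ℝ) :
    Integrable (fun z => min 1 (|s| * |v z|)) μ :=
  Integrable.of_bound (measurable_const.min (hv.measurable.norm.const_mul _)).aestronglyMeasurable 1
    (ae_of_all _ fun y => by
      rw [Real.norm_of_nonneg (le_min zero_le_one (by positivity))]
      exact min_le_left _ _)

theorem integrable_mul_min (hv : IsTame T P θ v K V) (hvi : Integrable v μ) (s : ℝ) :
    Integrable (fun z => |v z| * min 1 (|s| * |v z|)) μ :=
  hvi.abs.mul_bdd (c := 1)
    (measurable_const.min (hv.measurable.norm.const_mul _)).aestronglyMeasurable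
    (ae_of_all _ fun y => by
      rw [Real.norm_of_nonneg (le_min zero_le_one (by positivity))]
      exact min_le_left _ _)

theorem dominatedBy_increment (hv : IsTame T P θ v K V) (hθ : 0 ≤ θ) (t s : ℝ) :
    DominatedBy μ T P θ (fun y => twist v (t + s) y - twist v t y)
      (fun z => (1 + |t| * V) * (2 * K) * min 1 (|s| * |v z|) + |s| * V) where
  measurable := (measurable_twist hv _).sub (measurable_twist hv _)
  integrable := ((hv.integrable_min s).const_mul _).add (integrable_const _)
  norm_le j y hy z hz := by
    have h1 := hv.norm_increment_le t s hy hz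
    have hK := hv.one_le
    have hV := hv.nonneg
    have h2 : 0 ≤ min 1 (|s| * |v z|) := le_min zero_le_one (by positivity)
    have h3 : 0 ≤ |t| * V * (2 * K * min 1 (|s| * |v z|)) := by positivity
    have h4 : 0 ≤ |s| * V := by positivity
    linarith
  norm_sub_le j y hy y' hy' z hz := by
    refine (hv.norm_increment_sub_le hθ t s hy hy' hz).trans
      (mul_le_mul_of_nonneg_right ?_ (dTheta_nonneg hθ _ _))
    have hK := hv.one_le
    have h2 : 0 ≤ 2 * K * min 1 (|s| * |v z|) :=
      mul_nonneg (by linarith) (le_min zero_le_one (by positivity))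
    linarith

theorem norm_mul_sub_le (hv : IsTame T P θ v K V) (hθ : 0 ≤ θ) {u : Ω → ℂ} {j : ι} {y y' z : Ω}
    (hy : y ∈ P j) (hy' : y' ∈ P j) (hz : z ∈ P j) {a b : ℝ} (hu : ‖u y‖ ≤ a)
    (hu' : ‖u y - u y'‖ ≤ b * dTheta T P θ y y') :
    ‖Complex.I * v y * u y - Complex.I * v y' * u y'‖
      ≤ (V * a + K * |v z| * b) * dTheta T P θ y y' := by
  have hd := dTheta_nonneg (T := T) (P := P) hθ y y'
  have e : Complex.I * v y * u y - Complex.I * v y' * u y'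
      = Complex.I * ((v y - v y' : ℝ) : ℂ) * u y + Complex.I * v y' * (u y - u y') := by
    push_cast; ring
  rw [e, add_mul]
  refine (norm_add_le _ _).trans (add_le_add ?_ ?_)
  · rw [norm_mul, norm_mul, Complex.norm_I, one_mul, Complex.norm_real, Real.norm_eq_abs]
    refine (mul_le_mul (hv.abs_sub_le j y hy y' hy') hu (norm_nonneg _)
      (mul_nonneg hv.nonneg hd)).trans_eq ?_
    ring
  · rw [norm_mul, norm_mul, Complex.norm_I, one_mul, Complex.norm_real, Real.norm_eq_abs]
    refine (mul_le_mul (hv.abs_le j y' hy' z hz) hu' (norm_nonneg _)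
      (mul_nonneg (by linarith [hv.one_le]) (abs_nonneg _))).trans_eq ?_
    ring

theorem norm_mul_le (hv : IsTame T P θ v K V) {u : Ω → ℂ} {j : ι} {y z : Ω}
    (hy : y ∈ P j) (hz : z ∈ P j) {a : ℝ} (hu : ‖u y‖ ≤ a) :
    ‖Complex.I * v y * u y‖ ≤ K * |v z| * a := by
  rw [norm_mul, norm_mul, Complex.norm_I, one_mul, Complex.norm_real, Real.norm_eq_abs]
  exact mul_le_mul (hv.abs_le j y hy z hz) hu (norm_nonneg _)
    (mul_nonneg (by linarith [hv.one_le]) (abs_nonneg _))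

theorem dominatedBy_deriv (hv : IsTame T P θ v K V) (hθ : 0 ≤ θ) (hvi : Integrable v μ) (t : ℝ) :
    DominatedBy μ T P θ (fun y => Complex.I * v y * twist v t y)
      (fun z => K * (1 + |t| * V) * |v z| + V) where
  measurable := (hv.measurable.complex_ofReal.const_mul _).mul (measurable_twist hv t)
  integrable := (hvi.abs.const_mul _).add (integrable_const _)
  norm_le j y hy z hz := by
    refine (hv.norm_mul_le hy hz (norm_twist t y).le).trans ?_
    have hK := hv.one_le
    have hV := hv.nonneg
    have : 0 ≤ K * (|t| * V) * |v z| := by positivity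
    linarith
  norm_sub_le j y hy y' hy' z hz := by
    refine (hv.norm_mul_sub_le hθ hy hy' hz (norm_twist t y).le
      (hv.norm_twist_sub_twist_le t hy hy')).trans
      (mul_le_mul_of_nonneg_right ?_ (dTheta_nonneg hθ _ _))
    have hK := hv.one_le
    have : 0 ≤ K * |v z| := by positivity
    linarith

theorem dominatedBy_deriv_increment (hv : IsTame T P θ v K V) (hθ : 0 ≤ θ)
    (hvi : Integrable v μ) (t s : ℝ) :
    DominatedBy μ T P θ (fun y => Complex.I * v y * (twist v (t + s) y - twist v t y))
      (fun z => 2 * K * K * (1 + |t| * V) * (|v z| * min 1 (|s| * |v z|))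
        + 3 * K * V * |s| * |v z|) where
  measurable := (hv.measurable.complex_ofReal.const_mul _).mul
    ((measurable_twist hv _).sub (measurable_twist hv _))
  integrable := ((hv.integrable_mul_min hvi s).const_mul _).add (hvi.abs.const_mul _)
  norm_le j y hy z hz := by
    refine (hv.norm_mul_le (u := fun y => twist v (t + s) y - twist v t y) hy hz
      (hv.norm_increment_le t s hy hz)).trans ?_
    have hK := hv.one_le
    have hV := hv.nonneg
    have h2 : 0 ≤ min 1 (|s| * |v z|) := le_min zero_le_one (by positivity)
    have h3 : 0 ≤ 2 * K * K * (|t| * V) * (|v z| * min 1 (|s| * |v z|)) := by positivity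
    have h4 : 0 ≤ 3 * K * V * |s| * |v z| := by positivity
    linarith
  norm_sub_le j y hy y' hy' z hz := by
    refine (hv.norm_mul_sub_le (u := fun y => twist v (t + s) y - twist v t y) hθ hy hy' hz (hv.norm_increment_le t s hy hz)
      (hv.norm_increment_sub_le hθ t s hy hy' hz)).trans
      (mul_le_mul_of_nonneg_right ?_ (dTheta_nonneg hθ _ _))
    have hK := hv.one_le
    have hV := hv.nonneg
    have h2 : 0 ≤ min 1 (|s| * |v z|) := le_min zero_le_one (by positivity)
    -- The minimum is traded for |s| |v z|; with the term from |s| V this makes up the coefficient 3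
    -- K V |s|.
    have h3 : V * (2 * K * min 1 (|s| * |v z|)) ≤ V * (2 * K * (|s| * |v z|)) := by
      gcongr; exact min_le_right _ _
    have h4 : 0 ≤ 2 * K * K * (|v z| * min 1 (|s| * |v z|)) := by positivity
    linarith

/-- The remainder is e^{itv} E with E = e^{isv} - 1 - isv. The dominating function is |s| times a
quantity whose integral tends to 0 with s, whence differentiability in operator norm. -/
theorem dominatedBy_remainder (hv : IsTame T P θ v K V) (h : IsGibbsMarkov μ T P θ)
    (hvi : Integrable v μ) (t s : ℝ) :
    DominatedBy μ T P θ
      (fun y => twist v (t + s) y - twist v t y - s * (Complex.I * v y * twist v t y))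
      (fun z => |s| * (3 * K * K * (1 + |t| * V) * (|v z| * min 1 (|s| * |v z|))
        + 3 * |s| * V ^ 2 + 2 * K * V * |s| * |v z|)) where
  measurable := ((measurable_twist hv _).sub (measurable_twist hv _)).sub
    (((hv.measurable.complex_ofReal.const_mul _).mul (measurable_twist hv t)).const_mul _)
  integrable := ((((hv.integrable_mul_min hvi s).const_mul _).add (integrable_const _)).add
    (hvi.abs.const_mul _)).const_mul _
  norm_le j y hy z hz := by
    have hK := hv.one_le
    have hV := hv.nonneg
    have e : twist v (t + s) y - twist v t y - s * (Complex.I * v y * twist v t y)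
        = twist v t y * (twist v s y - 1 - Complex.I * (s * v y : ℝ)) := by
      rw [twist_add]; push_cast; ring
    rw [e, norm_mul, norm_twist, one_mul]
    have h1 := norm_exp_sub_one_sub_le (s * v y)
    rw [abs_mul] at h1
    refine h1.trans ?_
    have h2 : 0 ≤ min 1 (|s| * |v z|) := le_min zero_le_one (by positivity)
    have h0 : 0 ≤ min 1 (|s| * |v y|) := le_min zero_le_one (by positivity)
    have h3 : |s| * |v y| * min 1 (|s| * |v y|)
        ≤ |s| * (K * |v z|) * (K * min 1 (|s| * |v z|)) :=
      mul_le_mul (mul_le_mul_of_nonneg_left (hv.abs_le j y hy z hz) (abs_nonneg s))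
        (hv.min_le s hy hz) h0 (by positivity)
    have h4 : 0 ≤ |s| * (3 * K * K * (|t| * V) * (|v z| * min 1 (|s| * |v z|))) := by positivity
    have h5 : 0 ≤ |s| * (3 * |s| * V ^ 2 + 2 * K * V * |s| * |v z|) := by positivity
    linarith
  norm_sub_le j y hy y' hy' z hz := by
    have hK := hv.one_le
    have hV := hv.nonneg
    have hd := dTheta_nonneg (T := T) (P := P) h.theta_pos.le y y'
    have hd1 := dTheta_le_one (T := T) (P := P) h.theta_pos.le h.theta_lt_one.le y y'
    set d := dTheta T P θ y y'
    set m := min 1 (|s| * |v z|) with hm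
    have hm0 : 0 ≤ m := le_min zero_le_one (by positivity)
    set E : Ω → ℂ := fun y => twist v s y - 1 - Complex.I * (s * v y : ℝ) with hE
    have e0 : ∀ y, twist v (t + s) y - twist v t y - s * (Complex.I * v y * twist v t y)
        = twist v t y * E y := fun y => by
      simp only [hE]
      rw [twist_add]; push_cast; ring
    have hsub : |s * (v y - v y')| ≤ |s| * (V * d) := by
      rw [abs_mul]
      exact mul_le_mul_of_nonneg_left (hv.abs_sub_le j y hy y' hy') (abs_nonneg s)
    have e1 : twist v (t + s) y - twist v t y - s * (Complex.I * v y * twist v t y)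
          - (twist v (t + s) y' - twist v t y' - s * (Complex.I * v y' * twist v t y'))
        = (twist v t y - twist v t y') * E y + twist v t y' * (E y - E y') := by
      rw [e0, e0]; ring
    -- With δ = v y - v y', the difference splits into a Taylor remainder in sδ and sδ times e^{isv}
    -- - 1 at y'. Both terms carry δ, hence a factor d_θ(y, y').
    have e2 : E y - E y' = twist v s y' * (Complex.exp (Complex.I * (s * (v y - v y') : ℝ)) - 1
          - Complex.I * (s * (v y - v y') : ℝ))
        + Complex.I * (s * (v y - v y') : ℝ) * (twist v s y' - 1) := by
      have : twist v s y = twist v s y' * Complex.exp (Complex.I * (s * (v y - v y') : ℝ)) := by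
        rw [twist, twist, ← Complex.exp_add]
        push_cast
        ring_nf
      simp only [hE]
      rw [this]
      push_cast
      ring
    have b1 : ‖E y‖ ≤ 3 * (|s| * (K * |v z|) * (K * m)) := by
      have h1 := norm_exp_sub_one_sub_le (s * v y)
      rw [abs_mul] at h1
      refine h1.trans (mul_le_mul_of_nonneg_left ?_ (by norm_num))
      exact mul_le_mul (mul_le_mul_of_nonneg_left (hv.abs_le j y hy z hz) (abs_nonneg s))
        (hv.min_le s hy hz) (le_min zero_le_one (by positivity)) (by positivity)
    have b2 : ‖E y - E y'‖ ≤ 3 * (|s| * (V * d) * (|s| * V)) + |s| * (V * d) * (2 * K * m) := by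
      rw [e2]
      refine (norm_add_le _ _).trans (add_le_add ?_ ?_)
      · rw [norm_mul, norm_twist, one_mul]
        refine (norm_exp_sub_one_sub_le _).trans (mul_le_mul_of_nonneg_left ?_ (by norm_num))
        refine mul_le_mul hsub ((min_le_right _ _).trans (hsub.trans ?_))
          (le_min zero_le_one (abs_nonneg _)) (by positivity)
        exact mul_le_mul_of_nonneg_left (mul_le_of_le_one_right hV hd1) (abs_nonneg s)
      · rw [norm_mul, norm_mul, Complex.norm_I, one_mul, Complex.norm_real, Real.norm_eq_abs]
        exact mul_le_mul hsub (hv.norm_twist_sub_one_le s hy' hz) (norm_nonneg _) (by positivity)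
    rw [e1]
    refine (norm_add_le _ _).trans ?_
    rw [norm_mul, norm_mul, norm_twist, one_mul]
    have b3 : ‖twist v t y - twist v t y'‖ * ‖E y‖
        ≤ |t| * V * d * (3 * (|s| * (K * |v z|) * (K * m))) :=
      mul_le_mul (hv.norm_twist_sub_twist_le t hy hy') b1 (norm_nonneg _) (by positivity)
    have hmle : m ≤ |s| * |v z| := min_le_right _ _
    have b4 : |s| * (V * d) * (2 * K * m) ≤ |s| * (V * d) * (2 * K * (|s| * |v z|)) := by gcongr
    have b5 : 0 ≤ |s| * (3 * K * K * (|v z| * m)) * d := by positivity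
    calc _ ≤ |t| * V * d * (3 * (|s| * (K * |v z|) * (K * m)))
          + (3 * (|s| * (V * d) * (|s| * V)) + |s| * (V * d) * (2 * K * (|s| * |v z|))) := by
          linarith
      _ ≤ |t| * V * d * (3 * (|s| * (K * |v z|) * (K * m)))
          + (3 * (|s| * (V * d) * (|s| * V)) + |s| * (V * d) * (2 * K * (|s| * |v z|)))
          + |s| * (3 * K * K * (|v z| * m)) * d := by linarith
      _ = _ := by ring

end IsTame

end Tame

/-! ### The operators R(t) and the verification of (H2). -/

section PerturbedOperator

variable {Ω ι : Type*} [MeasurableSpace Ω] {μ : Measure Ω} {T : Ω → Ω} {P : ι → Set Ω} {θ : ℝ}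
  [Nonempty Ω] {g : Ω → ℝ} {C : ℝ} [Countable ι] [IsProbabilityMeasure μ]
  {v : Ω → ℝ} {K V : ℝ}

theorem BTheta.real_smul_apply (r : ℝ) (f : BTheta T P θ) (y : Ω) : (r • f) y = r * f y := by
  rw [← Complex.coe_smul, BTheta.smul_apply]

/-- The operator `f ↦ R (e^{itv} f)` on `𝓑_θ`. -/
def perturbedCLM (h : IsGibbsMarkov μ T P θ) (hg : IsWeight μ T P θ g C)
    (hv : IsTame T P θ v K V) (t : ℝ) : BTheta T P θ →L[ℂ] BTheta T P θ :=
  (hv.dominatedBy_twist (μ := μ) h.theta_pos.le t).op h hg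

/-- The operator `f ↦ R (i v e^{itv} f)` on `𝓑_θ`. -/
def perturbedDeriv (h : IsGibbsMarkov μ T P θ) (hg : IsWeight μ T P θ g C)
    (hv : IsTame T P θ v K V) (hvi : Integrable v μ) (t : ℝ) :
    BTheta T P θ →L[ℂ] BTheta T P θ :=
  (hv.dominatedBy_deriv h.theta_pos.le hvi t).op h hg

theorem perturbedCLM_ae_eq (h : IsGibbsMarkov μ T P θ) (hg : IsWeight μ T P θ g C)
    (hv : IsTame T P θ v K V) (t : ℝ) (f : BTheta T P θ) :
    (perturbedCLM h hg hv t f).toFun =ᵐ[μ] perturbedOp μ T v t f.toFun := by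
  have hm : Measurable fun y => twist v t y * f y := (measurable_twist hv t).mul f.measurable
  have hb : ∀ y, ‖twist v t y * f y‖ ≤ f.sup := fun y => by
    rw [norm_mul, norm_twist, one_mul]; exact f.norm_apply_le y
  exact (isTransferImage_branchSum h hg hm hb).ae_eq
    (transferOp_spec h.ergodic.toMeasurePreserving
      (Integrable.of_bound hm.aestronglyMeasurable f.sup (ae_of_all _ hb)))

theorem perturbedCLM_zero (h : IsGibbsMarkov μ T P θ) (hg : IsWeight μ T P θ g C)
    (hv : IsTame T P θ v K V) : perturbedCLM h hg hv 0 = h.op hg := by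
  ext f x
  rw [gmOp_apply, perturbedCLM, DominatedBy.op_apply]
  simp [twist_zero]

theorem norm_perturbedCLM_le (h : IsGibbsMarkov μ T P θ) (hg : IsWeight μ T P θ g C)
    (hv : IsTame T P θ v K V) (t : ℝ) :
    ‖perturbedCLM h hg hv t‖ ≤ 3 * C * (1 + |t| * V) := by
  refine ((hv.dominatedBy_twist (μ := μ) h.theta_pos.le t).norm_op_le h hg).trans_eq ?_
  simp

/-- The difference is again of the form f ↦ R(uf), with u the difference of the multipliers, so its
norm is read off from the integral of the dominating function. -/
theorem norm_perturbedCLM_sub_le (h : IsGibbsMarkov μ T P θ) (hg : IsWeight μ T P θ g C)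
    (hv : IsTame T P θ v K V) (t s : ℝ) :
    ‖perturbedCLM h hg hv (t + s) - perturbedCLM h hg hv t‖
      ≤ 3 * C * ((1 + |t| * V) * (2 * K) * ∫ y, min 1 (|s| * |v y|) ∂μ + |s| * V) := by
  refine ((hv.dominatedBy_increment (μ := μ) h.theta_pos.le t s).norm_le_of_apply_eq h hg
    fun f x => ?_).trans_eq ?_
  · have e1 := (hv.dominatedBy_twist (μ := μ) h.theta_pos.le (t + s)).summable h hg f x
    have e2 := (hv.dominatedBy_twist (μ := μ) h.theta_pos.le t).summable h hg f x
    rw [sub_apply, BTheta.sub_apply, perturbedCLM, perturbedCLM, DominatedBy.op_apply,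
      DominatedBy.op_apply, branchSum, branchSum, branchSum, ← e1.tsum_sub e2]
    refine tsum_congr fun j => ?_
    rw [← smul_sub, ← sub_mul]
  · rw [integral_add ((hv.integrable_min s).const_mul _) (integrable_const _), integral_const_mul]
    simp

theorem norm_perturbedDeriv_le (h : IsGibbsMarkov μ T P θ) (hg : IsWeight μ T P θ g C)
    (hv : IsTame T P θ v K V) (hvi : Integrable v μ) (t : ℝ) :
    ‖perturbedDeriv h hg hv hvi t‖ ≤ 3 * C * (K * (1 + |t| * V) * ∫ y, |v y| ∂μ + V) := by
  refine ((hv.dominatedBy_deriv (μ := μ) h.theta_pos.le hvi t).norm_op_le h hg).trans_eq ?_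
  rw [integral_add (hvi.abs.const_mul _) (integrable_const _), integral_const_mul]
  simp

theorem norm_perturbedDeriv_sub_le (h : IsGibbsMarkov μ T P θ) (hg : IsWeight μ T P θ g C)
    (hv : IsTame T P θ v K V) (hvi : Integrable v μ) (t s : ℝ) :
    ‖perturbedDeriv h hg hv hvi (t + s) - perturbedDeriv h hg hv hvi t‖
      ≤ 3 * C * (2 * K * K * (1 + |t| * V) * ∫ y, |v y| * min 1 (|s| * |v y|) ∂μ
        + 3 * K * V * |s| * ∫ y, |v y| ∂μ) := by
  refine ((hv.dominatedBy_deriv_increment (μ := μ) h.theta_pos.le hvi t s).norm_le_of_apply_eq h hg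
    fun f x => ?_).trans_eq ?_
  · have e1 := (hv.dominatedBy_deriv (μ := μ) h.theta_pos.le hvi (t + s)).summable h hg f x
    have e2 := (hv.dominatedBy_deriv (μ := μ) h.theta_pos.le hvi t).summable h hg f x
    rw [sub_apply, BTheta.sub_apply, perturbedDeriv, perturbedDeriv, DominatedBy.op_apply,
      DominatedBy.op_apply, branchSum, branchSum, branchSum, ← e1.tsum_sub e2]
    refine tsum_congr fun j => ?_
    rw [← smul_sub, ← sub_mul, ← mul_sub]
  · rw [integral_add ((hv.integrable_mul_min hvi s).const_mul _) (hvi.abs.const_mul _),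
      integral_const_mul, integral_const_mul]

theorem norm_perturbedCLM_sub_sub_le (h : IsGibbsMarkov μ T P θ) (hg : IsWeight μ T P θ g C)
    (hv : IsTame T P θ v K V) (hvi : Integrable v μ) (t s : ℝ) :
    ‖perturbedCLM h hg hv (t + s) - perturbedCLM h hg hv t - s • perturbedDeriv h hg hv hvi t‖
      ≤ 3 * C * (|s| * (3 * K * K * (1 + |t| * V) * ∫ y, |v y| * min 1 (|s| * |v y|) ∂μ
        + 3 * |s| * V ^ 2 + 2 * K * V * |s| * ∫ y, |v y| ∂μ)) := by
  refine ((hv.dominatedBy_remainder h hvi t s).norm_le_of_apply_eq h hg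
    fun f x => ?_).trans_eq ?_
  · have e1 := (hv.dominatedBy_twist (μ := μ) h.theta_pos.le (t + s)).summable h hg f x
    have e2 := (hv.dominatedBy_twist (μ := μ) h.theta_pos.le t).summable h hg f x
    have e3 := (hv.dominatedBy_deriv (μ := μ) h.theta_pos.le hvi t).summable h hg f x
    rw [sub_apply, sub_apply, smul_apply, BTheta.sub_apply, BTheta.sub_apply,
      BTheta.real_smul_apply, perturbedCLM, perturbedCLM, perturbedDeriv, DominatedBy.op_apply,
      DominatedBy.op_apply, DominatedBy.op_apply, branchSum, branchSum, branchSum, branchSum,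
      ← e1.tsum_sub e2, ← tsum_mul_left, ← (e1.sub e2).tsum_sub (e3.mul_left _)]
    refine tsum_congr fun j => ?_
    simp only [Complex.real_smul]
    ring
  · have hi : Integrable (fun y => 3 * K * K * (1 + |t| * V) * (|v y| * min 1 (|s| * |v y|))
        + 3 * |s| * V ^ 2) μ :=
      ((hv.integrable_mul_min hvi s).const_mul _).add (integrable_const _)
    rw [integral_const_mul, integral_add hi (hvi.abs.const_mul _),
      integral_add ((hv.integrable_mul_min hvi s).const_mul _) (integrable_const _),
      integral_const_mul, integral_const_mul, integral_const_mul]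
    simp

/-- Use min(1, x) ≤ x^a: a finite moment of order 1 + a replaces the precise tail asymptotics. -/
theorem integral_mul_min_le_rpow (hv : IsTame T P θ v K V) {a : ℝ} (ha : 0 < a) (ha1 : a ≤ 1)
    (hvi : Integrable v μ) (hm : Integrable (fun y => |v y| ^ (1 + a)) μ) (s : ℝ) :
    ∫ y, |v y| * min 1 (|s| * |v y|) ∂μ ≤ |s| ^ a * ∫ y, |v y| ^ (1 + a) ∂μ := by
  rw [← integral_const_mul]
  refine integral_mono (hv.integrable_mul_min hvi s) (hm.const_mul _) fun y => ?_
  have h1 := min_one_le_rpow (x := |s| * |v y|) (by positivity) ha.le ha1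
  have h2 := mul_le_mul_of_nonneg_left h1 (abs_nonneg (v y))
  refine h2.trans_eq ?_
  rw [Real.mul_rpow (abs_nonneg _) (abs_nonneg _), Real.rpow_add' (abs_nonneg _) (by linarith),
    Real.rpow_one]
  ring

theorem hasDerivAt_perturbedCLM (h : IsGibbsMarkov μ T P θ) (hg : IsWeight μ T P θ g C)
    (hv : IsTame T P θ v K V) (hvi : Integrable v μ) {a : ℝ} (ha : 0 < a) (ha1 : a ≤ 1)
    (hm : Integrable (fun y => |v y| ^ (1 + a)) μ) (t : ℝ) :
    HasDerivAt (perturbedCLM h hg hv) (perturbedDeriv h hg hv hvi t) t := by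
  rw [hasDerivAt_iff_isLittleO_nhds_zero, Asymptotics.isLittleO_iff]
  intro c hc
  set A := 3 * C * (3 * K * K * (1 + |t| * V)) * ∫ y, |v y| ^ (1 + a) ∂μ
  set B := 3 * C * (3 * V ^ 2 + 2 * K * V * ∫ y, |v y| ∂μ)
  have hlim : Tendsto (fun s : ℝ => A * |s| ^ a + B * |s|) (𝓝 0) (𝓝 0) := by
    have h1 : Continuous fun s : ℝ => A * |s| ^ a + B * |s| :=
      (continuous_const.mul (continuous_abs.rpow_const fun _ => Or.inr ha.le)).add
        (continuous_const.mul continuous_abs)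
    have h2 := h1.tendsto 0
    simpa [Real.zero_rpow ha.ne'] using h2
  filter_upwards [hlim.eventually_lt_const hc] with s hs
  refine (norm_perturbedCLM_sub_sub_le h hg hv hvi t s).trans ?_
  have h1 := integral_mul_min_le_rpow hv ha ha1 hvi hm s
  have hK := hv.one_le
  have hV := hv.nonneg
  have hC := hg.const_nonneg
  have h2 : 3 * C * (3 * K * K * (1 + |t| * V)) * ∫ y, |v y| * min 1 (|s| * |v y|) ∂μ
      ≤ 3 * C * (3 * K * K * (1 + |t| * V)) * (|s| ^ a * ∫ y, |v y| ^ (1 + a) ∂μ) :=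
    mul_le_mul_of_nonneg_left h1 (by positivity)
  rw [Real.norm_eq_abs]
  have h3 := mul_le_mul_of_nonneg_right hs.le (abs_nonneg s)
  refine le_trans ?_ h3
  have h4 := mul_le_mul_of_nonneg_right h2 (abs_nonneg s)
  simp only [A, B]
  linarith

theorem hypH2_of_lt_one (h : IsGibbsMarkov μ T P θ) (hg : IsWeight μ T P θ g C)
    (hv : IsTame T P θ v K V) {α : ℝ} {ℓ : ℝ → ℝ} (hα0 : 0 < α) (hα : α < 1)
    (hbound : ∃ C ε : ℝ, 0 ≤ C ∧ 0 < ε ∧ ∀ t : ℝ, 0 < |t| → |t| < ε →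
      ∫ y, min 1 (|t| * |v y|) ∂μ ≤ C * (|t| ^ α * ℓ (1 / |t|)) ∧
        |t| ≤ C * (|t| ^ α * ℓ (1 / |t|))) :
    HypH2 (perturbedCLM h hg hv) α ℓ := by
  obtain ⟨D, ε, hD0, hε0, hD⟩ := hbound
  have hK := hv.one_le
  have hV := hv.nonneg
  have hC := hg.const_nonneg
  set M₁ := 3 * C * (1 + V) with hM₁
  set M₂ := 3 * C * ((1 + V) * (2 * K) * D + D * V) with hM₂
  have hM₁0 : 0 ≤ M₁ := by positivity
  have hM₂0 : 0 ≤ M₂ := by positivity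
  refine ⟨min ε 1, by positivity, M₁ + M₂ + 1, by positivity, fun t ht => ?_,
    fun h1 => absurd h1 (not_lt.2 hα.le), fun _ t s ht hs => ?_,
    fun h1 => absurd h1 (not_lt.2 hα.le), fun h1 => absurd h1 (not_lt.2 hα.le)⟩
  · have ht1 : |t| ≤ 1 := ht.le.trans (min_le_right _ _)
    refine (norm_perturbedCLM_le h hg hv t).trans ?_
    have : 3 * C * (1 + |t| * V) ≤ M₁ := by
      rw [hM₁]; gcongr; exact mul_le_of_le_one_left hV ht1
    linarith
  · have ht1 : |t| ≤ 1 := ht.le.trans (min_le_right _ _)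
    rcases (abs_nonneg s).eq_or_lt with hs0 | hs0
    · have : s = 0 := abs_eq_zero.1 hs0.symm
      subst this
      simp [Real.zero_rpow hα0.ne']
    · obtain ⟨h1, h2⟩ := hD s hs0 (hs.trans_le (min_le_left _ _))
      set X := |s| ^ α * ℓ (1 / |s|)
      have hX : 0 ≤ X := (pos_of_mul_pos_right (hs0.trans_le h2) hD0).le
      refine (norm_perturbedCLM_sub_le h hg hv t s).trans ?_
      have h3 : 3 * C * ((1 + |t| * V) * (2 * K) * ∫ y, min 1 (|s| * |v y|) ∂μ + |s| * V)
          ≤ 3 * C * ((1 + V) * (2 * K) * (D * X) + D * X * V) := by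
        gcongr
        · exact mul_le_of_le_one_left hV ht1
      refine h3.trans ?_
      have h4 : 0 ≤ (M₁ + 1) * X := by positivity
      have h5 : 3 * C * ((1 + V) * (2 * K) * (D * X) + D * X * V) = M₂ * X := by rw [hM₂]; ring
      linarith

/-- The increment bound for R' gives (iv) through the truncated moment. With a moment of order α'
instead it gives Hölder continuity of R' at 0, and (iii) is the mean value inequality for r ↦ R(r) -
r R'(0) between t and t + h. -/
theorem hypH2_of_one_lt (h : IsGibbsMarkov μ T P θ) (hg : IsWeight μ T P θ g C)
    (hv : IsTame T P θ v K V) {α : ℝ} {ℓ : ℝ → ℝ} (hα : 1 < α) (hα2 : α ≤ 2)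
    (hvi : Integrable v μ)
    (hm : ∀ a : ℝ, 0 < a → a < α → Integrable (fun y => |v y| ^ a) μ)
    (hbound : ∃ C ε : ℝ, 0 ≤ C ∧ 0 < ε ∧ ∀ t : ℝ, 0 < |t| → |t| < ε →
      ∫ y, |v y| * min 1 (|t| * |v y|) ∂μ ≤ C * (|t| ^ (α - 1) * ellZero α ℓ (1 / |t|)) ∧
        |t| ≤ C * (|t| ^ (α - 1) * ellZero α ℓ (1 / |t|))) :
    HypH2 (perturbedCLM h hg hv) α ℓ := by
  obtain ⟨D, ε, hD0, hε0, hD⟩ := hbound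
  have hK := hv.one_le
  have hV := hv.nonneg
  have hC := hg.const_nonneg
  set m := ∫ y, |v y| ∂μ with hmdef
  have hm0 : 0 ≤ m := integral_nonneg fun y => abs_nonneg _
  have hder : ∀ t, HasDerivAt (perturbedCLM h hg hv) (perturbedDeriv h hg hv hvi t) t :=
    -- Then 1 + a = (1 + α) / 2 < α, so the moment is finite.
    hasDerivAt_perturbedCLM h hg hv hvi (a := (α - 1) / 2) (by linarith) (by linarith)
      (hm _ (by linarith) (by linarith))
  have hderiv : ∀ t, deriv (perturbedCLM h hg hv) t = perturbedDeriv h hg hv hvi t :=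
    fun t => (hder t).deriv
  set M₁ := 3 * C * (1 + V) with hM₁
  set M₂ := 3 * C * (K * (1 + V) * m + V) with hM₂
  set M₃ := 3 * C * (2 * K * K * (1 + V) * D + 3 * K * V * D * m) with hM₃
  have hM₁0 : 0 ≤ M₁ := by positivity
  have hM₂0 : 0 ≤ M₂ := by positivity
  have hM₃0 : 0 ≤ M₃ := by positivity
  -- With |t|, |h| ≤ 1 / 2 the whole segment from t to t + h stays in [-1, 1], where the Hölder
  -- bound for R' is available.
  refine ⟨min ε (1 / 2), by positivity, M₁ + M₂ + M₃ + 1, by positivity, fun t ht => ?_,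
    fun _ => ⟨fun t _ => (hder t).differentiableAt, fun t ht => ?_⟩,
    fun h1 => absurd h1 (not_lt.2 hα.le), fun _ α' hα'1 hα' => ?_, fun _ t s ht hs => ?_⟩
  · have ht1 : |t| ≤ 1 := (ht.le.trans (min_le_right _ _)).trans (by norm_num)
    refine (norm_perturbedCLM_le h hg hv t).trans ?_
    have : 3 * C * (1 + |t| * V) ≤ M₁ := by
      rw [hM₁]; gcongr; exact mul_le_of_le_one_left hV ht1
    linarith
  · have ht1 : |t| ≤ 1 := (ht.le.trans (min_le_right _ _)).trans (by norm_num)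
    rw [hderiv]
    refine (norm_perturbedDeriv_le h hg hv hvi t).trans ?_
    have : 3 * C * (K * (1 + |t| * V) * m + V) ≤ M₂ := by
      rw [hM₂]; gcongr; exact mul_le_of_le_one_left hV ht1
    linarith
  · set a := α' - 1 with ha
    have ha0 : 0 < a := by linarith
    have ha1 : a ≤ 1 := by linarith
    have hma : Integrable (fun y => |v y| ^ (1 + a)) μ := hm _ (by linarith) (by linarith)
    set m' := ∫ y, |v y| ^ (1 + a) ∂μ with hm'
    have hm'0 : 0 ≤ m' := integral_nonneg fun y => Real.rpow_nonneg (abs_nonneg _) _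
    set C' := 3 * C * (2 * K * K * m' + 3 * K * V * m) with hC'
    have hC'0 : 0 ≤ C' := by positivity
    have hbd : ∀ s : ℝ, |s| ≤ 1 →
        ‖perturbedDeriv h hg hv hvi s - perturbedDeriv h hg hv hvi 0‖ ≤ C' * |s| ^ a := by
      intro s hs
      have h1 := norm_perturbedDeriv_sub_le h hg hv hvi 0 s
      rw [zero_add, abs_zero, zero_mul, add_zero, mul_one] at h1
      refine h1.trans ?_
      have h2 := integral_mul_min_le_rpow hv ha0 ha1 hvi hma s
      have h3 : |s| ≤ |s| ^ a := by
        have := min_one_le_rpow (abs_nonneg s) ha0.le ha1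
        rwa [min_eq_right hs] at this
      calc _ ≤ 3 * C * (2 * K * K * (|s| ^ a * m') + 3 * K * V * |s| ^ a * m) := by gcongr
        _ = _ := by rw [hC']; ring
    refine ⟨C' + 1, by positivity, fun t s ht hs => ?_⟩
    have ht2 : |t| ≤ 1 / 2 := ht.le.trans (min_le_right _ _)
    have hs2 : |s| ≤ 1 / 2 := hs.le.trans (min_le_right _ _)
    have hseg : ∀ r ∈ uIcc t (t + s), |r| ≤ |t| + |s| := by
      intro r hr
      have h1 : |r - t| ≤ |t + s - t| := abs_sub_left_of_mem_uIcc hr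
      rw [add_sub_cancel_left] at h1
      have h2 := abs_sub_abs_le_abs_sub r t
      linarith
    have hmv := (convex_uIcc t (t + s)).norm_image_sub_le_of_norm_hasDerivWithin_le
      (f := fun r : ℝ => perturbedCLM h hg hv r - r • perturbedDeriv h hg hv hvi 0)
      (f' := fun r => perturbedDeriv h hg hv hvi r - perturbedDeriv h hg hv hvi 0)
      (C := C' * (|t| ^ a + |s| ^ a))
      (fun r _ => by
        have h1 := (hder r).sub ((hasDerivAt_id r).smul_const (perturbedDeriv h hg hv hvi 0))
        rw [one_smul] at h1
        exact h1.hasDerivWithinAt)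
      (fun r hr => by
        have h1 := hseg r hr
        refine (hbd r (by linarith)).trans (mul_le_mul_of_nonneg_left ?_ hC'0)
        refine (Real.rpow_le_rpow (abs_nonneg r) h1 ha0.le).trans ?_
        exact Real.rpow_add_le_add_rpow (abs_nonneg t) (abs_nonneg s) ha0.le ha1)
      left_mem_uIcc right_mem_uIcc
    have e : perturbedCLM h hg hv (t + s) - (t + s) • perturbedDeriv h hg hv hvi 0
        - (perturbedCLM h hg hv t - t • perturbedDeriv h hg hv hvi 0)
        = perturbedCLM h hg hv (t + s) - perturbedCLM h hg hv t
          - s • perturbedDeriv h hg hv hvi 0 := by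
      rw [add_smul]; abel
    rw [e, add_sub_cancel_left, Real.norm_eq_abs] at hmv
    rw [hderiv]
    refine hmv.trans ?_
    have h5 : 0 ≤ |s| * (|t| ^ a + |s| ^ a) := by positivity
    linarith
  · have ht1 : |t| ≤ 1 := (ht.le.trans (min_le_right _ _)).trans (by norm_num)
    rw [hderiv, hderiv]
    rcases (abs_nonneg s).eq_or_lt with hs0 | hs0
    · have : s = 0 := abs_eq_zero.1 hs0.symm
      subst this
      simp [Real.zero_rpow (by linarith : α - 1 ≠ 0)]
    · obtain ⟨h1, h2⟩ := hD s hs0 (hs.trans_le (min_le_left _ _))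
      set X := |s| ^ (α - 1) * ellZero α ℓ (1 / |s|)
      have hX : 0 ≤ X := (pos_of_mul_pos_right (hs0.trans_le h2) hD0).le
      refine (norm_perturbedDeriv_sub_le h hg hv hvi t s).trans ?_
      have h3 : 3 * C * (2 * K * K * (1 + |t| * V) * ∫ y, |v y| * min 1 (|s| * |v y|) ∂μ
            + 3 * K * V * |s| * m)
          ≤ 3 * C * (2 * K * K * (1 + V) * (D * X) + 3 * K * V * (D * X) * m) := by
        gcongr
        · exact mul_le_of_le_one_left hV ht1
      refine h3.trans ?_
      have h4 : 0 ≤ (M₁ + M₂ + 1) * X := by positivity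
      have h5 : 3 * C * (2 * K * K * (1 + V) * (D * X) + 3 * K * V * (D * X) * m) = M₃ * X := by
        rw [hM₃]; ring
      linarith

end PerturbedOperator

end

/-! ### The main theorem. -/

theorem mainTheorem4 {Ω ι : Type*} [MeasurableSpace Ω] [Countable ι]
    (μ : Measure Ω) [IsProbabilityMeasure μ] (T : Ω → Ω) (P : ι → Set Ω) (θ : ℝ)
    (hGM : IsGibbsMarkov μ T P θ) (hmix : IsMixing μ T)
    (v : Ω → ℝ) (hv : Measurable v) (hv2 : ∫⁻ y, ‖v y‖ₑ ^ 2 ∂μ = ⊤)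
    (hvLip : lipSemi T P θ v < ⊤)
    (hextra : ∃ C : ℝ≥0, ∀ j, lipOn T P θ v j ≤ C * ⨅ y ∈ P j, ‖v y‖ₑ)
    (α : ℝ) (hα : α ∈ Ioo (0 : ℝ) 1 ∪ Ioc (1 : ℝ) 2)
    (p q : ℝ) (ℓ : ℝ → ℝ) (hH1 : HypH1 μ v α p q ℓ)
    (hℓ : α = 2 → ∀ x : ℝ, 1 ≤ x → IntervalIntegrable (fun u => ℓ u / u) volume 1 x) :
    -- `𝓑_θ` is a Banach space of bounded functions, with `|f|_∞ ≤ ‖f‖` and constants in it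
    CompleteSpace (BTheta T P θ) ∧
    (∀ f : BTheta T P θ, eLpNorm f ⊤ μ = supNormE f ∧ eLpNorm f ⊤ μ ≤ ENNReal.ofReal ‖f‖) ∧
    (∀ c : ℂ, ∃ f : BTheta T P θ, ∀ y, f y = c) ∧
    -- the operators `R(t)` act on `𝓑_θ` and satisfy the hypotheses
    ∃ R : ℝ → BTheta T P θ →L[ℂ] BTheta T P θ,
      (∀ t f, R t f =ᵐ[μ] perturbedOp μ T v t f) ∧
      HypH1 μ v α p q ℓ ∧ HypH2 R α ℓ ∧ HypH3 (R 0) := by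
  have : Nonempty Ω := μ.nonempty_of_neZero
  obtain ⟨g, C, hg⟩ := exists_isWeight hGM
  obtain ⟨K, V, ht⟩ := exists_isTame hGM hv hvLip hextra
  refine ⟨BTheta.completeSpace hGM.theta_pos hGM.separating, fun f => ?_,
    fun c => ⟨BTheta.const hGM.theta_pos.le c, fun _ => rfl⟩, perturbedCLM hGM hg ht,
    perturbedCLM_ae_eq hGM hg ht, hH1, ?_, ?_⟩
  · have h1 := eLpNorm_top_eq_supNormE hGM hg f
    refine ⟨h1, ?_⟩
    rw [h1, ← ENNReal.ofReal_toReal f.mem.2.1.ne]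
    exact ENNReal.ofReal_le_ofReal f.sup_le_norm
  · rcases hα with hα | hα
    · exact hypH2_of_lt_one hGM hg ht hα.1 hα.2 (hH1.exists_integral_min_le hv hv2 hα.2)
    · have hT := hH1.hasTail hv
      refine hypH2_of_one_lt hGM hg ht hα.1 hα.2 ?_ (fun a ha haα => hT.integrable_rpow ha haα)
        (hH1.exists_integral_mul_min_le hv hv2 hα.1 hα.2 hℓ)
      exact (integrable_norm_iff hv.aestronglyMeasurable).1 (hT.integrable hα.1)
  · rw [perturbedCLM_zero]
    exact hypH3_gmOp hGM hmix hg
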